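/- **Syntax.** Types are $A,B ::= I \mid A+B \mid A\otimes B \mid A\multimap B \mid {!A}$; the non-linear types are $P,R ::= I \mid P+R \mid P\otimes R \mid {!A}$. Terms, up to renaming of bound variables, are $$m,n,p ::= x \mid * \mid m;n \mid \mathtt{left}_{A,B}\,m \mid \mathtt{right}_{A,B}\,m \mid \mathtt{case}\ m\ \mathtt{of}\ \{\mathtt{left}\ x\to n \mid \mathtt{right}\ y\to p\} \mid \langle m,n\rangle \mid \mathtt{let}\ \langle x,y\rangle = m\ \mathtt{in}\ n \mid \lambda x^A.m \mid mn \mid \mathtt{lift}\ m \mid \mathtt{force}\ m \mid \mathtt{rec}\ z^{!A}.m .$$ A context is a finite assignment of types to variables; $\Phi$ ranges over non-linear contexts (all types non-linear), $\Gamma,\Sigma$ over arbitrary contexts, and a comma denotes disjoint union. The calculi $\lambda_l$ and $\lambda_a$ share the following typing rules: * from $\Phi,\Gamma\vdash m:I$ and $\Phi,\Sigma\vdash n:A$ infer $\Phi,\Gamma,\Sigma\vdash m;n:A$; from $\Gamma\vdash m:{!A}$ infer $\Gamma\vdash\mathtt{force}\ m:A$; * from $\Gamma\vdash m:A$ infer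 $\Gamma\vdash\mathtt{left}_{A,B}m:A+B$; from $\Gamma\vdash m:B$ infer $\Gamma\vdash\mathtt{right}_{A,B}m:A+B$; * from $\Phi,\Gamma\vdash m:A+B$, $\Phi,\Sigma,x:A\vdash n:C$ and $\Phi,\Sigma,y:B\vdash p:C$ infer $\Phi,\Gamma,\Sigma\vdash \mathtt{case}\ m\ \mathtt{of}\ \{\mathtt{left}\ x\to n\mid\mathtt{right}\ y\to p\}:C$; * from $\Phi,\Gamma\vdash m:A$ and $\Phi,\Sigma\vdash n:B$ infer $\Phi,\Gamma,\Sigma\vdash\langle m,n\rangle:A\otimes B$; from $\Phi,\Gamma\vdash m:A\otimes B$ and $\Phi,\Sigma,x:A,y:B\vdash n:C$ infer $\Phi,\Gamma,\Sigma\vdash\mathtt{let}\ \langle x,y\rangle=m\ \mathtt{in}\ n:C$; * from $\Gamma,x:A\vdash m:B$ infer $\Gamma\vdash\lambda x^A.m:A\multimap B$; from $\Phi,\Gamma\vdash m:A\multimap B$ and $\Phi,\Sigma\vdash n:A$ infer $\Phi,\Gamma,\Sigma\vdash mn:B$; * from $\Phi,z:{!A}\vdash m:A$ infer $\Phi\vdash\mathtt{rec}\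 z^{!A}.m:A$. In addition, $\lambda_l$ has $\Phi,x:A\vdash x:A$, $\Phi\vdash *:I$, and from $\Phi\vdash m:A$ infer $\Phi\vdash\mathtt{lift}\ m:{!A}$; while $\lambda_a$ has $\Gamma,x:A\vdash x:A$, $\Gamma\vdash *:I$, from $\Phi\vdash m:A$ infer $\Phi,\Gamma\vdash\mathtt{lift}\ m:{!A}$, and from $\Phi,z:{!A}\vdash m:A$ infer $\Phi,\Gamma\vdash\mathtt{rec}\ z^{!A}.m:A$. **Evaluation.** $m\Downarrow v$ is the least relation with: $x\Downarrow x$, $*\Downarrow *$, $\lambda x.m\Downarrow\lambda x.m$, $\mathtt{lift}\ m\Downarrow\mathtt{lift}\ m$; $m;n\Downarrow v$ if $m\Downarrow *$ and $n\Downarrow v$; $\mathtt{left}\ m\Downarrow\mathtt{left}\ v$ and $\mathtt{right}\ m\Downarrow\mathtt{right}\ v$ if $m\Downarrow v$; the case term evaluates to $w$ if $m\Downarrow\mathtt{left}\ v$ and $n[v/x]\Downarrow w$, or $m\Downarrow\mathtt{right}\ v$ and $p[v/y]\Downarrow w$; $\langle m,n\rangle\Downarrow\langle v,w\rangle$ if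 $m\Downarrow v$ and $n\Downarrow w$; $\mathtt{let}\ \langle x,y\rangle=m\ \mathtt{in}\ n\Downarrow w$ if $m\Downarrow\langle v,v'\rangle$ and $n[v/x,v'/y]\Downarrow w$; $mn\Downarrow w$ if $m\Downarrow\lambda x.m'$, $n\Downarrow v$ and $m'[v/x]\Downarrow w$; $\mathtt{force}\ m\Downarrow v$ if $m\Downarrow\mathtt{lift}\ m'$ and $m'\Downarrow v$; $\mathtt{rec}\ z^{!A}.m\Downarrow v$ if $m[\mathtt{lift}\ \mathtt{rec}\ z^{!A}.m/z]\Downarrow v$. **Models.** A (compact) $\lambda_l$-model consists of a cartesian category $\mathbf B$ and symmetric monoidal categories $\mathbf V$, $\mathbf C$, all with finite coproducts; symmetric monoidal adjunctions $J\dashv K:\mathbf V\to\mathbf B$ and $L\dashv R:\mathbf C\to\mathbf V$ (with $J$, $L$ strong), where we put $F=LJ$, $G=KR$, ${!}=FG$ and let $\eta,\epsilon$ be the unit and counit of $F\dashv G$; for every $A\in\mathbf V$ an adjunction $L\circ(-\otimes A)\dashv(A\multimap-):\mathbf C\to\mathbf V$ (currying); and for every $X\in\mathbf B$ an initial algebra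 $\omega:FX\otimes{!\Omega_X}\to\Omega_X$ of the functor $FX\otimes{!(-)}$ such that $\omega^{-1}$ is a final coalgebra. A (compact) $\lambda_a$-model is a $\lambda_l$-model in which the tensor unit of $\mathbf V$ is terminal. **Interpretation.** Types are interpreted in $\mathbf C$ by $[\![I]\!]=I$, $[\![A+B]\!]=[\![A]\!]+[\![B]\!]$, $[\![A\otimes B]\!]=[\![A]\!]\otimes[\![B]\!]$, $[\![A\multimap B]\!]=L([\![A]\!]_V\multimap[\![B]\!])$, $[\![{!A}]\!]={!}[\![A]\!]$; in $\mathbf V$ in the same way, except that $[\![A\multimap B]\!]_V=[\![A]\!]_V\multimap[\![B]\!]$ and $[\![{!A}]\!]_V=JG[\![A]\!]$; and the non-linear types in $\mathbf B$ in the same way with $\times$ for $\otimes$ and $[\![{!A}]\!]_B=G[\![A]\!]$. Contexts are interpreted as tensor products (in $\mathbf B$, for non-linear contexts: products). There are canonical isomorphisms $[\![\Gamma]\!]\cong L[\![\Gamma]\!]_V$ and $[\![\Phi]\!]\cong F[\![\Phi]\!]_B$ and likewise for types; they and the structural isomorphisms (associativity, unit, symmetry, the strong monoidal structure of $J$, $L$,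 and preservation of coproducts) are left implicit below. On non-linear contexts, discarding $\diamond:[\![\Phi]\!]\to I$, copying $\triangle:[\![\Phi]\!]\to[\![\Phi]\!]\otimes[\![\Phi]\!]$ and promotion $\Box:[\![\Phi]\!]\to{!}[\![\Phi]\!]$ are the images under $F$ of the terminal map, the diagonal and $\eta$; in a $\lambda_a$-model, $\diamond:[\![\Gamma]\!]\to I$ is defined on every context as the image under $L$ of the unique map $[\![\Gamma]\!]_V\to I$. A derivation of $\Gamma\vdash m:A$ is interpreted as a morphism $[\![m]\!]:[\![\Gamma]\!]\to[\![A]\!]$ of $\mathbf C$ by induction. Each rule with conclusion context $\Phi,\Gamma,\Sigma$ first applies $\triangle$ to $[\![\Phi]\!]$ and rearranges, giving $[\![\Phi,\Gamma]\!]\otimes[\![\Phi,\Sigma]\!]$, after which $m;n$ and $\langle m,n\rangle$ are $[\![m]\!]\otimes[\![n]\!]$; $mn$ is $\mathrm{eval}\circ([\![m]\!]\otimes[\![n]\!])$ with $\mathrm{eval}$ the counit of currying; $\mathtt{let}$ applies $[\![m]\!]$ and then $[\![n]\!]$; and $\mathtt{case}$ applies $[\![m]\!]$, the distributivity isomorphism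 $[\![\Phi,\Sigma]\!]\otimes([\![A]\!]+[\![B]\!])\cong[\![\Phi,\Sigma]\!]\otimes[\![A]\!]+[\![\Phi,\Sigma]\!]\otimes[\![B]\!]$ and then $[[\![n]\!],[\![p]\!]]$. Variables and $*$ discard the rest of the context with $\diamond$; $\mathtt{left}$ and $\mathtt{right}$ are composition with the coproduct injections; $[\![\lambda x^A.m]\!]=L(\mathbf{curry}[\![m]\!])$; $[\![\mathtt{lift}\ m]\!]={!}[\![m]\!]\circ\Box$; $[\![\mathtt{force}\ m]\!]=\epsilon\circ[\![m]\!]$; and $[\![\mathtt{rec}\ z^{!A}.m]\!]=\sigma\circ\gamma$, where, for $X=[\![\Phi]\!]_B$, $\gamma:FX\to\Omega_X$ is the unique coalgebra morphism from $(\mathrm{id}\otimes\Box)\circ\triangle:FX\to FX\otimes{!FX}$, and $\sigma:\Omega_X\to[\![A]\!]$ is the unique algebra morphism to $[\![m]\!]:FX\otimes{!}[\![A]\!]\to[\![A]\!]$. In the rules of $\lambda_a$ for $\mathtt{lift}$ and $\mathtt{rec}$ with context $\Phi,\Gamma$, the part $\Gamma$ is first discarded with $\diamond$. **Theorem (Soundness).**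 In $\lambda_l$, suppose $\Gamma\vdash m:A$ and $m\Downarrow v$. Then $\Gamma\vdash v:A$, and in every $\lambda_l$-model $[\![m]\!]=[\![v]\!]$, for all derivations of $\Gamma\vdash m:A$ and of $\Gamma\vdash v:A$. Likewise in $\lambda_a$, suppose $\Gamma\vdash m:A$ and $m\Downarrow v$. Then $\Gamma\vdash v:A$, and in every $\lambda_a$-model $[\![m]\!]=[\![v]\!]$, for all derivations of $\Gamma\vdash m:A$ and of $\Gamma\vdash v:A$. -/

import Mathlib

open CategoryTheory CategoryTheory.Limits MonoidalCategory

universe v₁ v₂ v₃ u₁ u₂ u₃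

namespace SubLambda

/-! ## Types, terms, contexts -/

/-- Types `I | A + B | A ⊗ B | A ⊸ B | !A`. -/
inductive Ty : Type
  | unit : Ty
  | sum : Ty → Ty → Ty
  | tensor : Ty → Ty → Ty
  | lolli : Ty → Ty → Ty
  | bang : Ty → Ty

/-- The non-linear types `P, R ::= I | P + R | P ⊗ R | !A`. -/
def Ty.NonLinear : Ty → Prop
  | .unit => True
  | .sum P R => P.NonLinear ∧ R.NonLinear
  | .tensor P R => P.NonLinear ∧ R.NonLinear
  | .lolli _ _ => False
  | .bang _ => True

/-- Terms up to renaming of bound variables, with de Bruijn indices. In `case m n p` each of `n` and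
`p` binds index `0`; in `letPair m n` (that is `let ⟨x, y⟩ = m in n`) the variable `x` is index `1`
and `y` is index `0` of `n`; `recur A m` is `rec z^{!A}. m`. -/
inductive Tm : Type
  | var : ℕ → Tm
  | star : Tm
  | seq : Tm → Tm → Tm
  | left : Ty → Ty → Tm → Tm
  | right : Ty → Ty → Tm → Tm
  | case : Tm → Tm → Tm → Tm
  | pair : Tm → Tm → Tm
  | letPair : Tm → Tm → Tm
  | lam : Ty → Tm → Tm
  | app : Tm → Tm → Tm
  | lift : Tm → Tm
  | force : Tm → Tm
  | recur : Ty → Tm → Tm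

namespace Tm

/-- A renaming under one more binder. -/
def upRen (ρ : ℕ → ℕ) : ℕ → ℕ
  | 0 => 0
  | i + 1 => ρ i + 1

/-- Renaming of the free variables. -/
def rename : (ℕ → ℕ) → Tm → Tm
  | ρ, .var i => .var (ρ i)
  | _, .star => .star
  | ρ, .seq m n => .seq (rename ρ m) (rename ρ n)
  | ρ, .left A B m => .left A B (rename ρ m)
  | ρ, .right A B m => .right A B (rename ρ m)
  | ρ, .case m n p => .case (rename ρ m) (rename (upRen ρ) n) (rename (upRen ρ) p)
  | ρ, .pair m n => .pair (rename ρ m) (rename ρ n)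
  | ρ, .letPair m n => .letPair (rename ρ m) (rename (upRen (upRen ρ)) n)
  | ρ, .lam A m => .lam A (rename (upRen ρ) m)
  | ρ, .app m n => .app (rename ρ m) (rename ρ n)
  | ρ, .lift m => .lift (rename ρ m)
  | ρ, .force m => .force (rename ρ m)
  | ρ, .recur A m => .recur A (rename (upRen ρ) m)

/-- A simultaneous substitution under one more binder. -/
def upSub (σ : ℕ → Tm) : ℕ → Tm
  | 0 => .var 0
  | i + 1 => rename Nat.succ (σ i)

/-- Simultaneous capture-avoiding substitution. -/
def subst : (ℕ → Tm) → Tm → Tm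
  | σ, .var i => σ i
  | _, .star => .star
  | σ, .seq m n => .seq (subst σ m) (subst σ n)
  | σ, .left A B m => .left A B (subst σ m)
  | σ, .right A B m => .right A B (subst σ m)
  | σ, .case m n p => .case (subst σ m) (subst (upSub σ) n) (subst (upSub σ) p)
  | σ, .pair m n => .pair (subst σ m) (subst σ n)
  | σ, .letPair m n => .letPair (subst σ m) (subst (upSub (upSub σ)) n)
  | σ, .lam A m => .lam A (subst (upSub σ) m)
  | σ, .app m n => .app (subst σ m) (subst σ n)
  | σ, .lift m => .lift (subst σ m)
  | σ, .force m => .force (subst σ m)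
  | σ, .recur A m => .recur A (subst (upSub σ) m)

/-- The substitution `0 ↦ v`, `i + 1 ↦ i`. -/
def scons (v : Tm) (σ : ℕ → Tm) : ℕ → Tm
  | 0 => v
  | i + 1 => σ i

/-- `m[v/x]`, where `x` is index `0` of `m`. -/
def subst1 (m v : Tm) : Tm := m.subst (scons v .var)

/-- `m[v/x, w/y]`, where `x` is index `1` and `y` is index `0` of `m`. -/
def subst2 (m v w : Tm) : Tm := m.subst (scons w (scons v .var))

end Tm

/-- Values `x | * | left v | right v | ⟨v, w⟩ | λx.m | lift m`. -/
inductive IsValue : Tm → Prop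
  | var (i : ℕ) : IsValue (.var i)
  | star : IsValue .star
  | left {A B : Ty} {v : Tm} : IsValue v → IsValue (.left A B v)
  | right {A B : Ty} {v : Tm} : IsValue v → IsValue (.right A B v)
  | pair {v w : Tm} : IsValue v → IsValue w → IsValue (.pair v w)
  | lam (A : Ty) (m : Tm) : IsValue (.lam A m)
  | lift (m : Tm) : IsValue (.lift m)

/-- The big-step call-by-value reduction relation `m ⇓ v`. -/
inductive Eval : Tm → Tm → Prop
  | var (i : ℕ) : Eval (.var i) (.var i)
  | star : Eval .star .star
  | seq {m n v : Tm} : Eval m .star → Eval n v → Eval (.seq m n) v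
  | left {A B : Ty} {m v : Tm} : Eval m v → Eval (.left A B m) (.left A B v)
  | right {A B : Ty} {m v : Tm} : Eval m v → Eval (.right A B m) (.right A B v)
  | caseLeft {A B : Ty} {m n p v w : Tm} :
      Eval m (.left A B v) → Eval (n.subst1 v) w → Eval (.case m n p) w
  | caseRight {A B : Ty} {m n p v w : Tm} :
      Eval m (.right A B v) → Eval (p.subst1 v) w → Eval (.case m n p) w
  | pair {m n v w : Tm} : Eval m v → Eval n w → Eval (.pair m n) (.pair v w)
  | letPair {m n v v' w : Tm} :
      Eval m (.pair v v') → Eval (n.subst2 v v') w → Eval (.letPair m n) w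
  | lam (A : Ty) (m : Tm) : Eval (.lam A m) (.lam A m)
  | app {A : Ty} {m n m' v w : Tm} :
      Eval m (.lam A m') → Eval n v → Eval (m'.subst1 v) w → Eval (.app m n) w
  | lift (m : Tm) : Eval (.lift m) (.lift m)
  | force {m m' v : Tm} : Eval m (.lift m') → Eval m' v → Eval (.force m) v
  | recur {A : Ty} {m v : Tm} :
      Eval (m.subst1 (.lift (.recur A m))) v → Eval (.recur A m) v

/-- The results of evaluation are values. -/
theorem Eval.isValue {m v : Tm} (h : Eval m v) : IsValue v := by
  induction h <;> first | assumption | (constructor <;> assumption)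

/-- A context is a finite assignment of types to variables: if entry `i` of the list is `some A`
then the context declares `xᵢ : A`, and if it is `none` then the variable `xᵢ` is not declared. -/
abbrev Ctx : Type := List (Option Ty)

/-- Contexts that declare only variables of non-linear types. -/
def Ctx.NonLinear : Ctx → Prop
  | [] => True
  | none :: Φ => Ctx.NonLinear Φ
  | some P :: Φ => Ctx.NonLinear Φ ∧ P.NonLinear

/-- `Insert Γ i A Θ`: the context `Θ` is `Γ, xᵢ : A`, the variable `xᵢ` being undeclared in `Γ`. -/
inductive Insert : Ctx → ℕ → Ty → Ctx → Type
  | here (Γ : Ctx) (A : Ty) : Insert (none :: Γ) 0 A (some A :: Γ)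
  | there (o : Option Ty) {Γ : Ctx} {i : ℕ} {A : Ty} {Θ : Ctx} :
      Insert Γ i A Θ → Insert (o :: Γ) (i + 1) A (o :: Θ)

/-- `Union Γ Δ Θ`: the context `Θ` is the union `Γ, Δ` of the disjoint contexts `Γ` and `Δ`. -/
inductive Union : Ctx → Ctx → Ctx → Type
  | nil : Union [] [] []
  | skip {Γ Δ Θ : Ctx} : Union Γ Δ Θ → Union (none :: Γ) (none :: Δ) (none :: Θ)
  | inl (A : Ty) {Γ Δ Θ : Ctx} : Union Γ Δ Θ → Union (some A :: Γ) (none :: Δ) (some A :: Θ)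
  | inr (A : Ty) {Γ Δ Θ : Ctx} : Union Γ Δ Θ → Union (none :: Γ) (some A :: Δ) (some A :: Θ)

/-- A presentation of contexts `Γ₁`, `Γ₂`, `Θ` as `Γ₁ = Φ, Γ` and `Γ₂ = Φ, Δ` and `Θ = Φ, Γ, Δ`
with `Φ` non-linear: the context management of the rules with several premises. -/
structure Split (Γ₁ Γ₂ Θ : Ctx) : Type where
  (Φ Γ Δ : Ctx)
  nonLinear : Φ.NonLinear
  first : Union Φ Γ Γ₁
  second : Union Φ Δ Γ₂
  total : Union Γ₁ Δ Θ

/-- The two calculi `λ_l` and `λ_a`. -/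
inductive Calculus : Type
  | linear : Calculus
  | affine : Calculus

/-- Derivations of `Γ ⊢ m : A` in either calculus. The rules whose names end in `L` and `A` belong to
`λ_l` and `λ_a` only. The rule `recurA` is the weakened form of `recur`, exactly as `liftA` is of
`lift`: in `λ_a` all variables are discardable, and without it weakening by a linear variable and
subject reduction fail in `λ_a` (see `(λ f^{I⊸I}. λ a^{I⊸I}. f) (λ b^I. rec z^{!I}. force z)`). -/
inductive Der : Calculus → Ctx → Tm → Ty → Type
  | varL {Φ Θ : Ctx} {i : ℕ} {A : Ty} :
      Φ.NonLinear → Insert Φ i A Θ → Der .linear Θ (.var i) A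
  | starL {Φ : Ctx} : Φ.NonLinear → Der .linear Φ .star .unit
  | liftL {Φ : Ctx} {m : Tm} {A : Ty} :
      Φ.NonLinear → Der .linear Φ m A → Der .linear Φ (.lift m) (.bang A)
  | varA {Γ Θ : Ctx} {i : ℕ} {A : Ty} : Insert Γ i A Θ → Der .affine Θ (.var i) A
  | starA {Γ : Ctx} : Der .affine Γ .star .unit
  | liftA {Φ Γ Θ : Ctx} {m : Tm} {A : Ty} :
      Φ.NonLinear → Union Φ Γ Θ → Der .affine Φ m A → Der .affine Θ (.lift m) (.bang A)
  | recurA {Φ Γ Θ : Ctx} {m : Tm} {A : Ty} :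
      Φ.NonLinear → Union Φ Γ Θ → Der .affine (some (.bang A) :: Φ) m A →
      Der .affine Θ (.recur A m) A
  | seq {c : Calculus} {Γ₁ Γ₂ Θ : Ctx} {m n : Tm} {A : Ty} :
      Split Γ₁ Γ₂ Θ → Der c Γ₁ m .unit → Der c Γ₂ n A → Der c Θ (.seq m n) A
  | force {c : Calculus} {Γ : Ctx} {m : Tm} {A : Ty} :
      Der c Γ m (.bang A) → Der c Γ (.force m) A
  | left {c : Calculus} {Γ : Ctx} {m : Tm} {A B : Ty} :
      Der c Γ m A → Der c Γ (.left A B m) (.sum A B)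
  | right {c : Calculus} {Γ : Ctx} {m : Tm} {A B : Ty} :
      Der c Γ m B → Der c Γ (.right A B m) (.sum A B)
  | case {c : Calculus} {Γ₁ Γ₂ Θ : Ctx} {m n p : Tm} {A B D : Ty} :
      Split Γ₁ Γ₂ Θ → Der c Γ₁ m (.sum A B) → Der c (some A :: Γ₂) n D →
      Der c (some B :: Γ₂) p D → Der c Θ (.case m n p) D
  | pair {c : Calculus} {Γ₁ Γ₂ Θ : Ctx} {m n : Tm} {A B : Ty} :
      Split Γ₁ Γ₂ Θ → Der c Γ₁ m A → Der c Γ₂ n B → Der c Θ (.pair m n) (.tensor A B)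
  | letPair {c : Calculus} {Γ₁ Γ₂ Θ : Ctx} {m n : Tm} {A B D : Ty} :
      Split Γ₁ Γ₂ Θ → Der c Γ₁ m (.tensor A B) → Der c (some B :: some A :: Γ₂) n D →
      Der c Θ (.letPair m n) D
  | lam {c : Calculus} {Γ : Ctx} {m : Tm} {A B : Ty} :
      Der c (some A :: Γ) m B → Der c Γ (.lam A m) (.lolli A B)
  | app {c : Calculus} {Γ₁ Γ₂ Θ : Ctx} {m n : Tm} {A B : Ty} :
      Split Γ₁ Γ₂ Θ → Der c Γ₁ m (.lolli A B) → Der c Γ₂ n A → Der c Θ (.app m n) B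
  | recur {c : Calculus} {Φ : Ctx} {m : Tm} {A : Ty} :
      Φ.NonLinear → Der c (some (.bang A) :: Φ) m A → Der c Φ (.recur A m) A

/-! ## Models -/

noncomputable section

/-- A (compact) `λ_l`-model on a cartesian category `B` and symmetric monoidal categories `V`, `C`,
all with finite coproducts. -/
structure LinearModel (B : Type u₁) [Category.{v₁} B] [CartesianMonoidalCategory B]
    [BraidedCategory B] [HasFiniteCoproducts B]
    (V : Type u₂) [Category.{v₂} V] [MonoidalCategory V] [SymmetricCategory V]
    [HasFiniteCoproducts V]
    (C : Type u₃) [Category.{v₃} C] [MonoidalCategory C] [SymmetricCategory C]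
    [HasFiniteCoproducts C] where
  J : B ⥤ V
  K : V ⥤ B
  L : V ⥤ C
  R : C ⥤ V
  -- the symmetric monoidal adjunction `J ⊣ K`
  [braidedJ : J.Braided]
  [laxBraidedK : K.LaxBraided]
  adjJK : J ⊣ K
  monoidalJK : adjJK.IsMonoidal
  -- the symmetric monoidal adjunction `L ⊣ R`
  [braidedL : L.Braided]
  [laxBraidedR : R.LaxBraided]
  adjLR : L ⊣ R
  monoidalLR : adjLR.IsMonoidal
  /-- The functors `A ⊸ - : C ⥤ V`. -/
  hom : V → (C ⥤ V)
  /-- Currying: `L ∘ (- ⊗ A) ⊣ (A ⊸ -)`. -/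
  adjHom (A : V) : tensorRight A ⋙ L ⊣ hom A
  /-- The initial algebra `ω : F X ⊗ !Ω ⟶ Ω` of `F X ⊗ !(-)`, where `F = L J` and `! = L J K R`. -/
  omega (X : B) :
    Endofunctor.Algebra (((R ⋙ K) ⋙ J ⋙ L) ⋙ tensorLeft ((J ⋙ L).obj X))
  omegaInitial (X : B) : IsInitial (omega X)
  /-- `ω⁻¹ : Ω ⟶ F X ⊗ !Ω` is a final coalgebra. -/
  omegaFinal (X : B) :
    IsTerminal (⟨(omega X).a, Endofunctor.Algebra.Initial.strInv (omegaInitial X)⟩ :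
      Endofunctor.Coalgebra (((R ⋙ K) ⋙ J ⋙ L) ⋙ tensorLeft ((J ⋙ L).obj X)))

attribute [instance] LinearModel.braidedJ LinearModel.laxBraidedK LinearModel.braidedL
  LinearModel.laxBraidedR LinearModel.monoidalJK LinearModel.monoidalLR

/-- A (compact) `λ_a`-model: a `λ_l`-model in which the tensor unit of `V` is terminal. -/
structure AffineModel (B : Type u₁) [Category.{v₁} B] [CartesianMonoidalCategory B]
    [BraidedCategory B] [HasFiniteCoproducts B]
    (V : Type u₂) [Category.{v₂} V] [MonoidalCategory V] [SymmetricCategory V]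
    [HasFiniteCoproducts V]
    (C : Type u₃) [Category.{v₃} C] [MonoidalCategory C] [SymmetricCategory C]
    [HasFiniteCoproducts C] extends LinearModel B V C where
  unitTerminal : IsTerminal (𝟙_ V)

namespace LinearModel

variable {B : Type u₁} [Category.{v₁} B] [CartesianMonoidalCategory B]
  [BraidedCategory B] [HasFiniteCoproducts B]
  {V : Type u₂} [Category.{v₂} V] [MonoidalCategory V] [SymmetricCategory V]
  [HasFiniteCoproducts V]
  {C : Type u₃} [Category.{v₃} C] [MonoidalCategory C] [SymmetricCategory C]
  [HasFiniteCoproducts C]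
  (M : LinearModel B V C)

/-- `F = L J`. -/
abbrev F : B ⥤ C := M.J ⋙ M.L

/-- `G = K R`. -/
abbrev G : C ⥤ B := M.R ⋙ M.K

/-- `! = F G`. -/
abbrev bang : C ⥤ C := M.G ⋙ M.F

/-- The composite adjunction `F ⊣ G`. -/
def adjFG : M.F ⊣ M.G := M.adjJK.comp M.adjLR

instance : PreservesColimitsOfSize.{0, 0} M.J := M.adjJK.leftAdjoint_preservesColimits

instance : PreservesColimitsOfSize.{0, 0} M.L := M.adjLR.leftAdjoint_preservesColimits

instance (A : V) : PreservesColimitsOfSize.{0, 0} (tensorRight A ⋙ M.L) :=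
  (M.adjHom A).leftAdjoint_preservesColimits

/-! ### Interpretation of types and contexts -/

/-- The interpretations `⟦A⟧` in `C` and `⟦A⟧` in `V`, by simultaneous induction. -/
@[reducible] def ty : Ty → C × V
  | .unit => (𝟙_ C, 𝟙_ V)
  | .sum A B => ((ty A).1 ⨿ (ty B).1, (ty A).2 ⨿ (ty B).2)
  | .tensor A B => ((ty A).1 ⊗ (ty B).1, (ty A).2 ⊗ (ty B).2)
  | .lolli A B => (M.L.obj ((M.hom (ty A).2).obj (ty B).1), (M.hom (ty A).2).obj (ty B).1)
  | .bang A => (M.bang.obj (ty A).1, M.J.obj (M.G.obj (ty A).1))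

/-- `⟦A⟧` in `C`. -/
@[reducible] def tyC (A : Ty) : C := (M.ty A).1

/-- `⟦A⟧` in `V`. -/
@[reducible] def tyV (A : Ty) : V := (M.ty A).2

/-- `⟦P⟧` in `B`, for non-linear `P`. -/
@[reducible] def tyB : (P : Ty) → P.NonLinear → B
  | .unit, _ => 𝟙_ B
  | .sum P R, h => tyB P h.1 ⨿ tyB R h.2
  | .tensor P R, h => tyB P h.1 ⊗ tyB R h.2
  | .lolli _ _, h => h.elim
  | .bang A, _ => M.G.obj (M.tyC A)

/-- `L⟦A⟧ ≅ ⟦A⟧`. -/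
def tyIsoC : (A : Ty) → (M.L.obj (M.tyV A) ≅ M.tyC A)
  | .unit => (Functor.Monoidal.εIso M.L).symm
  | .sum A B => (PreservesColimitPair.iso M.L (M.tyV A) (M.tyV B)).symm ≪≫
      coprod.mapIso (tyIsoC A) (tyIsoC B)
  | .tensor A B => (Functor.Monoidal.μIso M.L (M.tyV A) (M.tyV B)).symm ≪≫
      tensorIso (tyIsoC A) (tyIsoC B)
  | .lolli _ _ => Iso.refl _
  | .bang _ => Iso.refl _

/-- `J⟦P⟧ ≅ ⟦P⟧`. -/
def tyIsoV : (P : Ty) → (h : P.NonLinear) → (M.J.obj (M.tyB P h) ≅ M.tyV P)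
  | .unit, _ => (Functor.Monoidal.εIso M.J).symm
  | .sum P R, h => (PreservesColimitPair.iso M.J (M.tyB P h.1) (M.tyB R h.2)).symm ≪≫
      coprod.mapIso (tyIsoV P h.1) (tyIsoV R h.2)
  | .tensor P R, h => (Functor.Monoidal.μIso M.J (M.tyB P h.1) (M.tyB R h.2)).symm ≪≫
      tensorIso (tyIsoV P h.1) (tyIsoV R h.2)
  | .lolli _ _, h => h.elim
  | .bang _, _ => Iso.refl _

/-- `⟦Γ⟧` in `C`. -/
@[reducible] def ctxC : Ctx → C
  | [] => 𝟙_ C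
  | none :: Γ => ctxC Γ
  | some A :: Γ => ctxC Γ ⊗ M.tyC A

/-- `⟦Γ⟧` in `V`. -/
@[reducible] def ctxV : Ctx → V
  | [] => 𝟙_ V
  | none :: Γ => ctxV Γ
  | some A :: Γ => ctxV Γ ⊗ M.tyV A

/-- `⟦Φ⟧` in `B`, for non-linear `Φ`. -/
@[reducible] def ctxB : (Φ : Ctx) → Φ.NonLinear → B
  | [], _ => 𝟙_ B
  | none :: Φ, h => ctxB Φ h
  | some P :: Φ, h => ctxB Φ h.1 ⊗ M.tyB P h.2

/-- `L⟦Γ⟧ ≅ ⟦Γ⟧`. -/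
def ctxIsoC : (Γ : Ctx) → (M.L.obj (M.ctxV Γ) ≅ M.ctxC Γ)
  | [] => (Functor.Monoidal.εIso M.L).symm
  | none :: Γ => ctxIsoC Γ
  | some A :: Γ => (Functor.Monoidal.μIso M.L (M.ctxV Γ) (M.tyV A)).symm ≪≫
      tensorIso (ctxIsoC Γ) (M.tyIsoC A)

/-- `J⟦Φ⟧ ≅ ⟦Φ⟧`. -/
def ctxIsoV : (Φ : Ctx) → (h : Φ.NonLinear) → (M.J.obj (M.ctxB Φ h) ≅ M.ctxV Φ)
  | [], _ => (Functor.Monoidal.εIso M.J).symm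
  | none :: Φ, h => ctxIsoV Φ h
  | some P :: Φ, h => (Functor.Monoidal.μIso M.J (M.ctxB Φ h.1) (M.tyB P h.2)).symm ≪≫
      tensorIso (ctxIsoV Φ h.1) (M.tyIsoV P h.2)

/-- `F⟦Φ⟧ ≅ ⟦Φ⟧`. -/
def ctxIsoF (Φ : Ctx) (h : Φ.NonLinear) : M.F.obj (M.ctxB Φ h) ≅ M.ctxC Φ :=
  M.L.mapIso (M.ctxIsoV Φ h) ≪≫ M.ctxIsoC Φ

/-! ### Structural and substructural morphisms -/

/-- `⟦Γ, xᵢ : A⟧ ≅ ⟦Γ⟧ ⊗ ⟦A⟧`. -/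
def insertIso : {Γ : Ctx} → {i : ℕ} → {A : Ty} → {Θ : Ctx} → Insert Γ i A Θ →
    (M.ctxC Θ ≅ M.ctxC Γ ⊗ M.tyC A)
  | _, _, _, _, .here _ _ => Iso.refl _
  | _, _, _, _, .there none s => (insertIso s :)
  | _, _, _, _, .there (some D) (Γ := Γ) (A := A) s =>
      whiskerRightIso (insertIso s) (M.tyC D) ≪≫ α_ (M.ctxC Γ) (M.tyC A) (M.tyC D) ≪≫
        whiskerLeftIso (M.ctxC Γ) (β_ (M.tyC A) (M.tyC D)) ≪≫
        (α_ (M.ctxC Γ) (M.tyC D) (M.tyC A)).symm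

/-- `⟦Γ, Δ⟧ ≅ ⟦Γ⟧ ⊗ ⟦Δ⟧`. -/
def unionIso : {Γ Δ Θ : Ctx} → Union Γ Δ Θ → (M.ctxC Θ ≅ M.ctxC Γ ⊗ M.ctxC Δ)
  | _, _, _, .nil => (λ_ (𝟙_ C)).symm
  | _, _, _, .skip s => (unionIso s :)
  | _, _, _, .inl A (Γ := Γ) (Δ := Δ) s =>
      whiskerRightIso (unionIso s) (M.tyC A) ≪≫ α_ (M.ctxC Γ) (M.ctxC Δ) (M.tyC A) ≪≫
        whiskerLeftIso (M.ctxC Γ) (β_ (M.ctxC Δ) (M.tyC A)) ≪≫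
        (α_ (M.ctxC Γ) (M.tyC A) (M.ctxC Δ)).symm
  | _, _, _, .inr A (Γ := Γ) (Δ := Δ) s =>
      whiskerRightIso (unionIso s) (M.tyC A) ≪≫ α_ (M.ctxC Γ) (M.ctxC Δ) (M.tyC A)

/-- Discarding `⟦Φ⟧ ⟶ I`. -/
def discard (Φ : Ctx) (h : Φ.NonLinear) : M.ctxC Φ ⟶ 𝟙_ C :=
  (M.ctxIsoF Φ h).inv ≫ M.F.map (SemiCartesianMonoidalCategory.toUnit (M.ctxB Φ h)) ≫
    Functor.OplaxMonoidal.η M.F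

/-- Copying `⟦Φ⟧ ⟶ ⟦Φ⟧ ⊗ ⟦Φ⟧`. -/
def copy (Φ : Ctx) (h : Φ.NonLinear) : M.ctxC Φ ⟶ M.ctxC Φ ⊗ M.ctxC Φ :=
  (M.ctxIsoF Φ h).inv ≫ M.F.map (CartesianMonoidalCategory.lift (𝟙 _) (𝟙 _)) ≫
    Functor.OplaxMonoidal.δ M.F (M.ctxB Φ h) (M.ctxB Φ h) ≫
    ((M.ctxIsoF Φ h).hom ⊗ₘ (M.ctxIsoF Φ h).hom)

/-- Promotion `⟦Φ⟧ ⟶ !⟦Φ⟧`. -/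
def promote (Φ : Ctx) (h : Φ.NonLinear) : M.ctxC Φ ⟶ M.bang.obj (M.ctxC Φ) :=
  (M.ctxIsoF Φ h).inv ≫ M.F.map (M.adjFG.unit.app (M.ctxB Φ h)) ≫
    M.bang.map (M.ctxIsoF Φ h).hom

/-- Discarding of an arbitrary context `⟦Γ⟧ ⟶ I` when the tensor unit of `V` is terminal. -/
def discardAll (t : IsTerminal (𝟙_ V)) (Γ : Ctx) : M.ctxC Γ ⟶ 𝟙_ C :=
  (M.ctxIsoC Γ).inv ≫ M.L.map (t.from (M.ctxV Γ)) ≫ Functor.OplaxMonoidal.η M.L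

/-- `⟦Φ, Γ, Δ⟧ ⟶ ⟦Φ⟧ ⊗ ⟦Φ⟧ ⊗ ⟦Γ⟧ ⊗ ⟦Δ⟧ ≅ ⟦Φ, Γ⟧ ⊗ ⟦Φ, Δ⟧`, copying `Φ`. -/
def split {Γ₁ Γ₂ Θ : Ctx} (s : Split Γ₁ Γ₂ Θ) : M.ctxC Θ ⟶ M.ctxC Γ₁ ⊗ M.ctxC Γ₂ :=
  (M.unionIso s.total).hom ≫ (M.unionIso s.first).hom ▷ M.ctxC s.Δ ≫
    (M.copy s.Φ s.nonLinear ▷ M.ctxC s.Γ) ▷ M.ctxC s.Δ ≫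
    (α_ (M.ctxC s.Φ ⊗ M.ctxC s.Φ) (M.ctxC s.Γ) (M.ctxC s.Δ)).hom ≫
    tensorμ (M.ctxC s.Φ) (M.ctxC s.Φ) (M.ctxC s.Γ) (M.ctxC s.Δ) ≫
    ((M.unionIso s.first).inv ⊗ₘ (M.unionIso s.second).inv)

/-- Distributivity of `⊗` over `+` in the image of `L`:
`⟦Γ⟧ ⊗ (⟦A⟧ + ⟦B⟧) ≅ (⟦Γ⟧ ⊗ ⟦A⟧) + (⟦Γ⟧ ⊗ ⟦B⟧)`, since `L ∘ (- ⊗ ⟦Γ⟧)` preserves coproducts. -/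
def distrib (Γ : Ctx) (A B : Ty) :
    M.ctxC Γ ⊗ M.tyC (.sum A B) ≅ (M.ctxC Γ ⊗ M.tyC A) ⨿ (M.ctxC Γ ⊗ M.tyC B) :=
  -- `L (⟦D⟧ ⊗ ⟦Γ⟧) ≅ ⟦Γ⟧ ⊗ ⟦D⟧`
  let e : (D : Ty) → ((tensorRight (M.ctxV Γ) ⋙ M.L).obj (M.tyV D) ≅ M.ctxC Γ ⊗ M.tyC D) :=
    fun D => (Functor.Monoidal.μIso M.L (M.tyV D) (M.ctxV Γ)).symm ≪≫
      tensorIso (M.tyIsoC D) (M.ctxIsoC Γ) ≪≫ β_ (M.tyC D) (M.ctxC Γ)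
  (e (.sum A B)).symm ≪≫
    (PreservesColimitPair.iso (tensorRight (M.ctxV Γ) ⋙ M.L) (M.tyV A) (M.tyV B)).symm ≪≫
    coprod.mapIso (e A) (e B)

/-- `curry f : ⟦Γ⟧ ⟶ ⟦A⟧ ⊸ ⟦B⟧` in `V`, for `f : ⟦Γ, x : A⟧ ⟶ ⟦B⟧` in `C`. -/
def curry {Γ : Ctx} {A B : Ty} (f : M.ctxC (some A :: Γ) ⟶ M.tyC B) :
    M.ctxV Γ ⟶ M.tyV (.lolli A B) :=
  ((M.adjHom (M.tyV A)).homEquiv (M.ctxV Γ) (M.tyC B)) ((M.ctxIsoC (some A :: Γ)).hom ≫ f)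

/-- `eval : ⟦A ⊸ B⟧ ⊗ ⟦A⟧ ≅ L ((⟦A⟧ ⊸ ⟦B⟧) ⊗ ⟦A⟧) ⟶ ⟦B⟧`. -/
def eval (A B : Ty) : M.tyC (.lolli A B) ⊗ M.tyC A ⟶ M.tyC B :=
  ((M.tyIsoC (.lolli A B)).inv ⊗ₘ (M.tyIsoC A).inv) ≫
    Functor.LaxMonoidal.μ M.L (M.tyV (.lolli A B)) (M.tyV A) ≫
    (M.adjHom (M.tyV A)).counit.app (M.tyC B)

/-- The functor `F X ⊗ !(-)`. -/
abbrev recFunctor (X : B) : C ⥤ C := M.bang ⋙ tensorLeft (M.F.obj X)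

/-- The coalgebra `F X ⟶ F X ⊗ F X ⟶ F X ⊗ !F X`, copying and then promoting the second copy. -/
def unfoldCoalgebra (X : B) : Endofunctor.Coalgebra (M.recFunctor X) where
  V := M.F.obj X
  str := M.F.map (CartesianMonoidalCategory.lift (𝟙 X) (𝟙 X)) ≫
    Functor.OplaxMonoidal.δ M.F X X ≫ M.F.obj X ◁ M.F.map (M.adjFG.unit.app X)

/-- `γ : F X ⟶ Ω`, the unique coalgebra morphism to the final coalgebra. -/
def gamma (X : B) : M.F.obj X ⟶ (M.omega X).a :=
  ((M.omegaFinal X).from (M.unfoldCoalgebra X)).f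

/-- `σ_m : Ω ⟶ D`, the unique algebra morphism from the initial algebra to `m : F X ⊗ !D ⟶ D`. -/
def sigma (X : B) {D : C} (m : M.F.obj X ⊗ M.bang.obj D ⟶ D) : (M.omega X).a ⟶ D :=
  ((M.omegaInitial X).to (⟨D, m⟩ : Endofunctor.Algebra (M.recFunctor X))).f

/-- `⟦lift m⟧`, given `⟦m⟧`. -/
def liftMap {Φ : Ctx} (h : Φ.NonLinear) {A : Ty} (f : M.ctxC Φ ⟶ M.tyC A) :
    M.ctxC Φ ⟶ M.tyC (.bang A) :=
  M.promote Φ h ≫ M.bang.map f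

/-- `⟦rec z. m⟧ = σ_{⟦m⟧} ∘ γ`, given `⟦m⟧`. -/
def recMap {Φ : Ctx} (h : Φ.NonLinear) {A : Ty} (f : M.ctxC (some (.bang A) :: Φ) ⟶ M.tyC A) :
    M.ctxC Φ ⟶ M.tyC A :=
  (M.ctxIsoF Φ h).inv ≫ M.gamma (M.ctxB Φ h) ≫
    M.sigma (M.ctxB Φ h) ((M.ctxIsoF Φ h).hom ▷ M.bang.obj (M.tyC A) ≫ f)

/-! ### Interpretation of terms -/

/-- What a `λ_l`-model must have in addition in order to interpret the given calculus. -/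
def Supports (_ : LinearModel B V C) : Calculus → Type (max u₂ v₂)
  | .linear => PUnit
  | .affine => IsTerminal (𝟙_ V)

/-- `⟦Γ ⊢ m : A⟧ : ⟦Γ⟧ ⟶ ⟦A⟧`, by induction on the derivation. -/
def interp : {c : Calculus} → M.Supports c → {Γ : Ctx} → {m : Tm} → {A : Ty} → Der c Γ m A →
    (M.ctxC Γ ⟶ M.tyC A)
  | _, _, _, _, _, .varL (Φ := Φ) (A := A) h s =>
      (M.insertIso s).hom ≫ M.discard Φ h ▷ M.tyC A ≫ (λ_ (M.tyC A)).hom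
  | _, _, _, _, _, .starL (Φ := Φ) h => M.discard Φ h
  | _, t, _, _, _, .liftL h d => M.liftMap h (interp t d)
  | _, t, _, _, _, .varA (Γ := Γ) (A := A) s =>
      (M.insertIso s).hom ≫ M.discardAll t Γ ▷ M.tyC A ≫ (λ_ (M.tyC A)).hom
  | _, t, _, _, _, .starA (Γ := Γ) => M.discardAll t Γ
  | _, t, _, _, _, .liftA (Φ := Φ) (Γ := Γ) h s d =>
      (M.unionIso s).hom ≫ M.ctxC Φ ◁ M.discardAll t Γ ≫ (ρ_ (M.ctxC Φ)).hom ≫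
        M.liftMap h (interp t d)
  | _, t, _, _, _, .recurA (Φ := Φ) (Γ := Γ) h s d =>
      (M.unionIso s).hom ≫ M.ctxC Φ ◁ M.discardAll t Γ ≫ (ρ_ (M.ctxC Φ)).hom ≫
        M.recMap h (interp t d)
  | _, t, _, _, _, .seq (A := A) s d e =>
      M.split s ≫ (interp t d ⊗ₘ interp t e) ≫ (λ_ (M.tyC A)).hom
  | _, t, _, _, _, .force (A := A) d => interp t d ≫ M.adjFG.counit.app (M.tyC A)
  | _, t, _, _, _, .left (A := A) (B := B) d =>
      interp t d ≫ (coprod.inl : M.tyC A ⟶ M.tyC A ⨿ M.tyC B)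
  | _, t, _, _, _, .right (A := A) (B := B) d =>
      interp t d ≫ (coprod.inr : M.tyC B ⟶ M.tyC A ⨿ M.tyC B)
  | _, t, _, _, _, .case (Γ₁ := Γ₁) (Γ₂ := Γ₂) (A := A) (B := B) s d e f =>
      M.split s ≫ (β_ (M.ctxC Γ₁) (M.ctxC Γ₂)).hom ≫ M.ctxC Γ₂ ◁ interp t d ≫
        (M.distrib Γ₂ A B).hom ≫ coprod.desc (interp t e) (interp t f)
  | _, t, _, _, _, .pair s d e => M.split s ≫ (interp t d ⊗ₘ interp t e)
  | _, t, _, _, _, .letPair (Γ₂ := Γ₂) (A := A) (B := B) s d e =>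
      M.split s ≫ interp t d ▷ M.ctxC Γ₂ ≫ (β_ (M.tyC A ⊗ M.tyC B) (M.ctxC Γ₂)).hom ≫
        (α_ (M.ctxC Γ₂) (M.tyC A) (M.tyC B)).inv ≫ interp t e
  | _, t, _, _, _, .lam (Γ := Γ) d => (M.ctxIsoC Γ).inv ≫ M.L.map (M.curry (interp t d))
  | _, t, _, _, _, .app (A := A) (B := B) s d e =>
      M.split s ≫ (interp t d ⊗ₘ interp t e) ≫ M.eval A B
  | _, t, _, _, _, .recur h d => M.recMap h (interp t d)

/-- The interpretation of `λ_l` in a `λ_l`-model. -/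
def interpL {Γ : Ctx} {m : Tm} {A : Ty} (d : Der .linear Γ m A) : M.ctxC Γ ⟶ M.tyC A :=
  M.interp (c := .linear) PUnit.unit d

end LinearModel

/-- The interpretation of `λ_a` in a `λ_a`-model. -/
def AffineModel.interpA {B : Type u₁} [Category.{v₁} B] [CartesianMonoidalCategory B]
    [BraidedCategory B] [HasFiniteCoproducts B]
    {V : Type u₂} [Category.{v₂} V] [MonoidalCategory V] [SymmetricCategory V]
    [HasFiniteCoproducts V]
    {C : Type u₃} [Category.{v₃} C] [MonoidalCategory C] [SymmetricCategory C]
    [HasFiniteCoproducts C] (M : AffineModel B V C)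
    {Γ : Ctx} {m : Tm} {A : Ty} (d : Der .affine Γ m A) :
    M.toLinearModel.ctxC Γ ⟶ M.toLinearModel.tyC A :=
  M.toLinearModel.interp (c := .affine) M.unitTerminal d

end

end SubLambda

/-!
Variables and values share three properties that make substitution sound: they can be renamed, their
interpretations lie in the image of `L` and so commute with discarding, and at a non-linear type
they factor, after discarding variables, through the image of `F` and so commute with copying and
promotion. Substituting values for variables therefore composes interpretations, and every
evaluation rule becomes a law of the model: naturality of discarding, the universal properties of
coproducts and of currying, the counit law of `F ⊣ G`, and, for recursion, the fact that `σ ∘ γ`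
solves its fixed point equation.

A term has several derivations, which discard its unused variables at different places. Derivations
are therefore replaced by a relation `Denotes` in which variables may be discarded at every
distribution of a context; it is closed under substitution, and any two denotations of a term agree
after discarding down to a common context.
-/

namespace SubLambda

/-! ### Transport along a functor -/

namespace Transport

open Functor.LaxMonoidal Functor.OplaxMonoidal

section Category

variable {D : Type u₁} [Category.{v₁} D] {C : Type u₃} [Category.{v₃} C] {H : D ⥤ C}
  {E : Type u₂} [Category.{v₂} E] {J : E ⥤ D} {a b c : D} {e e' : E} {X Y Z : C}

/-- The morphism `X ⟶ Y` that `H.map g` becomes once its source and target are identified with `X`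
and `Y` along `x` and `y`. -/
def hom (x : H.obj a ≅ X) (y : H.obj b ≅ Y) (g : a ⟶ b) : X ⟶ Y := x.inv ≫ H.map g ≫ y.hom

theorem hom_id (x : H.obj a ≅ X) : hom x x (𝟙 _) = 𝟙 X := by simp [hom]

theorem hom_comp (x : H.obj a ≅ X) (y : H.obj b ≅ Y) (z : H.obj c ≅ Z) (f : a ⟶ b) (g : b ⟶ c) :
    hom x y f ≫ hom y z g = hom x z (f ≫ g) := by simp [hom]

theorem eq_hom_iff {x : H.obj a ≅ X} {y : H.obj b ≅ Y} {g : a ⟶ b} {f : X ⟶ Y} :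
    f = hom x y g ↔ x.hom ≫ f = H.map g ≫ y.hom := by
  rw [hom, Iso.eq_inv_comp]

theorem hom_eq_inv {x : H.obj a ≅ X} {y : H.obj b ≅ Y} {e : X ≅ Y} {g : a ≅ b}
    (h : e.hom = hom x y g.hom) : e.inv = hom y x g.inv := by
  rw [← cancel_mono e.hom, Iso.inv_hom_id, h, hom_comp, g.inv_hom_id, hom_id]

/-- Being the transport of a morphism along `H`: for `H` not full this is a restriction on `f`. -/
def IsImage (x : H.obj a ≅ X) (y : H.obj b ≅ Y) (f : X ⟶ Y) : Prop := ∃ g, f = hom x y g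

theorem isImage_hom (x : H.obj a ≅ X) (y : H.obj b ≅ Y) (g : a ⟶ b) : IsImage x y (hom x y g) :=
  ⟨g, rfl⟩

theorem isImage_id (x : H.obj a ≅ X) : IsImage x x (𝟙 X) := ⟨𝟙 _, (hom_id x).symm⟩

theorem IsImage.comp {x : H.obj a ≅ X} {y : H.obj b ≅ Y} {z : H.obj c ≅ Z} {f : X ⟶ Y} {g : Y ⟶ Z}
    (hf : IsImage x y f) (hg : IsImage y z g) : IsImage x z (f ≫ g) := by
  obtain ⟨f, rfl⟩ := hf
  obtain ⟨g, rfl⟩ := hg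
  exact ⟨f ≫ g, hom_comp ..⟩

/-- The presentation of `X` as an image under `J ⋙ H`, from presentations under `H` and `J`. -/
def comp (x : H.obj a ≅ X) (y : J.obj e ≅ a) :
    (J ⋙ H).obj e ≅ X := H.mapIso y ≪≫ x

theorem hom_hom (x : H.obj a ≅ X) (x' : J.obj e ≅ a)
    (y : H.obj b ≅ Y) (y' : J.obj e' ≅ b) (g : e ⟶ e') :
    hom (comp x x') (comp y y') g = hom x y (hom x' y' g) := by simp [hom, comp]

theorem IsImage.of_comp {x : H.obj a ≅ X}
    {x' : J.obj e ≅ a} {y : H.obj b ≅ Y} {y' : J.obj e' ≅ b} {f : X ⟶ Y}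
    (hf : IsImage (Transport.comp x x') (Transport.comp y y') f) : IsImage x y f := by
  obtain ⟨g, rfl⟩ := hf
  exact ⟨_, hom_hom ..⟩

end Category

section Monoidal

variable {D : Type u₁} [Category.{v₁} D] [MonoidalCategory D]
  {C : Type u₃} [Category.{v₃} C] [MonoidalCategory C]
  {H : D ⥤ C} [H.Monoidal]
  {E : Type u₂} [Category.{v₂} E] [MonoidalCategory E] {J : E ⥤ D} [J.Monoidal]
  {a b c d : D} {e e' : E} {X Y Z W : C}

/-- The presentation of the tensor unit as an image under `H`. -/
def unit (H : D ⥤ C) [H.Monoidal] : H.obj (𝟙_ D) ≅ 𝟙_ C := (Functor.Monoidal.εIso H).symm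

/-- The presentation of a tensor product of images as an image under `H`. -/
def tensor (x : H.obj a ≅ X) (y : H.obj b ≅ Y) : H.obj (a ⊗ b) ≅ X ⊗ Y :=
  (Functor.Monoidal.μIso H a b).symm ≪≫ tensorIso x y

theorem hom_tensor (x : H.obj a ≅ X) (y : H.obj b ≅ Y) (z : H.obj c ≅ Z) (w : H.obj d ≅ W)
    (f : a ⟶ b) (g : c ⟶ d) :
    (hom x y f ⊗ₘ hom z w g) = hom (tensor x z) (tensor y w) (f ⊗ₘ g) := by
  rw [eq_hom_iff]
  simp [tensor, hom, tensorHom_comp_tensorHom, ← δ_natural_assoc]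

theorem hom_whiskerRight (x : H.obj a ≅ X) (y : H.obj b ≅ Y) (z : H.obj c ≅ Z) (f : a ⟶ b) :
    hom x y f ▷ Z = hom (tensor x z) (tensor y z) (f ▷ c) := by
  rw [← tensorHom_id, ← tensorHom_id, ← hom_id z, hom_tensor]

theorem hom_whiskerLeft (x : H.obj a ≅ X) (y : H.obj b ≅ Y) (z : H.obj c ≅ Z) (f : a ⟶ b) :
    Z ◁ hom x y f = hom (tensor z x) (tensor z y) (c ◁ f) := by
  rw [← id_tensorHom, ← id_tensorHom, ← hom_id z, hom_tensor]

theorem hom_associator (x : H.obj a ≅ X) (y : H.obj b ≅ Y) (z : H.obj c ≅ Z) :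
    (α_ X Y Z).hom = hom (tensor (tensor x y) z) (tensor x (tensor y z)) (α_ _ _ _).hom := by
  rw [eq_hom_iff]
  simp only [tensor, Iso.trans_hom, Iso.symm_hom, Functor.Monoidal.μIso_inv, tensorIso_hom,
    Category.assoc, ← whiskerRight_comp_tensorHom, ← whiskerLeft_comp_tensorHom,
    associator_naturality, Functor.OplaxMonoidal.associativity_assoc]

theorem hom_leftUnitor (x : H.obj a ≅ X) :
    (λ_ X).hom = hom (tensor (unit H) x) x (λ_ _).hom := by
  rw [eq_hom_iff]
  simp [tensor, unit, MonoidalCategory.tensorHom_def]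

theorem hom_rightUnitor (x : H.obj a ≅ X) :
    (ρ_ X).hom = hom (tensor x (unit H)) x (ρ_ _).hom := by
  rw [eq_hom_iff]
  simp [tensor, unit, tensorHom_def']

theorem hom_associator_inv (x : H.obj a ≅ X) (y : H.obj b ≅ Y) (z : H.obj c ≅ Z) :
    (α_ X Y Z).inv = hom (tensor x (tensor y z)) (tensor (tensor x y) z) (α_ _ _ _).inv :=
  hom_eq_inv (hom_associator x y z)

theorem hom_leftUnitor_inv (x : H.obj a ≅ X) :
    (λ_ X).inv = hom x (tensor (unit H) x) (λ_ _).inv :=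
  hom_eq_inv (hom_leftUnitor x)

theorem hom_rightUnitor_inv (x : H.obj a ≅ X) :
    (ρ_ X).inv = hom x (tensor x (unit H)) (ρ_ _).inv :=
  hom_eq_inv (hom_rightUnitor x)

theorem IsImage.tensor {x : H.obj a ≅ X} {y : H.obj b ≅ Y} {z : H.obj c ≅ Z} {w : H.obj d ≅ W}
    {f : X ⟶ Y} {g : Z ⟶ W} (hf : IsImage x y f) (hg : IsImage z w g) :
    IsImage (tensor x z) (tensor y w) (f ⊗ₘ g) := by
  obtain ⟨f, rfl⟩ := hf
  obtain ⟨g, rfl⟩ := hg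
  exact ⟨_, hom_tensor ..⟩

theorem IsImage.whiskerRight {x : H.obj a ≅ X} {y : H.obj b ≅ Y} {f : X ⟶ Y} (hf : IsImage x y f)
    (z : H.obj c ≅ Z) : IsImage (Transport.tensor x z) (Transport.tensor y z) (f ▷ Z) := by
  simpa using hf.tensor (isImage_id z)

theorem comp_tensor (x : H.obj a ≅ X) (x' : J.obj e ≅ a) (y : H.obj b ≅ Y)
    (y' : J.obj e' ≅ b) : comp (tensor x y) (tensor x' y') = tensor (comp x x') (comp y y') := by
  ext
  simp [tensor, comp, ← tensorHom_comp_tensorHom]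

theorem comp_unit : comp (unit H) (unit J) = unit (J ⋙ H) := by
  ext
  simp [unit, comp]

end Monoidal

section Braided

variable {D : Type u₁} [Category.{v₁} D] [MonoidalCategory D] [BraidedCategory D]
  {C : Type u₃} [Category.{v₃} C] [MonoidalCategory C] [BraidedCategory C]
  {H : D ⥤ C} [H.Braided] {a b c d : D} {X Y Z W : C}

theorem hom_braiding (x : H.obj a ≅ X) (y : H.obj b ≅ Y) :
    (β_ X Y).hom = hom (tensor x y) (tensor y x) (β_ _ _).hom := by
  rw [eq_hom_iff]
  simp [tensor]

theorem hom_tensorμ (x : H.obj a ≅ X) (y : H.obj b ≅ Y) (z : H.obj c ≅ Z) (w : H.obj d ≅ W) :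
    tensorμ X Y Z W = hom (tensor (tensor x y) (tensor z w)) (tensor (tensor x z) (tensor y w))
      (tensorμ _ _ _ _) := by
  simp only [tensorμ, hom_braiding y z, hom_associator_inv y z w, hom_associator z y w,
    hom_associator_inv x z (tensor y w), hom_associator x y (tensor z w),
    hom_whiskerLeft _ _ x, hom_whiskerRight _ _ w, hom_comp]

end Braided

section Cartesian

open CartesianMonoidalCategory SemiCartesianMonoidalCategory

variable {D : Type u₁} [Category.{v₁} D] [CartesianMonoidalCategory D] [BraidedCategory D]
  {C : Type u₃} [Category.{v₃} C] [MonoidalCategory C] [BraidedCategory C]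
  {H : D ⥤ C} [H.Braided] {a b : D} {X Y : C}

/-- The transported diagonal, for an object in the image of a cartesian category. -/
def copy (x : H.obj a ≅ X) : X ⟶ X ⊗ X := hom x (tensor x x) (lift (𝟙 _) (𝟙 _))

/-- The transported terminal map, for an object in the image of a cartesian category. -/
def discard (x : H.obj a ≅ X) : X ⟶ 𝟙_ C := hom x (unit H) (toUnit _)

theorem IsImage.copy {x : H.obj a ≅ X} {y : H.obj b ≅ Y} {f : X ⟶ Y} (hf : IsImage x y f) :
    f ≫ Transport.copy y = Transport.copy x ≫ (f ⊗ₘ f) := by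
  obtain ⟨g, rfl⟩ := hf
  rw [Transport.copy, Transport.copy, hom_tensor, hom_comp, hom_comp]
  congr 1
  ext <;> simp

theorem IsImage.discard {x : H.obj a ≅ X} {y : H.obj b ≅ Y} {f : X ⟶ Y} (hf : IsImage x y f) :
    f ≫ Transport.discard y = Transport.discard x := by
  obtain ⟨g, rfl⟩ := hf
  rw [Transport.discard, Transport.discard, hom_comp]
  congr 1
  exact toUnit_unique _ _

theorem copy_tensor (x : H.obj a ≅ X) (y : H.obj b ≅ Y) :
    copy (tensor x y) = (copy x ⊗ₘ copy y) ≫ tensorμ X X Y Y := by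
  rw [copy, copy, copy, hom_tensor, hom_tensorμ x x y y, hom_comp]
  congr 1
  ext <;> simp

theorem discard_tensor (x : H.obj a ≅ X) (y : H.obj b ≅ Y) :
    discard (tensor x y) = (discard x ⊗ₘ discard y) ≫ (λ_ _).hom := by
  rw [discard, discard, discard, hom_tensor, hom_leftUnitor (unit H), hom_comp]
  congr 1
  exact toUnit_unique _ _

theorem copy_unit : copy (unit H) = (λ_ (𝟙_ C)).inv := by
  rw [copy, hom_leftUnitor_inv (unit H)]
  congr 1
  ext

theorem discard_unit : discard (unit H) = 𝟙 (𝟙_ C) := by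
  rw [discard, ← hom_id (unit H)]
  congr 1
  exact toUnit_unique _ _

@[simp]
theorem copy_discard_left (x : H.obj a ≅ X) : copy x ≫ discard x ▷ X = (λ_ X).inv := by
  rw [copy, discard, hom_whiskerRight _ _ x, hom_leftUnitor_inv x, hom_comp]
  congr 1
  ext; simp

@[simp]
theorem copy_discard_right (x : H.obj a ≅ X) : copy x ≫ X ◁ discard x = (ρ_ X).inv := by
  rw [copy, discard, hom_whiskerLeft _ _ x, hom_rightUnitor_inv x, hom_comp]
  congr 1
  ext; simp

@[simp]
theorem copy_braiding (x : H.obj a ≅ X) : copy x ≫ (β_ X X).hom = copy x := by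
  rw [copy, hom_braiding x x, hom_comp]
  congr 1
  ext <;> simp

theorem copy_assoc (x : H.obj a ≅ X) :
    copy x ≫ copy x ▷ X ≫ (α_ X X X).hom = copy x ≫ X ◁ copy x := by
  rw [copy, hom_whiskerRight _ _ x, hom_whiskerLeft _ _ x, hom_associator x x x, hom_comp,
    hom_comp, hom_comp]
  congr 1
  ext <;> simp

theorem isImage_copy {x : H.obj a ≅ X} : IsImage x (tensor x x) (Transport.copy x) := isImage_hom ..

theorem isImage_discard {x : H.obj a ≅ X} : IsImage x (unit H) (Transport.discard x) :=
  isImage_hom ..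

end Cartesian

end Transport

/-! ### Categorical preliminaries -/

section Monoidal

variable {C : Type u₃} [Category.{v₃} C] [MonoidalCategory C]

/-- Coassociativity of a splitting into three parts: splitting off `Z` and then splitting `XY` into
`X` and `Y` agrees with splitting off `X` and then splitting `YZ` into `Y` and `Z`. -/
def IsCoassoc {W X Y Z XY YZ : C} (p : W ⟶ XY ⊗ Z) (p₁ : XY ⟶ X ⊗ Y) (q : W ⟶ X ⊗ YZ)
    (q₂ : YZ ⟶ Y ⊗ Z) : Prop :=
  p ≫ p₁ ▷ Z ≫ (α_ X Y Z).hom = q ≫ X ◁ q₂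

theorem IsCoassoc.conj {W X Y Z XY YZ W' X' Y' Z' XY' YZ' : C} {p : W ⟶ XY ⊗ Z}
    {p₁ : XY ⟶ X ⊗ Y} {q : W ⟶ X ⊗ YZ} {q₂ : YZ ⟶ Y ⊗ Z} (h : IsCoassoc p p₁ q q₂)
    (w : W' ≅ W) (x : X' ≅ X) (y : Y' ≅ Y) (z : Z' ≅ Z) (xy : XY' ≅ XY) (yz : YZ' ≅ YZ) :
    IsCoassoc (w.hom ≫ p ≫ (xy.inv ⊗ₘ z.inv)) (xy.hom ≫ p₁ ≫ (x.inv ⊗ₘ y.inv))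
      (w.hom ≫ q ≫ (x.inv ⊗ₘ yz.inv)) (yz.hom ≫ q₂ ≫ (y.inv ⊗ₘ z.inv)) := by
  unfold IsCoassoc at h ⊢
  simp only [← tensorHom_id, ← id_tensorHom, tensorHom_comp_tensorHom_assoc, Category.assoc,
    tensorHom_comp_tensorHom, Iso.inv_hom_id_assoc, Category.comp_id]
  simp only [← whiskerRight_comp_tensorHom, ← whiskerLeft_comp_tensorHom, Category.assoc,
    associator_naturality, reassoc_of% h]

theorem conj_comp_discard_right {X X₁ X₂ Y Y₁ Y₂ : C} (i : X ≅ Y) (i₁ : X₁ ≅ Y₁) (i₂ : X₂ ≅ Y₂)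
    (p : Y ⟶ Y₁ ⊗ Y₂) (w : Y₂ ⟶ 𝟙_ C) :
    (i.hom ≫ p ≫ (i₁.inv ⊗ₘ i₂.inv)) ≫ X₁ ◁ (i₂.hom ≫ w) ≫ (ρ_ _).hom =
      i.hom ≫ (p ≫ Y₁ ◁ w ≫ (ρ_ _).hom) ≫ i₁.inv := by
  have discard_second :
      (i₁.inv ⊗ₘ i₂.inv) ≫ X₁ ◁ (i₂.hom ≫ w) = Y₁ ◁ w ≫ i₁.inv ▷ 𝟙_ C := by
    rw [← id_tensorHom, tensorHom_comp_tensorHom, Iso.inv_hom_id_assoc, Category.comp_id,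
      tensorHom_def']
  simp only [Category.assoc, reassoc_of% discard_second, rightUnitor_naturality]

/-- The interpretation of `m; n` from those of `m` and `n`, on separate contexts. -/
def seqMap {X Y D : C} (f : X ⟶ 𝟙_ C) (g : Y ⟶ D) : X ⊗ Y ⟶ D := (f ⊗ₘ g) ≫ (λ_ D).hom

theorem comp_seqMap {X X' Y Y' D : C} (s : X' ⟶ X) (s' : Y' ⟶ Y) (f : X ⟶ 𝟙_ C) (g : Y ⟶ D) :
    (s ⊗ₘ s') ≫ seqMap f g = seqMap (s ≫ f) (s' ≫ g) := by
  simp only [seqMap, tensorHom_comp_tensorHom_assoc]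

theorem tensorμ_braiding [SymmetricCategory C] (X₁ X₂ Y₁ Y₂ : C) :
    tensorμ X₁ X₂ Y₁ Y₂ ≫ (β_ (X₁ ⊗ Y₁) (X₂ ⊗ Y₂)).hom =
      ((β_ X₁ X₂).hom ⊗ₘ (β_ Y₁ Y₂).hom) ≫ tensorμ X₂ X₁ Y₂ Y₁ := by
  simp [tensorμ, SymmetricCategory.braiding_swap_eq_inv_braiding Y₁ X₂,
    MonoidalCategory.tensorHom_def]

variable [BraidedCategory C]

theorem IsCoassoc.tensor {W X Y Z XY YZ W' X' Y' Z' XY' YZ' : C} {p : W ⟶ XY ⊗ Z}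
    {p₁ : XY ⟶ X ⊗ Y} {q : W ⟶ X ⊗ YZ} {q₂ : YZ ⟶ Y ⊗ Z} {p' : W' ⟶ XY' ⊗ Z'}
    {p₁' : XY' ⟶ X' ⊗ Y'} {q' : W' ⟶ X' ⊗ YZ'} {q₂' : YZ' ⟶ Y' ⊗ Z'}
    (h : IsCoassoc p p₁ q q₂) (h' : IsCoassoc p' p₁' q' q₂') :
    IsCoassoc ((p ⊗ₘ p') ≫ tensorμ _ _ _ _) ((p₁ ⊗ₘ p₁') ≫ tensorμ _ _ _ _)
      ((q ⊗ₘ q') ≫ tensorμ _ _ _ _) ((q₂ ⊗ₘ q₂') ≫ tensorμ _ _ _ _) := by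
  have split_left : tensorμ XY Z XY' Z' ≫ (p₁ ⊗ₘ p₁') ▷ (Z ⊗ Z') =
      (p₁ ▷ Z ⊗ₘ p₁' ▷ Z') ≫ tensorμ (X ⊗ Y) Z (X' ⊗ Y') Z' := by
    simpa using (tensorμ_natural p₁ (𝟙 Z) p₁' (𝟙 Z')).symm
  have split_right : tensorμ X YZ X' YZ' ≫ (X ⊗ X') ◁ (q₂ ⊗ₘ q₂') =
      (X ◁ q₂ ⊗ₘ X' ◁ q₂') ≫ tensorμ X (Y ⊗ Z) X' (Y' ⊗ Z') := by
    simpa using (tensorμ_natural (𝟙 X) q₂ (𝟙 X') q₂').symm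
  unfold IsCoassoc at h h' ⊢
  simp only [comp_whiskerRight, whiskerLeft_comp, Category.assoc, reassoc_of% split_left,
    reassoc_of% split_right, associator_monoidal, tensorHom_comp_tensorHom_assoc, h, h']

theorem tensorHom_tensorμ_discard_right {X Y X₁ X₂ Y₁ Y₂ : C} (f : X ⟶ X₁ ⊗ X₂)
    (l : Y ⟶ Y₁ ⊗ Y₂) (u : X₂ ⟶ 𝟙_ C) (v : Y₂ ⟶ 𝟙_ C) :
    ((f ⊗ₘ l) ≫ tensorμ _ _ _ _) ≫ (X₁ ⊗ Y₁) ◁ ((u ⊗ₘ v) ≫ (λ_ _).hom) ≫ (ρ_ _).hom =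
      (f ≫ X₁ ◁ u ≫ (ρ_ _).hom) ⊗ₘ (l ≫ Y₁ ◁ v ≫ (ρ_ _).hom) := by
  have h : tensorμ X₁ X₂ Y₁ Y₂ ≫ (X₁ ⊗ Y₁) ◁ (u ⊗ₘ v) =
      (X₁ ◁ u ⊗ₘ Y₁ ◁ v) ≫ tensorμ X₁ (𝟙_ C) Y₁ (𝟙_ C) := by
    simpa using (tensorμ_natural (𝟙 X₁) u (𝟙 Y₁) v).symm
  simp only [whiskerLeft_comp, Category.assoc, reassoc_of% h, ← rightUnitor_monoidal,
    tensorHom_comp_tensorHom]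

end Monoidal

section Hylomorphism

open Endofunctor

variable {E : Type u₁} [Category.{v₁} E] {T T' : E ⥤ E} {W : Algebra T} {W' : Algebra T'}

/-- The hylomorphism `A ⟶ Ω ⟶ D` of a coalgebra `A` and an algebra `D` through an initial algebra
`Ω` whose inverse is a final coalgebra. -/
def hylo (initial : IsInitial W) (final : IsTerminal (⟨W.a, Algebra.Initial.strInv initial⟩ :
    Coalgebra T)) (A : Coalgebra T) (D : Algebra T) : A.V ⟶ D.a :=
  (final.from A).f ≫ (initial.to D).f

theorem hylo_unfold (initial : IsInitial W)
    (final : IsTerminal (⟨W.a, Algebra.Initial.strInv initial⟩ : Coalgebra T))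
    (A : Coalgebra T) (D : Algebra T) :
    hylo initial final A D = A.str ≫ T.map (hylo initial final A D) ≫ D.str := by
  have unfold_final : (final.from A).f =
      A.str ≫ T.map (final.from A).f ≫ W.str := by
    rw [reassoc_of% (final.from A).h, Algebra.Initial.left_inv, Category.comp_id]
  have fold_initial : W.str ≫ (initial.to D).f = T.map (initial.to D).f ≫ D.str :=
    (initial.to D).h.symm
  unfold hylo
  conv_lhs => rw [unfold_final]
  simp only [Category.assoc, fold_initial, Functor.map_comp]

/-- The comparison `k : Ω' ⟶ Ω` of initial algebras is also one of final coalgebras, so `γ` and `σ`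
each commute with it. -/
theorem hylo_natural (initial' : IsInitial W')
    (final' : IsTerminal (⟨W'.a, Algebra.Initial.strInv initial'⟩ : Coalgebra T'))
    (initial : IsInitial W)
    (final : IsTerminal (⟨W.a, Algebra.Initial.strInv initial⟩ : Coalgebra T))
    (θ : T' ⟶ T) (A' : Coalgebra T') (A : Coalgebra T) (p : A'.V ⟶ A.V)
    (hp : (A'.str ≫ θ.app A'.V) ≫ T.map p = p ≫ A.str) (D : Algebra T) :
    hylo initial' final' A' ((Algebra.functorOfNatTrans θ).obj D) =
      p ≫ hylo initial final A D := by
  let compare := initial'.to ((Algebra.functorOfNatTrans θ).obj W)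
  let k : W'.a ⟶ W.a := compare.f
  have k_sigma : k ≫ (initial.to D).f =
      (initial'.to ((Algebra.functorOfNatTrans θ).obj D)).f :=
    congrArg Algebra.Hom.f
      (initial'.hom_ext (compare ≫ (Algebra.functorOfNatTrans θ).map (initial.to D)) _)
  have k_coalgebra : (Algebra.Initial.strInv initial' ≫ θ.app W'.a) ≫ T.map k =
      k ≫ Algebra.Initial.strInv initial := by
    have k_algebra : W'.str ≫ k = T'.map k ≫ θ.app W.a ≫ W.str := compare.h.symm
    have cancel : W'.str ≫ k ≫ Algebra.Initial.strInv initial = θ.app W'.a ≫ T.map k := by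
      rw [reassoc_of% k_algebra, Algebra.Initial.right_inv, Category.comp_id, θ.naturality]
    rw [Category.assoc, ← cancel, ← Category.assoc, Algebra.Initial.left_inv, Category.id_comp]
  let γ' : A'.V ⟶ W'.a := (final'.from A').f
  let γ : A.V ⟶ W.a := (final.from A).f
  have gamma_k : γ' ≫ k = p ≫ γ :=
    congrArg Coalgebra.Hom.f (final.hom_ext
      ((Coalgebra.functorOfNatTrans θ).map (final'.from A') ≫ ⟨k, k_coalgebra⟩)
      ((⟨p, hp⟩ : (Coalgebra.functorOfNatTrans θ).obj A' ⟶ A) ≫ final.from A))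
  have fold_unfold : γ' ≫ k ≫ (initial.to D).f = p ≫ γ ≫ (initial.to D).f := by
    rw [reassoc_of% gamma_k]
  exact (congrArg (γ' ≫ ·) k_sigma.symm).trans fold_unfold

end Hylomorphism

section Coproducts

variable {D : Type u₁} [Category.{v₁} D] {E : Type u₂} [Category.{v₂} E] (H : D ⥤ E) (a b : D)
  [HasBinaryCoproduct a b] [HasBinaryCoproduct (H.obj a) (H.obj b)]
  [PreservesColimit (pair a b) H]

theorem map_inl_iso_inv :
    H.map coprod.inl ≫ (PreservesColimitPair.iso H a b).inv = coprod.inl := by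
  rw [Iso.comp_inv_eq, PreservesColimitPair.iso_hom, coprodComparison_inl]

theorem map_inr_iso_inv :
    H.map coprod.inr ≫ (PreservesColimitPair.iso H a b).inv = coprod.inr := by
  rw [Iso.comp_inv_eq, PreservesColimitPair.iso_hom, coprodComparison_inr]

end Coproducts

section Adjunction

variable {B : Type u₁} [Category.{v₁} B] {C : Type u₃} [Category.{v₃} C] {F : B ⥤ C} {G : C ⥤ B}

theorem map_unit_naturality (adj : F ⊣ G) {X X' : B} (g : X' ⟶ X) :
    F.map g ≫ F.map (adj.unit.app X) = F.map (adj.unit.app X') ≫ F.map (G.map (F.map g)) := by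
  rw [← F.map_comp, ← F.map_comp, ← adj.unit_naturality]

theorem map_diag_unit_naturality {B : Type u₁} [Category.{v₁} B] [CartesianMonoidalCategory B]
    [MonoidalCategory C] {F : B ⥤ C} [F.Monoidal] {G : C ⥤ B} (adj : F ⊣ G) {X X' : B}
    (g : X' ⟶ X) :
    (F.map (CartesianMonoidalCategory.lift (𝟙 X') (𝟙 X')) ≫ Functor.OplaxMonoidal.δ F X' X' ≫
      F.obj X' ◁ F.map (adj.unit.app X')) ≫ (F.map g ⊗ₘ F.map (G.map (F.map g))) =
    F.map g ≫ F.map (CartesianMonoidalCategory.lift (𝟙 X) (𝟙 X)) ≫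
      Functor.OplaxMonoidal.δ F X X ≫ F.obj X ◁ F.map (adj.unit.app X) := by
  have unit_natural :
      F.obj X' ◁ F.map (adj.unit.app X') ≫ (F.map g ⊗ₘ F.map (G.map (F.map g))) =
        (F.map g ⊗ₘ F.map g) ≫ F.obj X ◁ F.map (adj.unit.app X) := by
    rw [whiskerLeft_comp_tensorHom, ← map_unit_naturality, tensorHom_comp_whiskerLeft]
  have diag_natural : F.map (CartesianMonoidalCategory.lift (𝟙 X') (𝟙 X')) ≫ F.map (g ⊗ₘ g) =
      F.map g ≫ F.map (CartesianMonoidalCategory.lift (𝟙 X) (𝟙 X)) := by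
    simp only [← F.map_comp, CartesianMonoidalCategory.lift_map, Category.id_comp,
      CartesianMonoidalCategory.comp_lift, Category.comp_id]
  simp only [Category.assoc, unit_natural, Functor.OplaxMonoidal.δ_natural_assoc,
    reassoc_of% diag_natural]

end Adjunction

/-! ### Contexts -/

section Calculus

variable {c : Calculus}

/-- The types whose variables may be discarded. -/
def Ty.Discardable : Calculus → Ty → Prop
  | .linear, A => A.NonLinear
  | .affine, _ => True

theorem Ty.NonLinear.discardable {P : Ty} (h : P.NonLinear) : (c : Calculus) → Ty.Discardable c P
  | .linear => h
  | .affine => trivial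

/-- `OptDrop c o' o`: the entry `o'` is `o`, or `o` is discarded. -/
inductive OptDrop (c : Calculus) : Option Ty → Option Ty → Type
  | keep (o : Option Ty) : OptDrop c o o
  | drop (A : Ty) (h : Ty.Discardable c A) : OptDrop c none (some A)

/-- `OptShare c o₁ o₂ o`: the entry `o` is discarded, passed to one of two contexts, or shared. -/
inductive OptShare (c : Calculus) : Option Ty → Option Ty → Option Ty → Type
  | none : OptShare c none none none
  | drop (A : Ty) (h : Ty.Discardable c A) : OptShare c none none (some A)
  | left (A : Ty) : OptShare c (some A) none (some A)
  | right (A : Ty) : OptShare c none (some A) (some A)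
  | both (A : Ty) (h : A.NonLinear) : OptShare c (some A) (some A) (some A)

/-- `Drop c Γ' Γ`: the context `Γ'` arises from `Γ` by discarding variables. -/
inductive Drop (c : Calculus) : Ctx → Ctx → Type
  | nil : Drop c [] []
  | cons {o' o : Option Ty} {Γ' Γ : Ctx} :
      OptDrop c o' o → Drop c Γ' Γ → Drop c (o' :: Γ') (o :: Γ)

/-- `Share c Γ₁ Γ₂ Θ`: each variable of `Θ` is discarded, passed to one of `Γ₁`, `Γ₂`, or shared. -/
inductive Share (c : Calculus) : Ctx → Ctx → Ctx → Type
  | nil : Share c [] [] []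
  | cons {o₁ o₂ o : Option Ty} {Γ₁ Γ₂ Θ : Ctx} :
      OptShare c o₁ o₂ o → Share c Γ₁ Γ₂ Θ → Share c (o₁ :: Γ₁) (o₂ :: Γ₂) (o :: Θ)

/-- The contexts all of whose variables may be discarded. -/
def Ctx.Discardable (c : Calculus) : Ctx → Prop
  | [] => True
  | none :: Γ => Ctx.Discardable c Γ
  | some A :: Γ => Ctx.Discardable c Γ ∧ Ty.Discardable c A

theorem Ctx.discardable_affine : (Γ : Ctx) → Ctx.Discardable .affine Γ
  | [] => trivial
  | none :: Γ => Ctx.discardable_affine Γ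
  | some _ :: Γ => ⟨Ctx.discardable_affine Γ, trivial⟩

theorem Ctx.Discardable.nonLinear : {Γ : Ctx} → Ctx.Discardable .linear Γ → Γ.NonLinear
  | [], _ => trivial
  | none :: Γ, h => Ctx.Discardable.nonLinear (Γ := Γ) h
  | some _ :: Γ, h => ⟨Ctx.Discardable.nonLinear (Γ := Γ) h.1, h.2⟩

theorem Ctx.NonLinear.discardable : {Γ : Ctx} → Γ.NonLinear → (c : Calculus) → Ctx.Discardable c Γ
  | [], _, _ => trivial
  | none :: Γ, h, c => Ctx.NonLinear.discardable (Γ := Γ) h c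
  | some _ :: Γ, h, c => ⟨Ctx.NonLinear.discardable (Γ := Γ) h.1 c, h.2.discardable c⟩

instance {o' o : Option Ty} : Subsingleton (OptDrop c o' o) :=
  ⟨fun x y => by cases x <;> cases y <;> rfl⟩

instance {o₁ o₂ o : Option Ty} : Subsingleton (OptShare c o₁ o₂ o) :=
  ⟨fun x y => by cases x <;> cases y <;> rfl⟩

instance {Γ' Γ : Ctx} : Subsingleton (Drop c Γ' Γ) :=
  ⟨fun x y => by
    induction x with
    | nil => cases y; rfl
    | cons e x ih => cases y with | cons e' y => rw [ih y, Subsingleton.elim e e']⟩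

instance {Γ₁ Γ₂ Θ : Ctx} : Subsingleton (Share c Γ₁ Γ₂ Θ) :=
  ⟨fun x y => by
    induction x with
    | nil => cases y; rfl
    | cons e x ih => cases y with | cons e' y => rw [ih y, Subsingleton.elim e e']⟩

/-- Discarding in two steps. -/
def OptDrop.comp : {o'' o' o : Option Ty} → OptDrop c o'' o' → OptDrop c o' o → OptDrop c o'' o
  | _, _, _, .keep _, e => e
  | _, _, _, e, .keep _ => e

/-- Discarding from the results of a distribution. -/
def OptShare.dropBoth : {o₁ o₂ o o₁' o₂' : Option Ty} → OptShare c o₁ o₂ o → OptDrop c o₁' o₁ →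
    OptDrop c o₂' o₂ → OptShare c o₁' o₂' o
  | _, _, _, _, _, l, .keep _, .keep _ => l
  | _, _, _, _, _, .left A, .drop _ h, .keep _ => .drop A h
  | _, _, _, _, _, .right A, .keep _, .drop _ h => .drop A h
  | _, _, _, _, _, .both A _, .keep _, .drop _ _ => .left A
  | _, _, _, _, _, .both A _, .drop _ _, .keep _ => .right A
  | _, _, _, _, _, .both A _, .drop _ h, .drop _ _ => .drop A h

/-- Discarding before a distribution. -/
def OptShare.dropFirst : {o₁ o₂ o o' : Option Ty} → OptDrop c o' o → OptShare c o₁ o₂ o' →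
    OptShare c o₁ o₂ o
  | _, _, _, _, .keep _, l => l
  | _, _, _, _, .drop A h, .none => .drop A h

/-- Exchange of the two results of a distribution. -/
def OptShare.swap : {o₁ o₂ o : Option Ty} → OptShare c o₁ o₂ o → OptShare c o₂ o₁ o
  | _, _, _, .none => .none
  | _, _, _, .drop A h => .drop A h
  | _, _, _, .left A => .right A
  | _, _, _, .right A => .left A
  | _, _, _, .both A h => .both A h

/-- The entry of the union of the contexts with entries `o₁`, `o₂`. -/
def optJoin : Option Ty → Option Ty → Option Ty
  | none, o => o
  | some A, _ => some A

/-- The union of two contexts. -/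
def Ctx.join : Ctx → Ctx → Ctx
  | o₁ :: Γ₁, o₂ :: Γ₂ => optJoin o₁ o₂ :: Ctx.join Γ₁ Γ₂
  | _, _ => []

/-- Distribution of the union of the two results. -/
def OptShare.join : {o₁ o₂ o : Option Ty} → OptShare c o₁ o₂ o → OptShare c o₁ o₂ (optJoin o₁ o₂)
  | _, _, _, .none => .none
  | _, _, _, .drop _ _ => .none
  | _, _, _, .left A => .left A
  | _, _, _, .right A => .right A
  | _, _, _, .both A h => .both A h

/-- What a distribution discards altogether. -/
def OptShare.dropJoin : {o₁ o₂ o : Option Ty} → OptShare c o₁ o₂ o → OptDrop c (optJoin o₁ o₂) o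
  | _, _, _, .none => .keep _
  | _, _, _, .drop A h => .drop A h
  | _, _, _, .left _ => .keep _
  | _, _, _, .right _ => .keep _
  | _, _, _, .both _ _ => .keep _

/-- If `o` is distributed to `o₁` and `o₂`, and `o₁` to `o₃` and `o₄`, then `o` can first be
distributed to `o₃` and the union of `o₄` and `o₂`. -/
def OptShare.assocOuter : {o₁ o₂ o o₃ o₄ : Option Ty} → OptShare c o₁ o₂ o → OptShare c o₃ o₄ o₁ →
    OptShare c o₃ (optJoin o₄ o₂) o
  | _, _, _, _, _, .none, .none => .none
  | _, _, _, _, _, .drop A h, .none => .drop A h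
  | _, _, _, _, _, .left A, .drop _ h => .drop A h
  | _, _, _, _, _, .left A, .left _ => .left A
  | _, _, _, _, _, .left A, .right _ => .right A
  | _, _, _, _, _, .left A, .both _ h => .both A h
  | _, _, _, _, _, .right A, .none => .right A
  | _, _, _, _, _, .both A _, .drop _ _ => .right A
  | _, _, _, _, _, .both A h, .left _ => .both A h
  | _, _, _, _, _, .both A _, .right _ => .right A
  | _, _, _, _, _, .both A h, .both _ _ => .both A h

/-- The second step of `OptShare.assocOuter`. -/
def OptShare.assocInner : {o₁ o₂ o o₃ o₄ : Option Ty} → OptShare c o₁ o₂ o → OptShare c o₃ o₄ o₁ →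
    OptShare c o₄ o₂ (optJoin o₄ o₂)
  | _, _, _, _, _, .none, .none => .none
  | _, _, _, _, _, .drop _ _, .none => .none
  | _, _, _, _, _, .left _, .drop _ _ => .none
  | _, _, _, _, _, .left _, .left _ => .none
  | _, _, _, _, _, .left A, .right _ => .left A
  | _, _, _, _, _, .left A, .both _ _ => .left A
  | _, _, _, _, _, .right A, .none => .right A
  | _, _, _, _, _, .both A _, .drop _ _ => .right A
  | _, _, _, _, _, .both A _, .left _ => .right A
  | _, _, _, _, _, .both A h, .right _ => .both A h
  | _, _, _, _, _, .both A h, .both _ _ => .both A h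

/-- Discarding nothing. -/
def Drop.refl : (Γ : Ctx) → Drop c Γ Γ
  | [] => .nil
  | o :: Γ => .cons (.keep o) (Drop.refl Γ)

/-- Discarding in two steps. -/
def Drop.comp : {Γ'' Γ' Γ : Ctx} → Drop c Γ'' Γ' → Drop c Γ' Γ → Drop c Γ'' Γ
  | _, _, _, .nil, .nil => .nil
  | _, _, _, .cons e d, .cons e' d' => .cons (e.comp e') (d.comp d')

namespace Share

/-- Discarding from the results of a distribution. -/
def dropBoth : {Γ₁ Γ₂ Θ Γ₁' Γ₂' : Ctx} → Share c Γ₁ Γ₂ Θ → Drop c Γ₁' Γ₁ → Drop c Γ₂' Γ₂ →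
    Share c Γ₁' Γ₂' Θ
  | _, _, _, _, _, .nil, .nil, .nil => .nil
  | _, _, _, _, _, .cons l g, .cons e₁ d₁, .cons e₂ d₂ =>
    .cons (l.dropBoth e₁ e₂) (g.dropBoth d₁ d₂)

/-- Discarding before a distribution. -/
def dropFirst : {Γ₁ Γ₂ Θ Θ' : Ctx} → Drop c Θ' Θ → Share c Γ₁ Γ₂ Θ' → Share c Γ₁ Γ₂ Θ
  | _, _, _, _, .nil, .nil => .nil
  | _, _, _, _, .cons e d, .cons l g => .cons (.dropFirst e l) (.dropFirst d g)

/-- Exchange of the two results of a distribution. -/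
def swap : {Γ₁ Γ₂ Θ : Ctx} → Share c Γ₁ Γ₂ Θ → Share c Γ₂ Γ₁ Θ
  | _, _, _, .nil => .nil
  | _, _, _, .cons l g => .cons l.swap g.swap

/-- Distribution of the union of the two results. -/
def join : {Γ₁ Γ₂ Θ : Ctx} → Share c Γ₁ Γ₂ Θ → Share c Γ₁ Γ₂ (Ctx.join Γ₁ Γ₂)
  | _, _, _, .nil => .nil
  | _, _, _, .cons l g => .cons l.join g.join

/-- What a distribution discards altogether. -/
def dropJoin : {Γ₁ Γ₂ Θ : Ctx} → Share c Γ₁ Γ₂ Θ → Drop c (Ctx.join Γ₁ Γ₂) Θ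
  | _, _, _, .nil => .nil
  | _, _, _, .cons l g => .cons l.dropJoin g.dropJoin

/-- If `Θ` is distributed to `Γ₁` and `Γ₂`, and `Γ₁` to `Γ₃` and `Γ₄`, then `Θ` can first be
distributed to `Γ₃` and the union of `Γ₄` and `Γ₂`. -/
def assocOuter : {Γ₁ Γ₂ Θ Γ₃ Γ₄ : Ctx} → Share c Γ₁ Γ₂ Θ → Share c Γ₃ Γ₄ Γ₁ →
    Share c Γ₃ (Ctx.join Γ₄ Γ₂) Θ
  | _, _, _, _, _, .nil, .nil => .nil
  | _, _, _, _, _, .cons l g, .cons l' g' => .cons (l.assocOuter l') (g.assocOuter g')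

/-- The second step of `Share.assocOuter`. -/
def assocInner : {Γ₁ Γ₂ Θ Γ₃ Γ₄ : Ctx} → Share c Γ₁ Γ₂ Θ → Share c Γ₃ Γ₄ Γ₁ →
    Share c Γ₄ Γ₂ (Ctx.join Γ₄ Γ₂)
  | _, _, _, _, _, .nil, .nil => .nil
  | _, _, _, _, _, .cons l g, .cons l' g' => .cons (l.assocInner l') (g.assocInner g')

theorem join_nonLinear : {Γ₁ Γ₂ Θ : Ctx} → Share c Γ₁ Γ₂ Θ → Γ₁.NonLinear → Γ₂.NonLinear →
    (Ctx.join Γ₁ Γ₂).NonLinear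
  | _, _, _, .nil, _, _ => trivial
  | _, _, _, .cons .none g, h₁, h₂ => (join_nonLinear g h₁ h₂ :)
  | _, _, _, .cons (.drop _ _) g, h₁, h₂ => (join_nonLinear g h₁ h₂ :)
  | _, _, _, .cons (.left _) g, h₁, h₂ => ⟨join_nonLinear g h₁.1 h₂, h₁.2⟩
  | _, _, _, .cons (.right _) g, h₁, h₂ => ⟨join_nonLinear g h₁ h₂.1, h₂.2⟩
  | _, _, _, .cons (.both _ _) g, h₁, h₂ => ⟨join_nonLinear g h₁.1 h₂.1, h₁.2⟩

/-- Sharing of a whole non-linear context. -/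
def diag : {Φ : Ctx} → Φ.NonLinear → Share c Φ Φ Φ
  | [], _ => .nil
  | none :: Φ, h => .cons .none (diag (Φ := Φ) h)
  | some P :: Φ, h => .cons (.both P h.2) (diag (Φ := Φ) h.1)

/-- A disjoint union as a distribution that shares and discards nothing. -/
def ofUnion : {Γ Δ Θ : Ctx} → Union Γ Δ Θ → Share c Γ Δ Θ
  | _, _, _, .nil => .nil
  | _, _, _, .skip u => .cons .none (ofUnion u)
  | _, _, _, .inl A u => .cons (.left A) (ofUnion u)
  | _, _, _, .inr A u => .cons (.right A) (ofUnion u)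

/-- Discarding the second of two contexts. -/
def dropSnd : {Γ₁ Γ₂ Θ : Ctx} → Share c Γ₁ Γ₂ Θ → Ctx.Discardable c Γ₂ → Drop c Γ₁ Θ
  | _, _, _, .nil, _ => .nil
  | _, _, _, .cons .none g, h => .cons (.keep _) (dropSnd g h)
  | _, _, _, .cons (.drop A h') g, h => .cons (.drop A h') (dropSnd g h)
  | _, _, _, .cons (.left _) g, h => .cons (.keep _) (dropSnd g h)
  | _, _, _, .cons (.right A) g, h => .cons (.drop A h.2) (dropSnd g h.1)
  | _, _, _, .cons (.both _ _) g, h => .cons (.keep _) (dropSnd g h.1)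

end Share

theorem Drop.discardable : {Γ' Γ : Ctx} → Drop c Γ' Γ → Ctx.Discardable c Γ' → Ctx.Discardable c Γ
  | _, _, .nil, _ => trivial
  | _, _, .cons (.keep none) d, h => (Drop.discardable d h :)
  | _, _, .cons (.keep (some _)) d, h => ⟨Drop.discardable d h.1, h.2⟩
  | _, _, .cons (.drop _ h') d, h => ⟨Drop.discardable d h, h'⟩

theorem Drop.nonLinear : {Γ' Γ : Ctx} → Drop c Γ' Γ → Γ.NonLinear → Γ'.NonLinear
  | _, _, .nil, _ => trivial
  | _, _, .cons (.keep none) d, h => (Drop.nonLinear d h :)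
  | _, _, .cons (.keep (some _)) d, h => ⟨Drop.nonLinear d h.1, h.2⟩
  | _, _, .cons (.drop _ _) d, h => (Drop.nonLinear d h.1 :)

theorem Drop.nonLinear_of_linear {Φ Θ : Ctx} (d : Drop .linear Φ Θ) (h : Φ.NonLinear) :
    Θ.NonLinear :=
  Ctx.Discardable.nonLinear (d.discardable (h.discardable .linear))

/-- The contexts that declare no variable. -/
def Ctx.Empty : Ctx → Prop
  | [] => True
  | none :: Γ => Ctx.Empty Γ
  | some _ :: _ => False

/-- `Single i A Γ`: the context `Γ` declares `xᵢ : A` and nothing else. -/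
inductive Single : ℕ → Ty → Ctx → Type
  | zero (A : Ty) {Γ : Ctx} : Γ.Empty → Single 0 A (some A :: Γ)
  | succ {i : ℕ} {A : Ty} {Γ : Ctx} : Single i A Γ → Single (i + 1) A (none :: Γ)

instance {i : ℕ} {A : Ty} {Γ : Ctx} : Subsingleton (Single i A Γ) :=
  ⟨fun x y => by
    induction x with
    | zero A h => cases y; rfl
    | succ x ih => cases y with | succ y => rw [ih y]⟩

theorem Ctx.Empty.nonLinear : {Γ : Ctx} → Γ.Empty → Γ.NonLinear
  | [], _ => trivial
  | none :: Γ, h => Ctx.Empty.nonLinear (Γ := Γ) h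

theorem Single.nonLinear {i : ℕ} {P : Ty} {Γ : Ctx} (s : Single i P Γ) (h : P.NonLinear) :
    Γ.NonLinear := by
  induction s with
  | zero A e => exact ⟨e.nonLinear, h⟩
  | succ _ ih => exact ih h

theorem Split.nonempty_share {Γ₁ Γ₂ Θ : Ctx} (s : Split Γ₁ Γ₂ Θ) :
    Nonempty (Share c Γ₁ Γ₂ Θ) := by
  obtain ⟨Φ, Γ, Δ, h, u, v, w⟩ := s
  induction u generalizing Γ₂ Δ Θ with
  | nil => cases v; cases w; exact ⟨.nil⟩
  | skip _ ih =>
    cases v with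
    | @skip _ Δ' _ v =>
      cases w with | skip w =>
      obtain ⟨g⟩ := ih Δ' h v w
      exact ⟨.cons .none g⟩
    | @inr A _ Δ' _ v =>
      cases w with | inr _ w =>
      obtain ⟨g⟩ := ih Δ' h v w
      exact ⟨.cons (.right A) g⟩
  | inl A _ ih =>
    cases v with | @inl _ _ Δ' _ v =>
    cases w with | inl _ w =>
    obtain ⟨g⟩ := ih Δ' h.1 v w
    exact ⟨.cons (.both A h.2) g⟩
  | inr A _ ih =>
    cases v with
    | @skip _ Δ' _ v =>
      cases w with | inl _ w =>
      obtain ⟨g⟩ := ih Δ' h v w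
      exact ⟨.cons (.left A) g⟩
    | inr A v => cases w

/-- Discarded variables can be passed to the first context instead and discarded there. -/
theorem Share.exists_split {Γ₁ Γ₂ Θ : Ctx} (g : Share c Γ₁ Γ₂ Θ) :
    ∃ Θ₁, Nonempty (Split Θ₁ Γ₂ Θ) ∧ Nonempty (Drop c Γ₁ Θ₁) := by
  induction g with
  | nil => exact ⟨[], ⟨⟨[], [], [], trivial, .nil, .nil, .nil⟩⟩, ⟨.nil⟩⟩
  | cons l _ ih =>
    obtain ⟨Θ₁, ⟨⟨Φ, Γ, Δ, h, u, v, w⟩⟩, ⟨d⟩⟩ := ih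
    cases l with
    | none => exact ⟨_, ⟨⟨none :: Φ, none :: Γ, none :: Δ, h, .skip u, .skip v, .skip w⟩⟩,
        ⟨.cons (.keep _) d⟩⟩
    | drop A hA => exact ⟨_, ⟨⟨none :: Φ, some A :: Γ, none :: Δ, h, .inr A u, .skip v, .inl A w⟩⟩,
        ⟨.cons (.drop A hA) d⟩⟩
    | left A => exact ⟨_, ⟨⟨none :: Φ, some A :: Γ, none :: Δ, h, .inr A u, .skip v, .inl A w⟩⟩,
        ⟨.cons (.keep _) d⟩⟩
    | right A => exact ⟨_, ⟨⟨none :: Φ, none :: Γ, some A :: Δ, h, .skip u, .inr A v, .inr A w⟩⟩,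
        ⟨.cons (.keep _) d⟩⟩
    | both A hA => exact ⟨_, ⟨⟨some A :: Φ, none :: Γ, none :: Δ, ⟨h, hA⟩, .inl A u, .inl A v,
        .inl A w⟩⟩, ⟨.cons (.keep _) d⟩⟩

theorem Drop.exists_union {Γ' Γ : Ctx} (d : Drop c Γ' Γ) :
    ∃ Δ, Nonempty (Union Γ' Δ Γ) ∧ Ctx.Discardable c Δ := by
  induction d with
  | nil => exact ⟨[], ⟨.nil⟩, trivial⟩
  | @cons o _ _ _ e _ ih =>
    obtain ⟨Δ, ⟨u⟩, h⟩ := ih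
    cases e with
    | keep =>
      cases o with
      | none => exact ⟨none :: Δ, ⟨.skip u⟩, h⟩
      | some A => exact ⟨none :: Δ, ⟨.inl A u⟩, h⟩
    | drop A hA => exact ⟨some A :: Δ, ⟨.inr A u⟩, h, hA⟩

theorem Ctx.Discardable.exists_empty {Γ : Ctx} (h : Ctx.Discardable c Γ) :
    ∃ Δ : Ctx, Δ.Empty ∧ Nonempty (Drop c Δ Γ) := by
  induction Γ with
  | nil => exact ⟨[], trivial, ⟨.nil⟩⟩
  | cons o Γ ih =>
    cases o with
    | none =>
      obtain ⟨Δ, hΔ, ⟨d⟩⟩ := ih h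
      exact ⟨none :: Δ, hΔ, ⟨.cons (.keep _) d⟩⟩
    | some A =>
      obtain ⟨Δ, hΔ, ⟨d⟩⟩ := ih h.1
      exact ⟨none :: Δ, hΔ, ⟨.cons (.drop A h.2) d⟩⟩

theorem Insert.exists_single {Γ Θ : Ctx} {i : ℕ} {A : Ty} (s : Insert Γ i A Θ)
    (h : Ctx.Discardable c Γ) : ∃ S, Nonempty (Single i A S) ∧ Nonempty (Drop c S Θ) := by
  induction s with
  | here Γ A =>
    obtain ⟨E, hE, ⟨d⟩⟩ := Ctx.Discardable.exists_empty (Γ := Γ) h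
    exact ⟨some A :: E, ⟨.zero A hE⟩, ⟨.cons (.keep _) d⟩⟩
  | there o _ ih =>
    cases o with
    | none =>
      obtain ⟨S, ⟨s⟩, ⟨d⟩⟩ := ih h
      exact ⟨none :: S, ⟨.succ s⟩, ⟨.cons (.keep _) d⟩⟩
    | some A =>
      obtain ⟨S, ⟨s⟩, ⟨d⟩⟩ := ih h.1
      exact ⟨none :: S, ⟨.succ s⟩, ⟨.cons (.drop A h.2) d⟩⟩

theorem Single.exists_insert {S Θ : Ctx} {i : ℕ} {A : Ty} (s : Single i A S)
    (d : Drop c S Θ) : ∃ Γ, Nonempty (Insert Γ i A Θ) ∧ Ctx.Discardable c Γ := by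
  induction s generalizing Θ with
  | zero A h =>
    cases d with | cons e d =>
    cases e
    exact ⟨_, ⟨.here _ A⟩, d.discardable (h.nonLinear.discardable c)⟩
  | succ _ ih =>
    cases d with | cons e d =>
    obtain ⟨Γ, ⟨j⟩, h⟩ := ih d
    cases e with
    | keep => exact ⟨none :: Γ, ⟨.there none j⟩, h⟩
    | drop A hA => exact ⟨some A :: Γ, ⟨.there (some A) j⟩, h, hA⟩

/-- Two entries that do not disagree. -/
def OptCompat (o o' : Option Ty) : Prop := ∀ A A', o = some A → o' = some A' → A = A'

theorem OptCompat.refl (o : Option Ty) : OptCompat o o :=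
  fun _ _ h h' => Option.some.inj (h.symm.trans h')

theorem OptCompat.none_left (o : Option Ty) : OptCompat none o := fun _ _ h => nomatch h

theorem OptCompat.none_right (o : Option Ty) : OptCompat o none := fun _ _ _ h' => nomatch h'

/-- Two contexts of the same length that agree on the types of the variables declared in both. -/
abbrev Compat : Ctx → Ctx → Prop := List.Forall₂ OptCompat

theorem Compat.refl (Γ : Ctx) : Compat Γ Γ :=
  List.forall₂_same.2 fun o _ => .refl o

theorem Compat.cons_some (A : Ty) {Γ Γ' : Ctx} (h : Compat Γ Γ') :
    Compat (some A :: Γ) (some A :: Γ') :=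
  .cons (.refl _) h

theorem Compat.drop {Γ Γ' Θ Θ' : Ctx} (h : Compat Θ Θ') (d : Drop c Γ Θ) (d' : Drop c Γ' Θ') :
    Compat Γ Γ' := by
  induction h generalizing Γ Γ' with
  | nil => cases d; cases d'; exact .nil
  | cons r _ ih =>
    cases d with | cons e d =>
    cases d' with | cons e' d' =>
    refine .cons ?_ (ih d d')
    cases e <;> cases e' <;> first | exact r | exact .none_left _ | exact .none_right _

theorem Compat.share_fst {Γ₁ Γ₂ Γ₁' Γ₂' Θ Θ' : Ctx} (h : Compat Θ Θ') (g : Share c Γ₁ Γ₂ Θ)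
    (g' : Share c Γ₁' Γ₂' Θ') : Compat Γ₁ Γ₁' := by
  induction h generalizing Γ₁ Γ₂ Γ₁' Γ₂' with
  | nil => cases g; cases g'; exact .nil
  | cons r _ ih =>
    cases g with | cons l g =>
    cases g' with | cons l' g' =>
    refine .cons ?_ (ih g g')
    cases l <;> cases l' <;> first | exact r | exact .none_left _ | exact .none_right _

theorem Compat.share_snd {Γ₁ Γ₂ Γ₁' Γ₂' Θ Θ' : Ctx} (h : Compat Θ Θ') (g : Share c Γ₁ Γ₂ Θ)
    (g' : Share c Γ₁' Γ₂' Θ') : Compat Γ₂ Γ₂' :=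
  h.share_fst g.swap g'.swap

theorem Compat.empty_eq {Γ Γ' : Ctx} (h : Compat Γ Γ') (e : Γ.Empty) (e' : Γ'.Empty) : Γ = Γ' := by
  induction h with
  | nil => rfl
  | @cons o o' Γ Γ' r _ ih =>
    cases o with
    | some A => exact e.elim
    | none =>
      cases o' with
      | some A => exact e'.elim
      | none => rw [ih e e']

theorem Compat.single_eq {i : ℕ} {A A' : Ty} {Γ Γ' : Ctx} (h : Compat Γ Γ') (s : Single i A Γ)
    (s' : Single i A' Γ') : A = A' ∧ Γ = Γ' := by
  induction s generalizing Γ' with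
  | zero A e =>
    cases s' with | zero _ e' =>
    cases h with | cons r h =>
    obtain rfl := r _ _ rfl rfl
    obtain rfl := Compat.empty_eq h e e'
    exact ⟨rfl, rfl⟩
  | succ _ ih =>
    cases s' with | succ s' =>
    cases h with | cons r h =>
    obtain ⟨rfl, rfl⟩ := ih h s'
    exact ⟨rfl, rfl⟩

theorem Compat.exists_empty {Γ Γ' : Ctx} (h : Compat Γ Γ') (e : Ctx.Discardable c Γ)
    (e' : Ctx.Discardable c Γ') :
    ∃ Δ : Ctx, Δ.Empty ∧ Nonempty (Drop c Δ Γ) ∧ Nonempty (Drop c Δ Γ') := by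
  obtain ⟨Δ, hΔ, ⟨d⟩⟩ := e.exists_empty
  obtain ⟨Δ', hΔ', ⟨d'⟩⟩ := e'.exists_empty
  obtain rfl := (h.drop d d').empty_eq hΔ hΔ'
  exact ⟨Δ, hΔ, ⟨d⟩, ⟨d'⟩⟩

theorem Drop.exists_join {Δ₁ Δ₂ Γ : Ctx} (d₁ : Drop c Δ₁ Γ) (d₂ : Drop c Δ₂ Γ) :
    Nonempty (Drop c Δ₁ (Ctx.join Δ₁ Δ₂)) ∧ Nonempty (Drop c Δ₂ (Ctx.join Δ₁ Δ₂)) ∧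
      Nonempty (Drop c (Ctx.join Δ₁ Δ₂) Γ) := by
  induction d₁ generalizing Δ₂ with
  | nil => cases d₂; exact ⟨⟨.nil⟩, ⟨.nil⟩, ⟨.nil⟩⟩
  | cons e₁ _ ih =>
    cases d₂ with | cons e₂ d₂ =>
    obtain ⟨⟨a₁⟩, ⟨a₂⟩, ⟨a⟩⟩ := ih d₂
    cases e₁ with
    | keep =>
      cases e₂ with
      | keep =>
        have optJoin_self (o : Option Ty) : optJoin o o = o := by cases o <;> rfl
        rw [Ctx.join, optJoin_self]
        exact ⟨⟨.cons (.keep _) a₁⟩, ⟨.cons (.keep _) a₂⟩, ⟨.cons (.keep _) a⟩⟩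
      | drop A h => exact ⟨⟨.cons (.keep _) a₁⟩, ⟨.cons (.drop A h) a₂⟩, ⟨.cons (.keep _) a⟩⟩
    | drop A h =>
      cases e₂ with
      | keep => exact ⟨⟨.cons (.drop A h) a₁⟩, ⟨.cons (.keep _) a₂⟩, ⟨.cons (.keep _) a⟩⟩
      | drop => exact ⟨⟨.cons (.keep _) a₁⟩, ⟨.cons (.keep _) a₂⟩, ⟨.cons (.drop A h) a⟩⟩
theorem Share.exists_interchange {Γ₁ Γ₂ Θ Γ₁₁ Γ₁₂ Γ₂₁ Γ₂₂ : Ctx} (g : Share c Γ₁ Γ₂ Θ)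
    (g₁ : Share c Γ₁₁ Γ₁₂ Γ₁) (g₂ : Share c Γ₂₁ Γ₂₂ Γ₂) :
    ∃ Δ₁ Δ₂, Nonempty (Share c Δ₁ Δ₂ Θ) ∧ Nonempty (Share c Γ₁₁ Γ₂₁ Δ₁) ∧
      Nonempty (Share c Γ₁₂ Γ₂₂ Δ₂) := by
  induction g generalizing Γ₁₁ Γ₁₂ Γ₂₁ Γ₂₂ with
  | nil => cases g₁; cases g₂; exact ⟨[], [], ⟨.nil⟩, ⟨.nil⟩, ⟨.nil⟩⟩
  | cons l _ ih =>
    cases g₁ with | @cons a₁ b₁ _ _ _ _ l₁ g₁ =>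
    cases g₂ with | @cons a₂ b₂ _ _ _ _ l₂ g₂ =>
    obtain ⟨Δ₁, Δ₂, ⟨h⟩, ⟨h₁⟩, ⟨h₂⟩⟩ := ih g₁ g₂
    suffices Nonempty (OptShare c (optJoin a₁ a₂) (optJoin b₁ b₂) _) ∧
        Nonempty (OptShare c a₁ a₂ (optJoin a₁ a₂)) ∧
        Nonempty (OptShare c b₁ b₂ (optJoin b₁ b₂)) by
      obtain ⟨⟨e⟩, ⟨e₁⟩, ⟨e₂⟩⟩ := this
      exact ⟨_, _, ⟨.cons e h⟩, ⟨.cons e₁ h₁⟩, ⟨.cons e₂ h₂⟩⟩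
    cases l <;> cases l₁ <;> cases l₂ <;> refine ⟨⟨?_⟩, ⟨?_⟩, ⟨?_⟩⟩ <;> constructor <;> assumption

theorem Share.exists_assoc {Γ Γ₁ Γ₁₁ Γ₁₂ Θ : Ctx} (g : Share c Γ Γ₁ Θ) (g₁ : Share c Γ₁₁ Γ₁₂ Γ₁) :
    ∃ Δ, Nonempty (Share c Γ Γ₁₁ Δ) ∧ Nonempty (Share c Δ Γ₁₂ Θ) :=
  ⟨_, ⟨(g.swap.assocInner g₁.swap).swap⟩, ⟨(g.swap.assocOuter g₁.swap).swap⟩⟩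

theorem Share.exists_unit (Γ : Ctx) : ∃ Δ : Ctx, Δ.Empty ∧ Nonempty (Share c Γ Δ Γ) := by
  induction Γ with
  | nil => exact ⟨[], trivial, ⟨.nil⟩⟩
  | cons o Γ ih =>
    obtain ⟨Δ, hΔ, ⟨g⟩⟩ := ih
    refine ⟨none :: Δ, hΔ, ?_⟩
    cases o with
    | none => exact ⟨.cons .none g⟩
    | some A => exact ⟨.cons (.left A) g⟩

/-! ### Terms -/

theorem Tm.upSub_var : Tm.upSub Tm.var = Tm.var := by
  funext i
  cases i <;> rfl

theorem Tm.upSub_var_comp (ρ : ℕ → ℕ) :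
    Tm.upSub (fun i => .var (ρ i)) = fun i => .var (Tm.upRen ρ i) := by
  funext i
  cases i <;> rfl

theorem Tm.rename_eq_subst (m : Tm) (ρ : ℕ → ℕ) : m.rename ρ = m.subst fun i => .var (ρ i) := by
  induction m generalizing ρ <;> simp_all [Tm.rename, Tm.subst, Tm.upSub_var_comp]

theorem IsValue.rename {v : Tm} (h : IsValue v) (ρ : ℕ → ℕ) : IsValue (v.rename ρ) := by
  induction h with
  | var i => exact .var _
  | star => exact .star
  | left _ ih => exact .left ih
  | right _ ih => exact .right ih
  | pair _ _ ih ih' => exact .pair ih ih'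
  | lam => exact .lam _ _
  | lift => exact .lift _

theorem Der.nonempty_var {i : ℕ} {A : Ty} {S Θ : Ctx} (s : Single i A S) (d : Drop c S Θ) :
    Nonempty (Der c Θ (.var i) A) := by
  obtain ⟨Γ, ⟨j⟩, h⟩ := s.exists_insert d
  cases c with
  | linear => exact ⟨.varL h.nonLinear j⟩
  | affine => exact ⟨.varA j⟩

theorem Der.nonempty_star {Γ : Ctx} (h : Ctx.Discardable c Γ) : Nonempty (Der c Γ .star .unit) := by
  cases c with
  | linear => exact ⟨.starL h.nonLinear⟩
  | affine => exact ⟨.starA⟩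

theorem Der.nonempty_lift {Φ Θ : Ctx} {m : Tm} {A : Ty} (h : Φ.NonLinear) (d : Drop c Φ Θ)
    (hm : ∀ {Θ' : Ctx}, Drop c Φ Θ' → Nonempty (Der c Θ' m A)) :
    Nonempty (Der c Θ (.lift m) (.bang A)) := by
  cases c with
  | linear => exact (hm d).map (.liftL (d.nonLinear_of_linear h))
  | affine =>
    obtain ⟨Δ, ⟨u⟩, -⟩ := d.exists_union
    exact (hm (.refl _)).map (.liftA h u)

theorem Der.nonempty_recur {Φ Θ : Ctx} {m : Tm} {A : Ty} (h : Φ.NonLinear) (d : Drop c Φ Θ)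
    (hm : ∀ {Θ' : Ctx}, Drop c Φ Θ' → Nonempty (Der c (some (.bang A) :: Θ') m A)) :
    Nonempty (Der c Θ (.recur A m) A) := by
  cases c with
  | linear => exact (hm d).map (.recur (d.nonLinear_of_linear h))
  | affine =>
    obtain ⟨Δ, ⟨u⟩, -⟩ := d.exists_union
    exact (hm (.refl _)).map (.recurA h u)

end Calculus

/-! ### Interpretation of types and contexts -/

noncomputable section

namespace LinearModel

variable {B : Type u₁} [Category.{v₁} B] [CartesianMonoidalCategory B]
  [BraidedCategory B] [HasFiniteCoproducts B]
  {V : Type u₂} [Category.{v₂} V] [MonoidalCategory V] [SymmetricCategory V]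
  [HasFiniteCoproducts V]
  {C : Type u₃} [Category.{v₃} C] [MonoidalCategory C] [SymmetricCategory C]
  [HasFiniteCoproducts C]
  (M : LinearModel B V C) {c : Calculus} (t : M.Supports c)

/-- The canonical isomorphism `F⟦P⟧_B ≅ ⟦P⟧`. -/
def tyIsoF (P : Ty) (h : P.NonLinear) : M.F.obj (M.tyB P h) ≅ M.tyC P :=
  Transport.comp (M.tyIsoC P) (M.tyIsoV P h)

/-- Discarding `⟦A⟧ ⟶ I`: the terminal map of `B` or of `V`, transported to `C`. -/
def discTy : {c : Calculus} → M.Supports c → (A : Ty) → Ty.Discardable c A → (M.tyC A ⟶ 𝟙_ C)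
  | .linear, _, A, h => Transport.discard (M.tyIsoF A h)
  | .affine, t, A, _ =>
      Transport.hom (M.tyIsoC A) (Transport.unit M.L) (IsTerminal.from t (M.tyV A))

theorem discTy_of_nonLinear {P : Ty} (hP : P.NonLinear) (h : Ty.Discardable c P) :
    M.discTy t P h = Transport.discard (M.tyIsoF P hP) := by
  cases c
  · rfl
  · have e := Transport.comp_unit (J := M.J) (H := M.L)
    rw [discTy, Transport.discard]
    erw [← e]
    rw [tyIsoF, Transport.hom_hom]
    congr 1
    exact IsTerminal.hom_ext t _ _

theorem isImage_discTy (A : Ty) (h : Ty.Discardable c A) :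
    Transport.IsImage (M.tyIsoC A) (Transport.unit M.L) (M.discTy t A h) := by
  cases c
  · have e := Transport.comp_unit (J := M.J) (H := M.L)
    rw [discTy, Transport.discard]
    erw [← e]
    exact Transport.IsImage.of_comp (Transport.isImage_hom ..)
  · exact Transport.isImage_hom ..

/-- The interpretation of an entry of a context. -/
@[reducible] def optC : Option Ty → C
  | none => 𝟙_ C
  | some A => M.tyC A

/-- `⟦o :: Γ⟧ ≅ ⟦Γ⟧ ⊗ ⟦o⟧`, which is an identity only for a declared variable. -/
def consIso : (o : Option Ty) → (Γ : Ctx) → (M.ctxC (o :: Γ) ≅ M.ctxC Γ ⊗ M.optC o)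
  | none, Γ => (ρ_ (M.ctxC Γ)).symm
  | some _, _ => Iso.refl _

/-- Discarding of an entry of a context. -/
def optDropMap : {o' o : Option Ty} → OptDrop c o' o → (M.optC o ⟶ M.optC o')
  | _, _, .keep _ => 𝟙 _
  | _, _, .drop A h => M.discTy t A h

/-- Distribution of an entry of a context over two contexts. -/
def optShareMap : {o₁ o₂ o : Option Ty} → OptShare c o₁ o₂ o → (M.optC o ⟶ M.optC o₁ ⊗ M.optC o₂)
  | _, _, _, .none => (λ_ (𝟙_ C)).inv
  | _, _, _, .drop A h => M.discTy t A h ≫ (λ_ (𝟙_ C)).inv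
  | _, _, _, .left _ => (ρ_ _).inv
  | _, _, _, .right _ => (λ_ _).inv
  | _, _, _, .both A h => Transport.copy (M.tyIsoF A h)

/-- Discarding of some of the variables of a context. -/
def dropMap : {Γ' Γ : Ctx} → Drop c Γ' Γ → (M.ctxC Γ ⟶ M.ctxC Γ')
  | _, _, .nil => 𝟙 _
  | _, _, .cons (o' := o') (o := o) (Γ' := Γ') (Γ := Γ) e d =>
      (M.consIso o Γ).hom ≫ (dropMap d ⊗ₘ M.optDropMap t e) ≫ (M.consIso o' Γ').inv

/-- Distribution of the variables of a context over two contexts. -/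
def shareMap : {Γ₁ Γ₂ Θ : Ctx} → Share c Γ₁ Γ₂ Θ → (M.ctxC Θ ⟶ M.ctxC Γ₁ ⊗ M.ctxC Γ₂)
  | _, _, _, .nil => (λ_ (𝟙_ C)).inv
  | _, _, _, .cons (o₁ := o₁) (o₂ := o₂) (o := o) (Γ₁ := Γ₁) (Γ₂ := Γ₂) (Θ := Θ) l g =>
      (M.consIso o Θ).hom ≫ ((shareMap g ⊗ₘ M.optShareMap t l) ≫ tensorμ _ _ _ _) ≫
        ((M.consIso o₁ Γ₁).inv ⊗ₘ (M.consIso o₂ Γ₂).inv)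

/-- Discarding of all variables of a context. -/
def discMap : (Γ : Ctx) → Ctx.Discardable c Γ → (M.ctxC Γ ⟶ 𝟙_ C)
  | [], _ => 𝟙 _
  | none :: Γ, h => discMap Γ h
  | some A :: Γ, h => (discMap Γ h.1 ⊗ₘ M.discTy t A h.2) ≫ (λ_ (𝟙_ C)).hom

@[simp]
theorem copy_discTy_right {P : Ty} (hP : P.NonLinear) (h : Ty.Discardable c P) :
    Transport.copy (M.tyIsoF P hP) ≫ M.tyC P ◁ M.discTy t P h = (ρ_ _).inv := by
  rw [M.discTy_of_nonLinear t hP, Transport.copy_discard_right]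

@[simp]
theorem copy_discTy_left {P : Ty} (hP : P.NonLinear) (h : Ty.Discardable c P) :
    Transport.copy (M.tyIsoF P hP) ≫ M.discTy t P h ▷ M.tyC P = (λ_ _).inv := by
  rw [M.discTy_of_nonLinear t hP, Transport.copy_discard_left]

theorem copy_discTy_discTy {P : Ty} (hP : P.NonLinear) (h : Ty.Discardable c P) :
    Transport.copy (M.tyIsoF P hP) ≫ (M.discTy t P h ⊗ₘ M.discTy t P h) =
      M.discTy t P h ≫ (λ_ (𝟙_ C)).inv := by
  rw [M.discTy_of_nonLinear t hP, ← Transport.copy_unit (H := M.F)]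
  exact (Transport.isImage_discard.copy).symm

theorem optDropMap_comp {o'' o' o : Option Ty} (e' : OptDrop c o'' o') (e : OptDrop c o' o)
    (e'' : OptDrop c o'' o) : M.optDropMap t e ≫ M.optDropMap t e' = M.optDropMap t e'' := by
  cases e <;> cases e' <;> cases e'' <;> simp [optDropMap]

theorem optShareMap_dropBoth {o₁ o₂ o o₁' o₂' : Option Ty} (l : OptShare c o₁ o₂ o)
    (e₁ : OptDrop c o₁' o₁) (e₂ : OptDrop c o₂' o₂) (l' : OptShare c o₁' o₂' o) :
    M.optShareMap t l ≫ (M.optDropMap t e₁ ⊗ₘ M.optDropMap t e₂) = M.optShareMap t l' := by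
  cases l <;> cases e₁ <;> cases e₂ <;> cases l' <;>
    simp [optDropMap, optShareMap, copy_discTy_discTy, unitors_inv_equal]

theorem optDropMap_share {o₁ o₂ o o' : Option Ty} (e : OptDrop c o' o)
    (l : OptShare c o₁ o₂ o') (l' : OptShare c o₁ o₂ o) :
    M.optDropMap t e ≫ M.optShareMap t l = M.optShareMap t l' := by
  cases e <;> cases l <;> cases l' <;> simp [optDropMap, optShareMap]

theorem optShareMap_swap {o₁ o₂ o : Option Ty} (l : OptShare c o₁ o₂ o) (l' : OptShare c o₂ o₁ o) :
    M.optShareMap t l ≫ (β_ _ _).hom = M.optShareMap t l' := by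
  cases l <;> cases l' <;> simp [optShareMap, unitors_inv_equal]

theorem optShareMap_assoc {o₁ o₂ o o₃ o₄ o' : Option Ty} (g : OptShare c o₁ o₂ o)
    (g₁ : OptShare c o₃ o₄ o₁) (g' : OptShare c o₃ o' o) (g₂ : OptShare c o₄ o₂ o') :
    IsCoassoc (M.optShareMap t g) (M.optShareMap t g₁) (M.optShareMap t g')
      (M.optShareMap t g₂) := by
  unfold IsCoassoc
  cases g <;> cases g₁ <;> cases g' <;> cases g₂ <;>
    simp [optShareMap, Transport.copy_assoc, reassoc_of% M.copy_discTy_left t,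
      reassoc_of% M.copy_discTy_right t, unitors_inv_equal]

theorem dropMap_comp {Γ'' Γ' Γ : Ctx} (d' : Drop c Γ'' Γ') (d : Drop c Γ' Γ) (d'' : Drop c Γ'' Γ) :
    M.dropMap t d ≫ M.dropMap t d' = M.dropMap t d'' := by
  induction d generalizing Γ'' with
  | nil => cases d'; cases d''; simp [dropMap]
  | cons e d ih =>
    cases d' with | cons e' d' =>
    cases d'' with | cons e'' d'' =>
    simp [dropMap, tensorHom_comp_tensorHom_assoc, ih d' d'', M.optDropMap_comp t e' e e'']

theorem dropMap_refl {Γ : Ctx} (d : Drop c Γ Γ) : M.dropMap t d = 𝟙 _ := by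
  rw [Subsingleton.elim d (Drop.refl Γ)]
  clear d
  induction Γ with
  | nil => rfl
  | cons o Γ ih => simp [Drop.refl, dropMap, ih, optDropMap]

theorem shareMap_dropBoth {Γ₁ Γ₂ Θ Γ₁' Γ₂' : Ctx} (g : Share c Γ₁ Γ₂ Θ)
    (d₁ : Drop c Γ₁' Γ₁) (d₂ : Drop c Γ₂' Γ₂) (g' : Share c Γ₁' Γ₂' Θ) :
    M.shareMap t g ≫ (M.dropMap t d₁ ⊗ₘ M.dropMap t d₂) = M.shareMap t g' := by
  induction g generalizing Γ₁' Γ₂' with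
  | nil => cases d₁; cases d₂; cases g'; simp [dropMap]
  | cons l g ih =>
    cases d₁ with | cons e₁ d₁ =>
    cases d₂ with | cons e₂ d₂ =>
    cases g' with | cons l' g' =>
    simp only [shareMap, dropMap, ← ih d₁ d₂ g', ← M.optShareMap_dropBoth t l e₁ e₂ l',
      Category.assoc, tensorHom_comp_tensorHom, Iso.inv_hom_id_assoc]
    simp only [← tensorHom_comp_tensorHom, Category.assoc, tensorμ_natural_assoc]

theorem dropMap_share {Γ₁ Γ₂ Θ Θ' : Ctx} (d : Drop c Θ' Θ) (g : Share c Γ₁ Γ₂ Θ')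
    (g' : Share c Γ₁ Γ₂ Θ) : M.dropMap t d ≫ M.shareMap t g = M.shareMap t g' := by
  induction d generalizing Γ₁ Γ₂ with
  | nil => cases g; cases g'; simp [dropMap]
  | cons e d ih =>
    cases g with | cons l g =>
    cases g' with | cons l' g' =>
    simp [shareMap, dropMap, ← ih g g', ← M.optDropMap_share t e l l',
      tensorHom_comp_tensorHom_assoc]

theorem shareMap_swap {Γ₁ Γ₂ Θ : Ctx} (g : Share c Γ₁ Γ₂ Θ) (g' : Share c Γ₂ Γ₁ Θ) :
    M.shareMap t g ≫ (β_ _ _).hom = M.shareMap t g' := by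
  induction g with
  | nil => cases g'; simp [shareMap, unitors_inv_equal]
  | cons l g ih =>
    cases g' with | cons l' g' =>
    simp only [shareMap, ← ih g', ← M.optShareMap_swap t l l', Category.assoc,
      BraidedCategory.braiding_naturality, reassoc_of% tensorμ_braiding,
      tensorHom_comp_tensorHom_assoc]

theorem shareMap_assoc {Γ₁ Γ₂ Θ Γ₃ Γ₄ Γ' : Ctx} (g : Share c Γ₁ Γ₂ Θ) (g₁ : Share c Γ₃ Γ₄ Γ₁)
    (g' : Share c Γ₃ Γ' Θ) (g₂ : Share c Γ₄ Γ₂ Γ') :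
    IsCoassoc (M.shareMap t g) (M.shareMap t g₁) (M.shareMap t g') (M.shareMap t g₂) := by
  induction g generalizing Γ₃ Γ₄ Γ' with
  | nil =>
    cases g₁; cases g'; cases g₂
    simp only [IsCoassoc, shareMap]
    monoidal
  | cons l g ih =>
    cases g₁ with | cons l₁ g₁ =>
    cases g' with | cons l' g' =>
    cases g₂ with | cons l₂ g₂ =>
    exact ((ih g₁ g' g₂).tensor (M.optShareMap_assoc t l l₁ l' l₂)).conj _ _ _ _ _ _

theorem shareMap_dropRight {Γ₁ Γ₂ Θ Γ₂' : Ctx} (g : Share c Γ₁ Γ₂ Θ) (d : Drop c Γ₂' Γ₂)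
    (g' : Share c Γ₁ Γ₂' Θ) : M.shareMap t g ≫ _ ◁ M.dropMap t d = M.shareMap t g' := by
  rw [← M.shareMap_dropBoth t g (Drop.refl _) d g', dropMap_refl, id_tensorHom]

theorem shareMap_comp_whiskerLeft_eq {X Y Y' Y₁ Y₂ Θ : Ctx} (g : Share c X Y Θ)
    (h : Share c Y₁ Y₂ Y) (g' : Share c X Y' Θ) (h' : Share c Y₁ Y₂ Y') :
    M.shareMap t g ≫ _ ◁ M.shareMap t h = M.shareMap t g' ≫ _ ◁ M.shareMap t h' := by
  have through_join {Z : Ctx} (k : Share c X Z Θ) (l : Share c Y₁ Y₂ Z)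
      (k' : Share c X (Ctx.join Y₁ Y₂) Θ) :
      M.shareMap t k ≫ _ ◁ M.shareMap t l = M.shareMap t k' ≫ _ ◁ M.shareMap t l.join := by
    rw [← M.dropMap_share t l.dropJoin l.join l, whiskerLeft_comp,
      reassoc_of% M.shareMap_dropRight t k l.dropJoin k']
  let k : Share c X (Ctx.join Y₁ Y₂) Θ := g.dropBoth (Drop.refl _) h.dropJoin
  rw [through_join g h k, through_join g' h' k, Subsingleton.elim h.join h'.join]

theorem shareMap_exchange {X Y Y₁ Y₂ E Θ : Ctx} (g : Share c X Y Θ) (h : Share c Y₁ Y₂ Y)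
    (g' : Share c Y₁ E Θ) (h' : Share c X Y₂ E) :
    M.shareMap t g ≫ _ ◁ M.shareMap t h ≫ (α_ _ _ _).inv ≫ (β_ _ _).hom ▷ _ ≫
      (α_ _ _ _).hom = M.shareMap t g' ≫ _ ◁ M.shareMap t h' := by
  let outer := (g.swap.assocOuter h.swap).swap
  let inner := g.swap.assocInner h.swap
  have assoc : M.shareMap t outer ≫ M.shareMap t inner.swap ▷ _ ≫ (α_ _ _ _).hom =
      M.shareMap t g ≫ _ ◁ M.shareMap t h := M.shareMap_assoc t _ _ _ _
  have assoc' : M.shareMap t outer ≫ M.shareMap t inner ▷ _ ≫ (α_ _ _ _).hom =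
      M.shareMap t (outer.assocOuter inner) ≫ _ ◁ M.shareMap t (outer.assocInner inner) :=
    M.shareMap_assoc t _ _ _ _
  rw [← reassoc_of% assoc, Iso.hom_inv_id_assoc, ← comp_whiskerRight_assoc,
    M.shareMap_swap t inner.swap inner, assoc']
  exact M.shareMap_comp_whiskerLeft_eq t _ _ _ _

theorem shareMap_interchange {Γ₁ Γ₂ Θ Γ₁₁ Γ₁₂ Γ₂₁ Γ₂₂ Δ₁ Δ₂ : Ctx} (g : Share c Γ₁ Γ₂ Θ)
    (g₁ : Share c Γ₁₁ Γ₁₂ Γ₁) (g₂ : Share c Γ₂₁ Γ₂₂ Γ₂) (h : Share c Δ₁ Δ₂ Θ)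
    (h₁ : Share c Γ₁₁ Γ₂₁ Δ₁) (h₂ : Share c Γ₁₂ Γ₂₂ Δ₂) :
    M.shareMap t g ≫ (M.shareMap t g₁ ⊗ₘ M.shareMap t g₂) ≫ tensorμ _ _ _ _ =
      M.shareMap t h ≫ (M.shareMap t h₁ ⊗ₘ M.shareMap t h₂) := by
  let a := g.assocOuter g₁
  let b := g.assocInner g₁
  let r := ((b.swap.assocOuter g₂.swap).swap).assocOuter (b.swap.assocInner g₂.swap)
  let u := ((b.swap.assocOuter g₂.swap).swap).assocInner (b.swap.assocInner g₂.swap)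
  let a' := h.assocOuter h₁
  let b' := h.assocInner h₁
  let b'' := b'.dropBoth (Drop.refl _) h₂.dropJoin
  have assoc : M.shareMap t g ≫ M.shareMap t g₁ ▷ _ ≫ (α_ _ _ _).hom =
      M.shareMap t a ≫ _ ◁ M.shareMap t b := M.shareMap_assoc t _ _ _ _
  have assoc' : M.shareMap t h ≫ M.shareMap t h₁ ▷ _ ≫ (α_ _ _ _).hom =
      M.shareMap t a' ≫ _ ◁ M.shareMap t b' := M.shareMap_assoc t _ _ _ _
  have nested : M.shareMap t a ≫ _ ◁ (M.shareMap t r ≫ _ ◁ M.shareMap t u) =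
      M.shareMap t a' ≫ _ ◁ (M.shareMap t b' ≫ _ ◁ M.shareMap t h₂) := by
    rw [M.shareMap_comp_whiskerLeft_eq t b' h₂ b'' u, whiskerLeft_comp, whiskerLeft_comp,
      reassoc_of% M.shareMap_comp_whiskerLeft_eq t a r a' b'']
  rw [← cancel_mono (α_ _ _ _).hom, tensorμ]
  simp only [MonoidalCategory.tensorHom_def, Category.assoc, Iso.inv_hom_id, Category.comp_id,
    tensor_whiskerLeft, Iso.inv_hom_id_assoc, reassoc_of% assoc, reassoc_of% assoc']
  simp only [← whiskerLeft_comp, M.shareMap_exchange t b g₂ r u, nested]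

theorem dropMap_disc {Γ' Γ : Ctx} (d : Drop c Γ' Γ) (h' : Ctx.Discardable c Γ')
    (h : Ctx.Discardable c Γ) :
    M.dropMap t d ≫ M.discMap t Γ' h' = M.discMap t Γ h := by
  induction d with
  | nil => simp [dropMap, discMap]
  | @cons o' o Γ' Γ e d ih =>
    cases e with
    | keep =>
      cases o' with
      | none =>
        rw [discMap, discMap, ← ih h' h]
        simp [dropMap, consIso, optDropMap]
      | some A =>
        rw [discMap, discMap, ← ih h'.1 h.1]
        simp [dropMap, consIso, optDropMap, MonoidalCategory.tensorHom_def]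
    | drop A hA =>
      rw [discMap, discMap, ← ih h' h.1]
      simp [dropMap, consIso, optDropMap, MonoidalCategory.tensorHom_def', unitors_equal]

theorem shareMap_discSnd {Γ₁ Γ₂ Θ : Ctx} (g : Share c Γ₁ Γ₂ Θ) (h : Ctx.Discardable c Γ₂)
    (d : Drop c Γ₁ Θ) : M.shareMap t g ≫ _ ◁ M.discMap t Γ₂ h ≫ (ρ_ _).hom = M.dropMap t d := by
  induction g with
  | nil => cases d; simp [shareMap, dropMap, discMap, ctxC, ← unitors_equal]
  | @cons o₁ o₂ o Γ₁ Γ₂ Θ l g ih =>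
    cases d with | cons e d =>
    obtain ⟨h', v, hv, hl⟩ : ∃ (h' : Ctx.Discardable c Γ₂) (v : M.optC o₂ ⟶ 𝟙_ C),
        M.discMap t (o₂ :: Γ₂) h =
          (M.consIso o₂ Γ₂).hom ≫ (M.discMap t Γ₂ h' ⊗ₘ v) ≫ (λ_ _).hom ∧
        M.optShareMap t l ≫ _ ◁ v ≫ (ρ_ _).hom = M.optDropMap t e := by
      cases o₂ with
      | none =>
        refine ⟨h, 𝟙 _, by simp [consIso, discMap, unitors_equal], ?_⟩
        cases l <;> cases e <;> simp [optShareMap, optDropMap, ← unitors_equal]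
      | some A =>
        refine ⟨h.1, M.discTy t A h.2, by simp [consIso, discMap], ?_⟩
        cases l <;> cases e <;> simp [optShareMap, optDropMap,
          reassoc_of% M.copy_discTy_right t, optC, ← unitors_equal]
    have k := tensorHom_tensorμ_discard_right (M.shareMap t g) (M.optShareMap t l)
      (M.discMap t Γ₂ h') v
    rw [ih h' d, hl] at k
    rw [shareMap, dropMap, hv, conj_comp_discard_right, k]

theorem shareMap_discFst {Γ₁ Γ₂ Θ : Ctx} (g : Share c Γ₁ Γ₂ Θ) (h : Ctx.Discardable c Γ₁)
    (d : Drop c Γ₂ Θ) : M.shareMap t g ≫ M.discMap t Γ₁ h ▷ _ ≫ (λ_ _).hom = M.dropMap t d := by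
  rw [← M.shareMap_discSnd t g.swap h d, ← M.shareMap_swap t g g.swap, Category.assoc,
    ← BraidedCategory.braiding_naturality_left_assoc, braiding_rightUnitor]

/-! ### Comparison with the structural morphisms -/

theorem ctxIsoF_nil (h : Ctx.NonLinear []) : M.ctxIsoF [] h = Transport.unit M.F :=
  Transport.comp_unit

theorem ctxIsoF_cons (Φ : Ctx) (P : Ty) (h : Ctx.NonLinear (some P :: Φ)) :
    M.ctxIsoF (some P :: Φ) h = Transport.tensor (M.ctxIsoF Φ h.1) (M.tyIsoF P h.2) :=
  Transport.comp_tensor _ _ _ _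

theorem discard_eq (Φ : Ctx) (h : Φ.NonLinear) : M.discard Φ h =
    M.discMap t Φ (h.discardable c) := by
  change Transport.discard (M.ctxIsoF Φ h) = _
  induction Φ with
  | nil => rw [ctxIsoF_nil, Transport.discard_unit]; rfl
  | cons o Φ ih =>
    cases o with
    | none => exact ih h
    | some P => rw [ctxIsoF_cons, Transport.discard_tensor, ih h.1, discMap,
        M.discTy_of_nonLinear t h.2]

theorem shareMap_none {Γ₁ Γ₂ Θ : Ctx} (g : Share c Γ₁ Γ₂ Θ) :
    M.shareMap t (.cons .none g) = M.shareMap t g := by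
  simp only [shareMap, consIso, optShareMap, Iso.symm_hom, Iso.symm_inv, Category.assoc]
  rw [MonoidalCategory.tensorHom_def, Category.assoc, ← tensor_right_unitality]
  simp

theorem shareMap_left (A : Ty) {Γ₁ Γ₂ Θ : Ctx} (g : Share c Γ₁ Γ₂ Θ) :
    M.shareMap t (.cons (.left A) g) = M.shareMap t g ▷ M.tyC A ≫ (α_ _ _ _).hom ≫
      _ ◁ (β_ _ _).hom ≫ (α_ _ _ _).inv := by
  simp [shareMap, consIso, optShareMap, MonoidalCategory.tensorHom_def, tensorμ]

theorem shareMap_right (A : Ty) {Γ₁ Γ₂ Θ : Ctx} (g : Share c Γ₁ Γ₂ Θ) :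
    M.shareMap t (.cons (.right A) g) = M.shareMap t g ▷ M.tyC A ≫ (α_ _ _ _).hom := by
  have cancel_unitors (X Y Z : C) : X ◁ Y ◁ (λ_ Z).inv ≫ X ◁ (α_ Y (𝟙_ C) Z).inv ≫
      X ◁ (ρ_ Y).hom ▷ Z = 𝟙 _ := by monoidal
  simp [shareMap, consIso, optShareMap, optC, MonoidalCategory.tensorHom_def, tensorμ,
    cancel_unitors]

theorem unionIso_eq {Γ Δ Θ : Ctx} (u : Union Γ Δ Θ) (g : Share c Γ Δ Θ) :
    (M.unionIso u).hom = M.shareMap t g := by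
  rw [Subsingleton.elim g (.ofUnion u)]
  clear g
  induction u with
  | nil => rfl
  | skip u ih => rw [Share.ofUnion, shareMap_none, ← ih]; rfl
  | inl A u ih => rw [Share.ofUnion, shareMap_left, ← ih]; simp [unionIso]
  | inr A u ih => rw [Share.ofUnion, shareMap_right, ← ih]; simp [unionIso]

theorem copy_eq {Φ : Ctx} (h : Φ.NonLinear) (g : Share c Φ Φ Φ) : M.copy Φ h = M.shareMap t g := by
  rw [Subsingleton.elim g (.diag h)]
  clear g
  change Transport.copy (M.ctxIsoF Φ h) = _
  induction Φ with
  | nil => rw [ctxIsoF_nil, Transport.copy_unit]; rfl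
  | cons o Φ ih =>
    cases o with
    | none => rw [Share.diag, shareMap_none, ← ih h]; rfl
    | some P =>
      rw [ctxIsoF_cons, Transport.copy_tensor, ih h.1]
      simp [Share.diag, shareMap, consIso, optShareMap]

theorem split_eq {Γ₁ Γ₂ Θ : Ctx} (s : Split Γ₁ Γ₂ Θ) (g : Share c Γ₁ Γ₂ Θ) :
    M.split s = M.shareMap t g := by
  let total : Share c Γ₁ s.Δ Θ := .ofUnion s.total
  let first : Share c s.Φ s.Γ Γ₁ := .ofUnion s.first
  let second : Share c s.Φ s.Δ Γ₂ := .ofUnion s.second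
  let outer := total.assocOuter first
  let inner := total.assocInner first
  have assoc : M.shareMap t total ≫ M.shareMap t first ▷ _ ≫ (α_ _ _ _).hom =
      M.shareMap t outer ≫ _ ◁ M.shareMap t inner := M.shareMap_assoc t _ _ _ _
  have interchange := M.shareMap_interchange t outer (.diag s.nonLinear) inner g first second
  rw [split, ← Category.assoc, ← Category.assoc, ← Category.assoc, ← Category.assoc]
  rw [← tensorIso_inv, Iso.comp_inv_eq]
  simp only [tensorIso_hom, M.unionIso_eq t s.total total, M.unionIso_eq t s.first first,
    M.unionIso_eq t s.second second, M.copy_eq t s.nonLinear (.diag s.nonLinear), ← interchange,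
    Category.assoc]
  rw [tensorHom_def', Category.assoc, ← reassoc_of% assoc, whiskerRight_tensor]
  simp only [Category.assoc, Iso.hom_inv_id_assoc]

/-- Projection to the only variable of a context. -/
def singleMap : {i : ℕ} → {A : Ty} → {S : Ctx} → Single i A S → (M.ctxC S ⟶ M.tyC A)
  | _, _, _, .zero A (Γ := Γ) h =>
      M.discMap t Γ (h.nonLinear.discardable c) ▷ M.tyC A ≫ (λ_ (M.tyC A)).hom
  | _, _, _, .succ s => (singleMap s :)

theorem insertIso_disc {Γ Θ S : Ctx} {i : ℕ} {A : Ty} (j : Insert Γ i A Θ)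
    (h : Ctx.Discardable c Γ) (s : Single i A S) (d : Drop c S Θ) :
    (M.insertIso j).hom ≫ M.discMap t Γ h ▷ M.tyC A ≫ (λ_ (M.tyC A)).hom =
      M.dropMap t d ≫ M.singleMap t s := by
  induction j generalizing S with
  | here Γ A =>
    cases s with | zero _ hE =>
    cases d with | cons e d =>
    cases e
    rw [discMap, singleMap, ← M.dropMap_disc t d (hE.nonLinear.discardable c) h]
    simp [insertIso, dropMap, consIso, optDropMap]
  | @there o Γ i A Θ j ih =>
    cases s with | succ s =>
    cases d with | cons e d =>
    cases e with
    | keep =>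
      rw [discMap, singleMap]
      have ih' := ih h s d
      simp [insertIso, dropMap, consIso, optDropMap, ih']
    | drop D hD =>
      rw [discMap, singleMap]
      have ih' := ih h.1 s d
      have braiding_disc : M.ctxC Γ ◁ (β_ (M.tyC A) (M.tyC D)).hom ≫
          M.ctxC Γ ◁ M.discTy t D hD ▷ M.tyC A ≫ M.ctxC Γ ◁ (λ_ (M.tyC A)).hom =
            M.ctxC Γ ◁ M.tyC A ◁ M.discTy t D hD ≫ M.ctxC Γ ◁ (ρ_ (M.tyC A)).hom := by
        simp only [← whiskerLeft_comp, ← BraidedCategory.braiding_naturality_right_assoc,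
          braiding_leftUnitor]
      have insert_disc : (M.insertIso j).hom ▷ M.tyC D ≫ (α_ _ _ _).hom ≫
          M.ctxC Γ ◁ M.tyC A ◁ M.discTy t D hD ≫ (α_ _ _ _).inv ≫ (ρ_ _).hom =
            M.ctxC Θ ◁ M.discTy t D hD ≫ (ρ_ _).hom ≫ (M.insertIso j).hom := by
        rw [← rightUnitor_naturality, whisker_exchange_assoc, tensor_whiskerLeft]
        simp only [Category.assoc]
      simp [insertIso, dropMap, consIso, optDropMap, tensorHom_def', ← ih',
        reassoc_of% braiding_disc, reassoc_of% insert_disc]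

/-! ### Morphisms in the image of `L` -/

theorem isImage_dropMap {Γ' Γ : Ctx} (d : Drop c Γ' Γ) :
    Transport.IsImage (M.ctxIsoC Γ) (M.ctxIsoC Γ') (M.dropMap t d) := by
  induction d with
  | nil => exact Transport.isImage_id _
  | cons e d ih =>
    cases e with
    | keep =>
      rename_i o _ _
      cases o with
      | none =>
        have dropMap_eq : M.dropMap t (Drop.cons (.keep none) d) = M.dropMap t d := by
          simp [dropMap, consIso, optDropMap]
        rw [dropMap_eq]; exact ih
      | some A =>
        have dropMap_eq : M.dropMap t (Drop.cons (.keep (some A)) d) = M.dropMap t d ▷ _ := by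
          simp [dropMap, consIso, optDropMap]
        rw [dropMap_eq]; exact ih.whiskerRight (M.tyIsoC A)
    | drop A hA =>
      have dropMap_eq : M.dropMap t (Drop.cons (.drop A hA) d) =
          (M.dropMap t d ⊗ₘ M.discTy t A hA) ≫ (ρ_ _).hom := by
        simp [dropMap, consIso, optDropMap]
      rw [dropMap_eq]
      exact (ih.tensor (M.isImage_discTy t A hA)).comp ⟨_, Transport.hom_rightUnitor _⟩

theorem isImage_discMap (Γ : Ctx) (h : Ctx.Discardable c Γ) :
    Transport.IsImage (M.ctxIsoC Γ) (Transport.unit M.L) (M.discMap t Γ h) := by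
  induction Γ with
  | nil => exact Transport.isImage_id _
  | cons o Γ ih =>
    cases o with
    | none => exact ih h
    | some A =>
      exact ((ih h.1).tensor (M.isImage_discTy t A h.2)).comp ⟨_, Transport.hom_leftUnitor _⟩

/-- The canonical isomorphism `L⟦o⟧_V ≅ ⟦o⟧` for an entry of a context, with the object `⟦o⟧_V`. -/
def optIsoC : (o : Option Ty) → Σ v : V, (M.L.obj v ≅ M.optC o)
  | none => ⟨𝟙_ V, Transport.unit M.L⟩
  | some A => ⟨M.tyV A, M.tyIsoC A⟩

theorem isImage_consIso_hom (o : Option Ty) (Γ : Ctx) : Transport.IsImage (M.ctxIsoC (o :: Γ))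
    (Transport.tensor (M.ctxIsoC Γ) (M.optIsoC o).2) (M.consIso o Γ).hom := by
  cases o with
  | none => exact ⟨_, Transport.hom_rightUnitor_inv _⟩
  | some A => exact Transport.isImage_id _

theorem isImage_consIso_inv (o : Option Ty) (Γ : Ctx) :
    Transport.IsImage (Transport.tensor (M.ctxIsoC Γ) (M.optIsoC o).2) (M.ctxIsoC (o :: Γ))
      (M.consIso o Γ).inv := by
  cases o with
  | none => exact ⟨_, Transport.hom_rightUnitor _⟩
  | some A => exact Transport.isImage_id _

theorem isImage_optShareMap {o₁ o₂ o : Option Ty} (l : OptShare c o₁ o₂ o) :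
    Transport.IsImage (M.optIsoC o).2 (Transport.tensor (M.optIsoC o₁).2 (M.optIsoC o₂).2)
      (M.optShareMap t l) := by
  cases l with
  | none => exact ⟨_, Transport.hom_leftUnitor_inv _⟩
  | drop A h => exact (M.isImage_discTy t A h).comp ⟨_, Transport.hom_leftUnitor_inv _⟩
  | left A => exact ⟨_, Transport.hom_rightUnitor_inv _⟩
  | right A => exact ⟨_, Transport.hom_leftUnitor_inv _⟩
  | both A h =>
    have copy := Transport.isImage_copy (x := M.tyIsoF A h)
    rw [tyIsoF] at copy
    erw [← Transport.comp_tensor] at copy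
    exact copy.of_comp

theorem isImage_shareMap {Γ₁ Γ₂ Θ : Ctx} (g : Share c Γ₁ Γ₂ Θ) :
    Transport.IsImage (M.ctxIsoC Θ) (Transport.tensor (M.ctxIsoC Γ₁) (M.ctxIsoC Γ₂))
      (M.shareMap t g) := by
  induction g with
  | nil => exact ⟨_, Transport.hom_leftUnitor_inv _⟩
  | @cons o₁ o₂ o Γ₁ Γ₂ Θ l g ih =>
    exact (M.isImage_consIso_hom o Θ).comp
      (((ih.tensor (M.isImage_optShareMap t l)).comp ⟨_, Transport.hom_tensorμ _ _ _ _⟩).comp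
        ((M.isImage_consIso_inv o₁ Γ₁).tensor (M.isImage_consIso_inv o₂ Γ₂)))

theorem isImage_singleMap {i : ℕ} {A : Ty} {S : Ctx} (s : Single i A S) :
    Transport.IsImage (M.ctxIsoC S) (M.tyIsoC A) (M.singleMap t s) := by
  induction s with
  | zero A h =>
    exact ((M.isImage_discMap t _ _).whiskerRight (M.tyIsoC A)).comp ⟨_, Transport.hom_leftUnitor _⟩
  | succ _ ih => exact ih

theorem discardAll_eq (t : M.Supports .affine) (Γ : Ctx) (h : Ctx.Discardable .affine Γ) :
    M.discardAll t Γ = M.discMap t Γ h := by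
  obtain ⟨g, hg⟩ := M.isImage_discMap t Γ h
  rw [hg, IsTerminal.hom_ext t g (IsTerminal.from t _)]
  rfl

theorem comp_discMap_affine (t : M.Supports .affine) {Γ Θ : Ctx} {f : M.ctxC Θ ⟶ M.ctxC Γ}
    (hf : Transport.IsImage (M.ctxIsoC Θ) (M.ctxIsoC Γ) f)
    (h : Ctx.Discardable .affine Γ) (h' : Ctx.Discardable .affine Θ) :
    f ≫ M.discMap t Γ h = M.discMap t Θ h' := by
  obtain ⟨g, hg⟩ := hf.comp (M.isImage_discMap t Γ h)
  obtain ⟨g', hg'⟩ := M.isImage_discMap t Θ h'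
  rw [hg, hg', IsTerminal.hom_ext t g g']

/-! ### Promotion and recursion -/

theorem comp_liftMap {Φ' Φ : Ctx} (h' : Φ'.NonLinear) (h : Φ.NonLinear) {s : M.ctxC Φ' ⟶ M.ctxC Φ}
    (hs : Transport.IsImage (M.ctxIsoF Φ' h') (M.ctxIsoF Φ h) s) {A : Ty} (f : M.ctxC Φ ⟶ M.tyC A) :
    s ≫ M.liftMap h f = M.liftMap h' (s ≫ f) := by
  obtain ⟨g, rfl⟩ := hs
  have unit_natural : M.F.map g ≫ M.F.map (M.adjFG.unit.app _) =
      M.F.map (M.adjFG.unit.app _) ≫ M.bang.map (M.F.map g) := map_unit_naturality M.adjFG g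
  simp only [liftMap, promote, Transport.hom, Category.assoc, Iso.hom_inv_id_assoc,
    ← M.bang.map_comp]
  rw [M.bang.map_comp (M.F.map g)]
  erw [reassoc_of% unit_natural]
  rfl

theorem liftMap_counit {Φ : Ctx} (h : Φ.NonLinear) {A : Ty} (f : M.ctxC Φ ⟶ M.tyC A) :
    M.liftMap h f ≫ M.adjFG.counit.app (M.tyC A) = f := by
  have counit_natural :
      M.bang.map ((M.ctxIsoF Φ h).hom ≫ f) ≫ M.adjFG.counit.app (M.tyC A) =
        M.adjFG.counit.app _ ≫ (M.ctxIsoF Φ h).hom ≫ f :=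
    M.adjFG.counit.naturality _
  have triangle : M.F.map (M.adjFG.unit.app (M.ctxB Φ h)) ≫ M.adjFG.counit.app _ = 𝟙 _ :=
    M.adjFG.left_triangle_components (M.ctxB Φ h)
  rw [liftMap, promote, Category.assoc, Category.assoc, Category.assoc, ← M.bang.map_comp_assoc,
    counit_natural]
  erw [reassoc_of% triangle]
  rw [Iso.inv_hom_id_assoc]

theorem gamma_sigma_natural {X' X : B} (g : X' ⟶ X) {D : C} (m : M.F.obj X ⊗ M.bang.obj D ⟶ D) :
    M.gamma X' ≫ M.sigma X' (M.F.map g ▷ M.bang.obj D ≫ m) =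
      M.F.map g ≫ M.gamma X ≫ M.sigma X m := by
  let θ : M.recFunctor X' ⟶ M.recFunctor X :=
    Functor.whiskerLeft M.bang ((tensoringLeft C).map (M.F.map g))
  have unfold_natural : ((M.unfoldCoalgebra X').str ≫ θ.app (M.F.obj X')) ≫
      (M.recFunctor X).map (M.F.map g) = M.F.map g ≫ (M.unfoldCoalgebra X).str := by
    refine (Category.assoc _ _ _).trans (Eq.trans ?_ (map_diag_unit_naturality M.adjFG g))
    rw [MonoidalCategory.tensorHom_def]
    rfl
  exact hylo_natural (M.omegaInitial X') (M.omegaFinal X') (M.omegaInitial X) (M.omegaFinal X) θ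
    (M.unfoldCoalgebra X') (M.unfoldCoalgebra X) (M.F.map g) unfold_natural ⟨D, m⟩

theorem comp_recMap {Φ' Φ : Ctx} (h' : Φ'.NonLinear) (h : Φ.NonLinear) {s : M.ctxC Φ' ⟶ M.ctxC Φ}
    (hs : Transport.IsImage (M.ctxIsoF Φ' h') (M.ctxIsoF Φ h) s) {A : Ty}
    (f : M.ctxC (some (.bang A) :: Φ) ⟶ M.tyC A) :
    s ≫ M.recMap h f = M.recMap h' (s ▷ M.bang.obj (M.tyC A) ≫ f) := by
  obtain ⟨g, rfl⟩ := hs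
  have body_eq : (M.ctxIsoF Φ' h').hom ▷ M.bang.obj (M.tyC A) ≫
      Transport.hom (M.ctxIsoF Φ' h') (M.ctxIsoF Φ h) g ▷ M.bang.obj (M.tyC A) ≫ f =
      M.F.map g ▷ M.bang.obj (M.tyC A) ≫ (M.ctxIsoF Φ h).hom ▷ M.bang.obj (M.tyC A) ≫ f := by
    simp only [← comp_whiskerRight_assoc, Transport.hom, Iso.hom_inv_id_assoc]
  rw [recMap, recMap]
  erw [body_eq, gamma_sigma_natural]
  simp only [Transport.hom, Category.assoc, Iso.hom_inv_id_assoc]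

theorem ctxIsoF_hom_liftMap {Φ : Ctx} (h : Φ.NonLinear) {A : Ty} (f : M.ctxC Φ ⟶ M.tyC A) :
    (M.ctxIsoF Φ h).hom ≫ M.liftMap h f = M.F.map (M.adjFG.unit.app (M.ctxB Φ h)) ≫
      M.bang.map ((M.ctxIsoF Φ h).hom ≫ f) := by
  simp only [liftMap, promote, Category.assoc, Iso.hom_inv_id_assoc, Functor.map_comp]

theorem recMap_unfold {Φ : Ctx} (h : Φ.NonLinear) {A : Ty}
    (f : M.ctxC (some (.bang A) :: Φ) ⟶ M.tyC A) :
    M.recMap h f = M.copy Φ h ≫ M.ctxC Φ ◁ M.liftMap h (M.recMap h f) ≫ f := by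
  let x := M.ctxIsoF Φ h
  let m := x.hom ▷ M.bang.obj (M.tyC A) ≫ f
  let r := M.gamma (M.ctxB Φ h) ≫ M.sigma (M.ctxB Φ h) m
  have r_unfold : r = (M.F.map (CartesianMonoidalCategory.lift (𝟙 (M.ctxB Φ h)) (𝟙 _)) ≫
      Functor.OplaxMonoidal.δ M.F (M.ctxB Φ h) (M.ctxB Φ h) ≫
        M.F.obj (M.ctxB Φ h) ◁ M.F.map (M.adjFG.unit.app _)) ≫
        M.F.obj (M.ctxB Φ h) ◁ M.bang.map r ≫ m :=
    hylo_unfold (M.omegaInitial _) (M.omegaFinal _) (M.unfoldCoalgebra _) ⟨M.tyC A, m⟩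
  have promote_r : M.F.map (M.adjFG.unit.app (M.ctxB Φ h)) ≫ M.bang.map r =
      x.hom ≫ M.liftMap h (M.recMap h f) := by
    rw [ctxIsoF_hom_liftMap]
    exact congrArg (_ ≫ M.bang.map ·) (x.hom_inv_id_assoc r).symm
  calc M.recMap h f = x.inv ≫ r := rfl
    _ = x.inv ≫ M.F.map (CartesianMonoidalCategory.lift (𝟙 _) (𝟙 _)) ≫
        Functor.OplaxMonoidal.δ M.F _ _ ≫
          M.F.obj (M.ctxB Φ h) ◁ (x.hom ≫ M.liftMap h (M.recMap h f)) ≫ m := by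
      rw [r_unfold, ← promote_r, whiskerLeft_comp]
      simp only [Category.assoc]
    _ = M.copy Φ h ≫ M.ctxC Φ ◁ M.liftMap h (M.recMap h f) ≫ f := by
      simp only [copy, m, Category.assoc, tensorHom_def', whisker_exchange_assoc, whiskerLeft_comp]
      rfl

/-! ### Functions -/

theorem comp_curry {Γ' Γ : Ctx} {s : M.ctxC Γ' ⟶ M.ctxC Γ}
    (hs : Transport.IsImage (M.ctxIsoC Γ') (M.ctxIsoC Γ) s) {A B : Ty}
    (f : M.ctxC (some A :: Γ) ⟶ M.tyC B) :
    s ≫ (M.ctxIsoC Γ).inv ≫ M.L.map (M.curry f) =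
      (M.ctxIsoC Γ').inv ≫ M.L.map (M.curry (Γ := Γ') (s ▷ M.tyC A ≫ f)) := by
  obtain ⟨g, hg⟩ := hs
  have whiskerRight_eq : s ▷ M.tyC A =
      Transport.hom (M.ctxIsoC (some A :: Γ')) (M.ctxIsoC (some A :: Γ)) (g ▷ M.tyV A) := by
    rw [hg]; exact Transport.hom_whiskerRight _ _ _ _
  have curry_natural : M.curry (Γ := Γ') (s ▷ M.tyC A ≫ f) = g ≫ M.curry f := by
    rw [curry, curry, ← Adjunction.homEquiv_naturality_left, whiskerRight_eq]
    simp [Transport.hom]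
  rw [curry_natural, hg]
  simp [Transport.hom]

theorem curry_eval {Γ : Ctx} {A B : Ty} (f : M.ctxC (some A :: Γ) ⟶ M.tyC B) {X : C}
    (g : X ⟶ M.tyC A) :
    (((M.ctxIsoC Γ).inv ≫ M.L.map (M.curry f)) ⊗ₘ g) ≫ M.eval A B = M.ctxC Γ ◁ g ≫ f := by
  have beta : M.L.map (M.curry f ▷ M.tyV A) ≫ (M.adjHom (M.tyV A)).counit.app (M.tyC B) =
      Functor.OplaxMonoidal.δ M.L (M.ctxV Γ) (M.tyV A) ≫
        ((M.ctxIsoC Γ).hom ⊗ₘ (M.tyIsoC A).hom) ≫ f := by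
    have uncurry_curry := (M.adjHom (M.tyV A)).homEquiv_counit (g := M.curry f)
    rw [curry, Equiv.symm_apply_apply] at uncurry_curry
    refine uncurry_curry.symm.trans ?_
    simp [ctxIsoC]
  have tensor_eq : (((M.ctxIsoC Γ).inv ≫ M.L.map (M.curry f)) ⊗ₘ g) ≫
      ((M.tyIsoC (.lolli A B)).inv ⊗ₘ (M.tyIsoC A).inv) =
      ((M.ctxIsoC Γ).inv ⊗ₘ (g ≫ (M.tyIsoC A).inv)) ≫ M.L.map (M.curry f) ▷ _ := by
    rw [tensorHom_comp_tensorHom, ← tensorHom_id, tensorHom_comp_tensorHom]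
    simp [tyIsoC]
  rw [eval, reassoc_of% tensor_eq, Functor.LaxMonoidal.μ_natural_left_assoc, beta,
    Functor.Monoidal.μ_δ_assoc, tensorHom_comp_tensorHom_assoc]
  simp

/-! ### Coproducts -/

theorem map_inl_tyIsoC (A B : Ty) :
    M.L.map (coprod.inl : M.tyV A ⟶ _) ≫ (M.tyIsoC (.sum A B)).hom =
      (M.tyIsoC A).hom ≫ coprod.inl := by
  have preserved := map_inl_iso_inv M.L (M.tyV A) (M.tyV B)
  simp [tyIsoC, reassoc_of% preserved]

theorem map_inr_tyIsoC (A B : Ty) :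
    M.L.map (coprod.inr : M.tyV B ⟶ _) ≫ (M.tyIsoC (.sum A B)).hom =
      (M.tyIsoC B).hom ≫ coprod.inr := by
  have preserved := map_inr_iso_inv M.L (M.tyV A) (M.tyV B)
  simp [tyIsoC, reassoc_of% preserved]

theorem map_inl_tyIsoV (A B : Ty) (h : (Ty.sum A B).NonLinear) :
    M.J.map (coprod.inl : M.tyB A h.1 ⟶ _) ≫ (M.tyIsoV (.sum A B) h).hom =
      (M.tyIsoV A h.1).hom ≫ coprod.inl := by
  have preserved := map_inl_iso_inv M.J (M.tyB A h.1) (M.tyB B h.2)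
  simp [tyIsoV, reassoc_of% preserved]

theorem map_inr_tyIsoV (A B : Ty) (h : (Ty.sum A B).NonLinear) :
    M.J.map (coprod.inr : M.tyB B h.2 ⟶ _) ≫ (M.tyIsoV (.sum A B) h).hom =
      (M.tyIsoV B h.2).hom ≫ coprod.inr := by
  have preserved := map_inr_iso_inv M.J (M.tyB A h.1) (M.tyB B h.2)
  simp [tyIsoV, reassoc_of% preserved]

/-- `L (⟦D⟧ ⊗ ⟦Γ⟧) ≅ ⟦Γ⟧ ⊗ ⟦D⟧`. -/
def distribIso (Γ : Ctx) (D : Ty) :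
    (tensorRight (M.ctxV Γ) ⋙ M.L).obj (M.tyV D) ≅ M.ctxC Γ ⊗ M.tyC D :=
  (Functor.Monoidal.μIso M.L (M.tyV D) (M.ctxV Γ)).symm ≪≫
    tensorIso (M.tyIsoC D) (M.ctxIsoC Γ) ≪≫ β_ (M.tyC D) (M.ctxC Γ)

theorem distribIso_natural (Γ : Ctx) {D D' : Ty} (f : M.tyV D ⟶ M.tyV D') (g : M.tyC D ⟶ M.tyC D')
    (h : M.L.map f ≫ (M.tyIsoC D').hom = (M.tyIsoC D).hom ≫ g) :
    M.ctxC Γ ◁ g ≫ (M.distribIso Γ D').inv =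
      (M.distribIso Γ D).inv ≫ (tensorRight (M.ctxV Γ) ⋙ M.L).map f := by
  rw [Iso.comp_inv_eq, Category.assoc, Iso.eq_inv_comp]
  have comparison_natural :
      M.L.map f ▷ M.L.obj (M.ctxV Γ) ≫ ((M.tyIsoC D').hom ⊗ₘ (M.ctxIsoC Γ).hom) =
        ((M.tyIsoC D).hom ⊗ₘ (M.ctxIsoC Γ).hom) ≫ g ▷ _ := by
    rw [whiskerRight_comp_tensorHom, h, tensorHom_comp_whiskerRight]
  simp only [distribIso, Iso.trans_hom, Iso.symm_hom, Functor.Monoidal.μIso_inv, tensorIso_hom,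
    Functor.comp_map, Category.assoc]
  change _ = M.L.map (f ▷ M.ctxV Γ) ≫ _
  rw [← Functor.OplaxMonoidal.δ_natural_left_assoc, reassoc_of% comparison_natural]
  simp

theorem inl_distrib (Γ : Ctx) (A B : Ty) :
    M.ctxC Γ ◁ (coprod.inl : M.tyC A ⟶ M.tyC A ⨿ M.tyC B) ≫ (M.distrib Γ A B).hom =
      coprod.inl := by
  have comparison := M.distribIso_natural Γ (D' := .sum A B) coprod.inl coprod.inl
    (M.map_inl_tyIsoC A B)
  have preserved := map_inl_iso_inv (tensorRight (M.ctxV Γ) ⋙ M.L) (M.tyV A) (M.tyV B)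
  change _ ≫ (M.distribIso Γ (.sum A B)).inv ≫ _ ≫
    coprod.map (M.distribIso Γ A).hom (M.distribIso Γ B).hom = _
  erw [reassoc_of% comparison, reassoc_of% preserved]
  simp

theorem inr_distrib (Γ : Ctx) (A B : Ty) :
    M.ctxC Γ ◁ (coprod.inr : M.tyC B ⟶ M.tyC A ⨿ M.tyC B) ≫ (M.distrib Γ A B).hom =
      coprod.inr := by
  have comparison := M.distribIso_natural Γ (D' := .sum A B) coprod.inr coprod.inr
    (M.map_inr_tyIsoC A B)
  have preserved := map_inr_iso_inv (tensorRight (M.ctxV Γ) ⋙ M.L) (M.tyV A) (M.tyV B)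
  change _ ≫ (M.distribIso Γ (.sum A B)).inv ≫ _ ≫
    coprod.map (M.distribIso Γ A).hom (M.distribIso Γ B).hom = _
  erw [reassoc_of% comparison, reassoc_of% preserved]
  simp

theorem comp_distrib {Γ' Γ : Ctx} (s : M.ctxC Γ' ⟶ M.ctxC Γ) (A B : Ty) {X : C}
    (f : M.ctxC Γ ⊗ M.tyC A ⟶ X) (g : M.ctxC Γ ⊗ M.tyC B ⟶ X) :
    s ▷ _ ≫ (M.distrib Γ A B).hom ≫ coprod.desc f g =
      (M.distrib Γ' A B).hom ≫ coprod.desc (s ▷ _ ≫ f) (s ▷ _ ≫ g) := by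
  have inl_inv : coprod.inl ≫ (M.distrib Γ' A B).inv = M.ctxC Γ' ◁ coprod.inl := by
    rw [Iso.comp_inv_eq, inl_distrib]
  have inr_inv : coprod.inr ≫ (M.distrib Γ' A B).inv = M.ctxC Γ' ◁ coprod.inr := by
    rw [Iso.comp_inv_eq, inr_distrib]
  rw [← cancel_epi (M.distrib Γ' A B).inv, Iso.inv_hom_id_assoc]
  apply coprod.hom_ext
  · rw [reassoc_of% inl_inv, whisker_exchange_assoc, reassoc_of% M.inl_distrib,
      coprod.inl_desc, coprod.inl_desc]
  · rw [reassoc_of% inr_inv, whisker_exchange_assoc, reassoc_of% M.inr_distrib,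
      coprod.inr_desc, coprod.inr_desc]

/-! ### Naturality on non-linear contexts -/

theorem isImage_discTy_of_nonLinear {A : Ty} (h : A.NonLinear) (h' : Ty.Discardable c A) :
    Transport.IsImage (M.tyIsoF A h) (Transport.unit M.F) (M.discTy t A h') := by
  rw [M.discTy_of_nonLinear t h]
  exact Transport.isImage_discard

theorem dropMap_keep_none {Γ' Γ : Ctx} (d : Drop c Γ' Γ) :
    M.dropMap t (Drop.cons (.keep none) d) = M.dropMap t d := by
  simp [dropMap, consIso, optDropMap]

theorem dropMap_keep_some (A : Ty) {Γ' Γ : Ctx} (d : Drop c Γ' Γ) :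
    M.dropMap t (Drop.cons (.keep (some A)) d) = M.dropMap t d ▷ M.tyC A := by
  simp [dropMap, consIso, optDropMap]

theorem dropMap_drop (A : Ty) (h : Ty.Discardable c A) {Γ' Γ : Ctx} (d : Drop c Γ' Γ) :
    M.dropMap t (Drop.cons (.drop A h) d) =
      (M.dropMap t d ⊗ₘ M.discTy t A h) ≫ (ρ_ (M.ctxC Γ')).hom := by
  simp [dropMap, consIso, optDropMap]

theorem isImage_dropMap_of_nonLinear {Γ' Γ : Ctx} (d : Drop c Γ' Γ) (h' : Γ'.NonLinear)
    (h : Γ.NonLinear) :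
    Transport.IsImage (M.ctxIsoF Γ h) (M.ctxIsoF Γ' h') (M.dropMap t d) := by
  induction d with
  | nil => exact Transport.isImage_id _
  | @cons o _ _ _ e d ih =>
    cases e with
    | keep =>
      cases o with
      | none =>
        rw [dropMap_keep_none]
        exact ih h' h
      | some A =>
        rw [dropMap_keep_some, ctxIsoF_cons, ctxIsoF_cons]
        exact (ih h'.1 h.1).whiskerRight (M.tyIsoF A h.2)
    | drop A hA =>
      rw [dropMap_drop, ctxIsoF_cons]
      exact ((ih h' h.1).tensor (M.isImage_discTy_of_nonLinear t h.2 hA)).comp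
        ⟨_, Transport.hom_rightUnitor _⟩

theorem isImage_discMap_of_nonLinear (Γ : Ctx) (h : Γ.NonLinear) (h' : Ctx.Discardable c Γ) :
    Transport.IsImage (M.ctxIsoF Γ h) (Transport.unit M.F) (M.discMap t Γ h') := by
  rw [← M.discard_eq t Γ h]
  exact Transport.isImage_discard

theorem isImage_shareMap_of_nonLinear {Γ₁ Γ₂ Θ : Ctx} (g : Share c Γ₁ Γ₂ Θ) (h₁ : Γ₁.NonLinear)
    (h₂ : Γ₂.NonLinear) (h : Θ.NonLinear) :
    Transport.IsImage (M.ctxIsoF Θ h)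
      (Transport.tensor (M.ctxIsoF Γ₁ h₁) (M.ctxIsoF Γ₂ h₂)) (M.shareMap t g) := by
  have d₁ : Drop c Γ₁ Θ := g.dropSnd (h₂.discardable c)
  have d₂ : Drop c Γ₂ Θ := g.swap.dropSnd (h₁.discardable c)
  rw [← M.shareMap_dropBoth t (.diag h) d₁ d₂ g, ← M.copy_eq t h]
  exact Transport.isImage_copy.comp ((M.isImage_dropMap_of_nonLinear t d₁ h₁ h).tensor
    (M.isImage_dropMap_of_nonLinear t d₂ h₂ h))

theorem isImage_singleMap_of_nonLinear {i : ℕ} {A : Ty} {S : Ctx} (s : Single i A S)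
    (h : S.NonLinear) (hA : A.NonLinear) :
    Transport.IsImage (M.ctxIsoF S h) (M.tyIsoF A hA) (M.singleMap t s) := by
  induction s with
  | zero A hE =>
    rw [ctxIsoF_cons]
    exact ((M.isImage_discMap_of_nonLinear t _ _ _).whiskerRight (M.tyIsoF A hA)).comp
      ⟨_, Transport.hom_leftUnitor _⟩
  | succ _ ih => exact ih h hA

theorem isImage_liftMap_of_nonLinear {Φ : Ctx} (h : Φ.NonLinear) {A : Ty} (f : M.ctxC Φ ⟶ M.tyC A)
    (hA : (Ty.bang A).NonLinear) :
    Transport.IsImage (M.ctxIsoF Φ h) (M.tyIsoF (.bang A) hA) (M.liftMap h f) := by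
  refine ⟨M.adjFG.unit.app _ ≫ M.G.map ((M.ctxIsoF Φ h).hom ≫ f), ?_⟩
  simp only [liftMap, promote, Transport.hom, Functor.map_comp, Category.assoc]
  congr 3
  simp [tyIsoF, Transport.comp, tyIsoC, tyIsoV]

theorem isImage_inl_of_nonLinear {A D : Ty} (h : (Ty.sum A D).NonLinear) :
    Transport.IsImage (M.tyIsoF A h.1) (M.tyIsoF (.sum A D) h)
      (coprod.inl : M.tyC A ⟶ M.tyC A ⨿ M.tyC D) := by
  refine ⟨coprod.inl, ?_⟩
  have preserved := congrArg M.L.map (M.map_inl_tyIsoV A D h)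
  rw [Transport.eq_hom_iff]
  simp only [Functor.map_comp] at preserved
  simp only [tyIsoF, Transport.comp, Iso.trans_hom, Functor.mapIso_hom, Category.assoc,
    Functor.comp_map, reassoc_of% preserved]
  rw [M.map_inl_tyIsoC]

theorem isImage_inr_of_nonLinear {A D : Ty} (h : (Ty.sum A D).NonLinear) :
    Transport.IsImage (M.tyIsoF D h.2) (M.tyIsoF (.sum A D) h)
      (coprod.inr : M.tyC D ⟶ M.tyC A ⨿ M.tyC D) := by
  refine ⟨coprod.inr, ?_⟩
  have preserved := congrArg M.L.map (M.map_inr_tyIsoV A D h)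
  rw [Transport.eq_hom_iff]
  simp only [Functor.map_comp] at preserved
  simp only [tyIsoF, Transport.comp, Iso.trans_hom, Functor.mapIso_hom, Category.assoc,
    Functor.comp_map, reassoc_of% preserved]
  rw [M.map_inr_tyIsoC]

theorem tyIsoF_tensor {A D : Ty} (h : (Ty.tensor A D).NonLinear) :
    M.tyIsoF (.tensor A D) h = Transport.tensor (M.tyIsoF A h.1) (M.tyIsoF D h.2) :=
  Transport.comp_tensor _ _ _ _

theorem tyIsoF_unit (h : Ty.unit.NonLinear) : M.tyIsoF .unit h = Transport.unit M.F :=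
  Transport.comp_unit

theorem isImage_inl (A D : Ty) : Transport.IsImage (M.tyIsoC A) (M.tyIsoC (.sum A D))
    (coprod.inl : M.tyC A ⟶ M.tyC A ⨿ M.tyC D) :=
  ⟨coprod.inl, by rw [Transport.eq_hom_iff, map_inl_tyIsoC]⟩

theorem isImage_inr (A D : Ty) : Transport.IsImage (M.tyIsoC D) (M.tyIsoC (.sum A D))
    (coprod.inr : M.tyC D ⟶ M.tyC A ⨿ M.tyC D) :=
  ⟨coprod.inr, by rw [Transport.eq_hom_iff, map_inr_tyIsoC]⟩

theorem isImage_curry {Γ : Ctx} {A D : Ty} (f : M.ctxC (some A :: Γ) ⟶ M.tyC D) :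
    Transport.IsImage (M.ctxIsoC Γ) (M.tyIsoC (.lolli A D))
      ((M.ctxIsoC Γ).inv ≫ M.L.map (M.curry f)) :=
  ⟨M.curry f, by simp [Transport.hom, tyIsoC]⟩

theorem isImage_liftMap {Φ : Ctx} (h : Φ.NonLinear) {A : Ty} (f : M.ctxC Φ ⟶ M.tyC A) :
    Transport.IsImage (M.ctxIsoC Φ) (M.tyIsoC (.bang A)) (M.liftMap h f) :=
  (M.isImage_liftMap_of_nonLinear h f trivial).of_comp

/-! ### The rules with two premises -/

/-- The interpretation of `m n` from those of its subterms, on separate contexts. -/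
def appMap {X Y : C} {A D : Ty} (f : X ⟶ M.tyC (.lolli A D)) (g : Y ⟶ M.tyC A) :
    X ⊗ Y ⟶ M.tyC D := (f ⊗ₘ g) ≫ M.eval A D

/-- The interpretation of `case m of {left x → n | right y → p}` from those of its subterms,
on separate contexts. -/
def caseMap {X : C} {Γ : Ctx} {A D E : Ty} (f : X ⟶ M.tyC (.sum A D))
    (g : M.ctxC (some A :: Γ) ⟶ M.tyC E) (g' : M.ctxC (some D :: Γ) ⟶ M.tyC E) :
    X ⊗ M.ctxC Γ ⟶ M.tyC E :=
  (β_ X (M.ctxC Γ)).hom ≫ M.ctxC Γ ◁ f ≫ (M.distrib Γ A D).hom ≫ coprod.desc g g'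

/-- The interpretation of `let ⟨x, y⟩ = m in n` from those of its subterms,
on separate contexts. -/
def letPairMap {X : C} {Γ : Ctx} {A D E : Ty} (f : X ⟶ M.tyC (.tensor A D))
    (g : M.ctxC (some D :: some A :: Γ) ⟶ M.tyC E) : X ⊗ M.ctxC Γ ⟶ M.tyC E :=
  f ▷ M.ctxC Γ ≫ (β_ (M.tyC A ⊗ M.tyC D) (M.ctxC Γ)).hom ≫
    (α_ (M.ctxC Γ) (M.tyC A) (M.tyC D)).inv ≫ g

theorem comp_appMap {X X' Y Y' : C} {A D : Ty} (s : X' ⟶ X) (s' : Y' ⟶ Y)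
    (f : X ⟶ M.tyC (.lolli A D)) (g : Y ⟶ M.tyC A) :
    (s ⊗ₘ s') ≫ M.appMap f g = M.appMap (s ≫ f) (s' ≫ g) := by
  simp only [appMap, tensorHom_comp_tensorHom_assoc]

theorem comp_caseMap {X X' : C} {Γ Γ' : Ctx} {A D E : Ty} (s : X' ⟶ X) (s' : M.ctxC Γ' ⟶ M.ctxC Γ)
    (f : X ⟶ M.tyC (.sum A D))
    (g : M.ctxC (some A :: Γ) ⟶ M.tyC E) (g' : M.ctxC (some D :: Γ) ⟶ M.tyC E) :
    (s ⊗ₘ s') ≫ M.caseMap f g g' =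
      M.caseMap (Γ := Γ') (s ≫ f) (s' ▷ M.tyC A ≫ g) (s' ▷ M.tyC D ≫ g') := by
  rw [caseMap, caseMap, BraidedCategory.braiding_naturality_assoc, tensorHom_def', Category.assoc,
    ← whisker_exchange_assoc, M.comp_distrib]
  simp only [whiskerLeft_comp, Category.assoc]

theorem comp_letPairMap {X X' : C} {Γ Γ' : Ctx} {A D E : Ty} (s : X' ⟶ X)
    (s' : M.ctxC Γ' ⟶ M.ctxC Γ) (f : X ⟶ M.tyC (.tensor A D))
    (g : M.ctxC (some D :: some A :: Γ) ⟶ M.tyC E) :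
    (s ⊗ₘ s') ≫ M.letPairMap f g =
      M.letPairMap (Γ := Γ') (s ≫ f) (s' ▷ M.tyC A ▷ M.tyC D ≫ g) := by
  rw [letPairMap, letPairMap, MonoidalCategory.tensorHom_def, Category.assoc,
    whisker_exchange_assoc, BraidedCategory.braiding_naturality_right_assoc, whiskerRight_tensor]
  simp only [comp_whiskerRight, Category.assoc, Iso.hom_inv_id_assoc]

theorem dropMap_drop_comp {Γ'' Γ' Γ : Ctx} (d' : Drop c Γ'' Γ') (d : Drop c Γ' Γ) {X : C}
    (f : M.ctxC Γ'' ⟶ X) :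
    M.dropMap t (d'.comp d) ≫ f = M.dropMap t d ≫ M.dropMap t d' ≫ f := by
  rw [← M.dropMap_comp t d' d, Category.assoc]

theorem shareMap_dropFirst_comp {Γ₁ Γ₂ Θ Θ' : Ctx} (d : Drop c Θ' Θ) (g : Share c Γ₁ Γ₂ Θ')
    {X : C} (f : M.ctxC Γ₁ ⊗ M.ctxC Γ₂ ⟶ X) :
    M.shareMap t (g.dropFirst d) ≫ f = M.dropMap t d ≫ M.shareMap t g ≫ f := by
  rw [← M.dropMap_share t d g, Category.assoc]

theorem unionIso_discardAll (t : M.Supports .affine) {Φ Γ Θ : Ctx} (u : Union Φ Γ Θ)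
    (d : Drop .affine Φ Θ) {X : C} (f : M.ctxC Φ ⟶ X) :
    (M.unionIso u).hom ≫ M.ctxC Φ ◁ M.discardAll t Γ ≫ (ρ_ (M.ctxC Φ)).hom ≫ f =
      M.dropMap t d ≫ f := by
  rw [M.discardAll_eq t Γ (Ctx.discardable_affine _), M.unionIso_eq t u (.ofUnion u),
    ← M.shareMap_discSnd t (.ofUnion u) (Ctx.discardable_affine _) d]
  simp only [Category.assoc]

/-! ### Derivations with implicit weakening -/

/-- `M.Denotes t Γ m A f`: the morphism `f` interprets a derivation of `Γ ⊢ m : A` in which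
variables may be discarded wherever a context is distributed over premises. Unlike the derivations
of the calculi, these can be weakened by any discardable variables, which closes them under
substitution. -/
inductive Denotes : (Γ : Ctx) → Tm → (A : Ty) → (M.ctxC Γ ⟶ M.tyC A) → Prop
  | var {S Θ : Ctx} {i : ℕ} {A : Ty} (s : Single i A S) (d : Drop c S Θ) :
      Denotes Θ (.var i) A (M.dropMap t d ≫ M.singleMap t s)
  | star {Θ : Ctx} (h : Ctx.Discardable c Θ) : Denotes Θ .star .unit (M.discMap t Θ h)
  | lift {Φ Θ : Ctx} {m : Tm} {A : Ty} {f : M.ctxC Φ ⟶ M.tyC A} (h : Φ.NonLinear)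
      (d : Drop c Φ Θ) (hm : Denotes Φ m A f) :
      Denotes Θ (.lift m) (.bang A) (M.dropMap t d ≫ M.liftMap h f)
  | recur {Φ Θ : Ctx} {m : Tm} {A : Ty} {f : M.ctxC (some (.bang A) :: Φ) ⟶ M.tyC A}
      (h : Φ.NonLinear) (d : Drop c Φ Θ) (hm : Denotes (some (.bang A) :: Φ) m A f) :
      Denotes Θ (.recur A m) A (M.dropMap t d ≫ M.recMap h f)
  | force {Γ : Ctx} {m : Tm} {A : Ty} {f : M.ctxC Γ ⟶ M.tyC (.bang A)}
      (hm : Denotes Γ m (.bang A) f) :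
      Denotes Γ (.force m) A (f ≫ M.adjFG.counit.app (M.tyC A))
  | left {Γ : Ctx} {m : Tm} {A D : Ty} {f : M.ctxC Γ ⟶ M.tyC A} (hm : Denotes Γ m A f) :
      Denotes Γ (.left A D m) (.sum A D) (f ≫ (coprod.inl : M.tyC A ⟶ M.tyC A ⨿ M.tyC D))
  | right {Γ : Ctx} {m : Tm} {A D : Ty} {f : M.ctxC Γ ⟶ M.tyC D} (hm : Denotes Γ m D f) :
      Denotes Γ (.right A D m) (.sum A D) (f ≫ (coprod.inr : M.tyC D ⟶ M.tyC A ⨿ M.tyC D))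
  | lam {Γ : Ctx} {m : Tm} {A D : Ty} {f : M.ctxC (some A :: Γ) ⟶ M.tyC D}
      (hm : Denotes (some A :: Γ) m D f) :
      Denotes Γ (.lam A m) (.lolli A D) ((M.ctxIsoC Γ).inv ≫ M.L.map (M.curry f))
  | seq {Γ₁ Γ₂ Θ : Ctx} {m n : Tm} {A : Ty} {f : M.ctxC Γ₁ ⟶ M.tyC .unit}
      {f' : M.ctxC Γ₂ ⟶ M.tyC A} (g : Share c Γ₁ Γ₂ Θ) (hm : Denotes Γ₁ m .unit f)
      (hn : Denotes Γ₂ n A f') : Denotes Θ (.seq m n) A (M.shareMap t g ≫ seqMap f f')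
  | case {Γ₁ Γ₂ Θ : Ctx} {m n p : Tm} {A D E : Ty} {f : M.ctxC Γ₁ ⟶ M.tyC (.sum A D)}
      {f' : M.ctxC (some A :: Γ₂) ⟶ M.tyC E} {f'' : M.ctxC (some D :: Γ₂) ⟶ M.tyC E}
      (g : Share c Γ₁ Γ₂ Θ) (hm : Denotes Γ₁ m (.sum A D) f) (hn : Denotes (some A :: Γ₂) n E f')
      (hp : Denotes (some D :: Γ₂) p E f'') :
      Denotes Θ (.case m n p) E (M.shareMap t g ≫ M.caseMap f f' f'')
  | pair {Γ₁ Γ₂ Θ : Ctx} {m n : Tm} {A D : Ty} {f : M.ctxC Γ₁ ⟶ M.tyC A}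
      {f' : M.ctxC Γ₂ ⟶ M.tyC D} (g : Share c Γ₁ Γ₂ Θ) (hm : Denotes Γ₁ m A f)
      (hn : Denotes Γ₂ n D f') : Denotes Θ (.pair m n) (.tensor A D) (M.shareMap t g ≫ (f ⊗ₘ f'))
  | letPair {Γ₁ Γ₂ Θ : Ctx} {m n : Tm} {A D E : Ty} {f : M.ctxC Γ₁ ⟶ M.tyC (.tensor A D)}
      {f' : M.ctxC (some D :: some A :: Γ₂) ⟶ M.tyC E}
      (g : Share c Γ₁ Γ₂ Θ) (hm : Denotes Γ₁ m (.tensor A D) f)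
      (hn : Denotes (some D :: some A :: Γ₂) n E f') :
      Denotes Θ (.letPair m n) E (M.shareMap t g ≫ M.letPairMap f f')
  | app {Γ₁ Γ₂ Θ : Ctx} {m n : Tm} {A D : Ty} {f : M.ctxC Γ₁ ⟶ M.tyC (.lolli A D)}
      {f' : M.ctxC Γ₂ ⟶ M.tyC A} (g : Share c Γ₁ Γ₂ Θ) (hm : Denotes Γ₁ m (.lolli A D) f)
      (hn : Denotes Γ₂ n A f') : Denotes Θ (.app m n) D (M.shareMap t g ≫ M.appMap f f')

variable {M t}

theorem Denotes.congr {Γ : Ctx} {m : Tm} {A : Ty} {f f' : M.ctxC Γ ⟶ M.tyC A}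
    (h : M.Denotes t Γ m A f) (e : f = f') : M.Denotes t Γ m A f' := e ▸ h

theorem Denotes.weaken {Γ Θ : Ctx} {m : Tm} {A : Ty} {f : M.ctxC Γ ⟶ M.tyC A}
    (h : M.Denotes t Γ m A f) (d : Drop c Γ Θ) : M.Denotes t Θ m A (M.dropMap t d ≫ f) := by
  induction h generalizing Θ with
  | var s d' => exact (Denotes.var s (d'.comp d)).congr (M.dropMap_drop_comp t ..)
  | star h => exact (Denotes.star (d.discardable h)).congr (M.dropMap_disc t d _ _).symm
  | lift h d' hm _ => exact (Denotes.lift h (d'.comp d) hm).congr (M.dropMap_drop_comp t ..)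
  | recur h d' hm _ => exact (Denotes.recur h (d'.comp d) hm).congr (M.dropMap_drop_comp t ..)
  | force _ ih => exact (Denotes.force (ih d)).congr (Category.assoc ..)
  | left _ ih => exact (Denotes.left (ih d)).congr (Category.assoc ..)
  | right _ ih => exact (Denotes.right (ih d)).congr (Category.assoc ..)
  | lam _ ih =>
    refine (Denotes.lam (ih (.cons (.keep _) d))).congr ?_
    rw [M.comp_curry (M.isImage_dropMap t d), dropMap_keep_some]
  | seq g hm hn _ _ =>
    exact (Denotes.seq (g.dropFirst d) hm hn).congr (M.shareMap_dropFirst_comp t ..)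
  | case g hm hn hp _ _ _ =>
    exact (Denotes.case (g.dropFirst d) hm hn hp).congr (M.shareMap_dropFirst_comp t ..)
  | pair g hm hn _ _ =>
    exact (Denotes.pair (g.dropFirst d) hm hn).congr (M.shareMap_dropFirst_comp t ..)
  | letPair g hm hn _ _ =>
    exact (Denotes.letPair (g.dropFirst d) hm hn).congr (M.shareMap_dropFirst_comp t ..)
  | app g hm hn _ _ =>
    exact (Denotes.app (g.dropFirst d) hm hn).congr (M.shareMap_dropFirst_comp t ..)

theorem denotes_var_insert {Γ Θ : Ctx} {i : ℕ} {A : Ty} (j : Insert Γ i A Θ)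
    (h : Ctx.Discardable c Γ) :
    M.Denotes t Θ (.var i) A
      ((M.insertIso j).hom ≫ M.discMap t Γ h ▷ M.tyC A ≫ (λ_ (M.tyC A)).hom) := by
  obtain ⟨S, ⟨s⟩, ⟨d⟩⟩ := j.exists_single h
  exact (Denotes.var s d).congr (M.insertIso_disc t j h s d).symm

theorem Denotes.of_split {Γ₁ Γ₂ Θ : Ctx} {m : Tm} {A : Ty} {f : M.ctxC Γ₁ ⊗ M.ctxC Γ₂ ⟶ M.tyC A}
    (s : Split Γ₁ Γ₂ Θ) (h : ∀ g : Share c Γ₁ Γ₂ Θ, M.Denotes t Θ m A (M.shareMap t g ≫ f)) :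
    M.Denotes t Θ m A (M.split s ≫ f) := by
  obtain ⟨g⟩ := s.nonempty_share (c := c)
  exact (h g).congr (by rw [M.split_eq t s g])

theorem denotes_interp {Γ : Ctx} {m : Tm} {A : Ty} (d : Der c Γ m A) :
    M.Denotes t Γ m A (M.interp t d) := by
  induction d with
  | varL h j =>
    refine (denotes_var_insert j (h.discardable .linear)).congr ?_
    rw [interp, M.discard_eq t]
  | starL h => exact (Denotes.star (h.discardable _)).congr (M.discard_eq t _ h).symm
  | liftL h _ ih =>
    refine (Denotes.lift h (.refl _) (ih (t := t))).congr ?_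
    rw [interp, dropMap_refl, Category.id_comp]
  | varA j =>
    refine (denotes_var_insert j (Ctx.discardable_affine _)).congr ?_
    rw [interp, M.discardAll_eq t]
  | starA =>
    exact (Denotes.star (Ctx.discardable_affine _)).congr (M.discardAll_eq t _ _).symm
  | liftA h u _ ih =>
    let d := (Share.ofUnion u).dropSnd (Ctx.discardable_affine _)
    exact (Denotes.lift h d (ih (t := t))).congr (M.unionIso_discardAll t u d _).symm
  | recurA h u _ ih =>
    let d := (Share.ofUnion u).dropSnd (Ctx.discardable_affine _)
    exact (Denotes.recur h d (ih (t := t))).congr (M.unionIso_discardAll t u d _).symm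
  | seq s _ _ ihm ihn => exact .of_split s fun g => .seq g (ihm (t := t)) (ihn (t := t))
  | force _ ih => exact .force (ih (t := t))
  | left _ ih => exact .left (ih (t := t))
  | right _ ih => exact .right (ih (t := t))
  | case s _ _ _ ihm ihn ihp =>
    exact .of_split s fun g => .case g (ihm (t := t)) (ihn (t := t)) (ihp (t := t))
  | pair s _ _ ihm ihn => exact .of_split s fun g => .pair g (ihm (t := t)) (ihn (t := t))
  | letPair s _ _ ihm ihn => exact .of_split s fun g => .letPair g (ihm (t := t)) (ihn (t := t))
  | lam _ ih => exact .lam (ih (t := t))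
  | app s _ _ ihm ihn => exact .of_split s fun g => .app g (ihm (t := t)) (ihn (t := t))
  | recur h _ ih =>
    refine (Denotes.recur h (.refl _) (ih (t := t))).congr ?_
    rw [interp, dropMap_refl, Category.id_comp]

theorem Denotes.nonempty_der {Γ Θ : Ctx} {m : Tm} {A : Ty} {f : M.ctxC Γ ⟶ M.tyC A}
    (h : M.Denotes t Γ m A f) (d : Drop c Γ Θ) : Nonempty (Der c Θ m A) := by
  induction h generalizing Θ with
  | var s d' => exact Der.nonempty_var s (d'.comp d)
  | star h => exact Der.nonempty_star (d.discardable h)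
  | lift h d' _ ih => exact Der.nonempty_lift h (d'.comp d) ih
  | recur h d' _ ih => exact Der.nonempty_recur h (d'.comp d) fun d'' => ih (.cons (.keep _) d'')
  | force _ ih => exact (ih d).map .force
  | left _ ih => exact (ih d).map .left
  | right _ ih => exact (ih d).map .right
  | lam _ ih => exact (ih (.cons (.keep _) d)).map .lam
  | seq g _ _ ihm ihn =>
    obtain ⟨Θ₁, ⟨s⟩, ⟨d₁⟩⟩ := (g.dropFirst d).exists_split
    exact (ihm d₁).map2 (.seq s) (ihn (.refl _))
  | case g _ _ _ ihm ihn ihp =>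
    obtain ⟨Θ₁, ⟨s⟩, ⟨d₁⟩⟩ := (g.dropFirst d).exists_split
    obtain ⟨e⟩ := ihm d₁
    exact (ihn (.refl _)).map2 (.case s e) (ihp (.refl _))
  | pair g _ _ ihm ihn =>
    obtain ⟨Θ₁, ⟨s⟩, ⟨d₁⟩⟩ := (g.dropFirst d).exists_split
    exact (ihm d₁).map2 (.pair s) (ihn (.refl _))
  | letPair g _ _ ihm ihn =>
    obtain ⟨Θ₁, ⟨s⟩, ⟨d₁⟩⟩ := (g.dropFirst d).exists_split
    exact (ihm d₁).map2 (.letPair s) (ihn (.refl _))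
  | app g _ _ ihm ihn =>
    obtain ⟨Θ₁, ⟨s⟩, ⟨d₁⟩⟩ := (g.dropFirst d).exists_split
    exact (ihm d₁).map2 (.app s) (ihn (.refl _))

/-! ### Uniqueness of denotations -/

variable (M t)

/-- `M.Agree t Γ A f Γ' A' f'`: the types `A` and `A'` coincide, and `f` and `f'` discard `Γ` and
`Γ'` down to a common subcontext and continue with the same morphism. Derivations of the same term
are compared in this sense, as they may discard a variable at different places. -/
inductive Agree (Γ : Ctx) : (A : Ty) → (M.ctxC Γ ⟶ M.tyC A) → (Γ' : Ctx) → (A' : Ty) →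
    (M.ctxC Γ' ⟶ M.tyC A') → Prop
  | mk {Δ Γ' : Ctx} {A : Ty} (δ : Drop c Δ Γ) (δ' : Drop c Δ Γ') (f : M.ctxC Δ ⟶ M.tyC A) :
      Agree Γ A (M.dropMap t δ ≫ f) Γ' A (M.dropMap t δ' ≫ f)

/-- `Agree` for morphisms with one bound variable, which is not discarded. -/
inductive AgreeUnder (Γ : Ctx) : (A D : Ty) → (M.ctxC (some A :: Γ) ⟶ M.tyC D) → (Γ' : Ctx) →
    (D' : Ty) → (M.ctxC (some A :: Γ') ⟶ M.tyC D') → Prop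
  | mk {Δ Γ' : Ctx} {A D : Ty} (δ : Drop c Δ Γ) (δ' : Drop c Δ Γ')
      (f : M.ctxC (some A :: Δ) ⟶ M.tyC D) :
      AgreeUnder Γ A D (M.dropMap t δ ▷ M.tyC A ≫ f) Γ' D (M.dropMap t δ' ▷ M.tyC A ≫ f)

/-- `Agree` for morphisms with two bound variables, which are not discarded. -/
inductive AgreeUnderTwo (Γ : Ctx) : (A E D : Ty) → (M.ctxC (some E :: some A :: Γ) ⟶ M.tyC D) →
    (Γ' : Ctx) → (D' : Ty) → (M.ctxC (some E :: some A :: Γ') ⟶ M.tyC D') → Prop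
  | mk {Δ Γ' : Ctx} {A E D : Ty} (δ : Drop c Δ Γ) (δ' : Drop c Δ Γ')
      (f : M.ctxC (some E :: some A :: Δ) ⟶ M.tyC D) :
      AgreeUnderTwo Γ A E D (M.dropMap t δ ▷ M.tyC A ▷ M.tyC E ≫ f) Γ' D
        (M.dropMap t δ' ▷ M.tyC A ▷ M.tyC E ≫ f)

variable {M t}

theorem Agree.eq {Γ : Ctx} {A : Ty} {f f' : M.ctxC Γ ⟶ M.tyC A} (h : M.Agree t Γ A f Γ A f') :
    f = f' := by
  obtain ⟨δ, δ', k⟩ := h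
  rw [Subsingleton.elim δ δ']

theorem Agree.ty_eq {Γ Γ' : Ctx} {A A' : Ty} {f : M.ctxC Γ ⟶ M.tyC A} {f' : M.ctxC Γ' ⟶ M.tyC A'}
    (h : M.Agree t Γ A f Γ' A' f') : A = A' := by
  cases h; rfl

theorem Agree.under {Γ Γ' : Ctx} {A D D' : Ty} {f : M.ctxC (some A :: Γ) ⟶ M.tyC D}
    {f' : M.ctxC (some A :: Γ') ⟶ M.tyC D'}
    (h : M.Agree t (some A :: Γ) D f (some A :: Γ') D' f') : M.AgreeUnder t Γ A D f Γ' D' f' := by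
  cases h with | mk δ δ' k =>
  cases δ with | @cons o _ Δ _ e δ =>
  cases δ' with | cons e' δ' =>
  rw [← M.dropMap_comp t (.cons e (.refl _)) (.cons (.keep _) δ),
    ← M.dropMap_comp t (.cons e (.refl _)) (.cons (.keep _) δ'), dropMap_keep_some,
    dropMap_keep_some, Category.assoc, Category.assoc]
  exact .mk δ δ' _

theorem Agree.underTwo {Γ Γ' : Ctx} {A E D D' : Ty}
    {f : M.ctxC (some E :: some A :: Γ) ⟶ M.tyC D} {f' : M.ctxC (some E :: some A :: Γ') ⟶ M.tyC D'}
    (h : M.Agree t (some E :: some A :: Γ) D f (some E :: some A :: Γ') D' f') :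
    M.AgreeUnderTwo t Γ A E D f Γ' D' f' := by
  cases h with | mk δ δ' k =>
  cases δ with | cons e₁ δ =>
  cases δ with | cons e₂ δ =>
  cases δ' with | cons e₁' δ' =>
  cases δ' with | cons e₂' δ' =>
  rw [← M.dropMap_comp t (.cons e₁ (.cons e₂ (.refl _))) (.cons (.keep _) (.cons (.keep _) δ)),
    ← M.dropMap_comp t (.cons e₁ (.cons e₂ (.refl _))) (.cons (.keep _) (.cons (.keep _) δ')),
    dropMap_keep_some, dropMap_keep_some, dropMap_keep_some, dropMap_keep_some, Category.assoc,
    Category.assoc]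
  exact .mk δ δ' _

theorem Agree.lift {Φ Φ' Θ Θ' : Ctx} {A A' : Ty} {f : M.ctxC Φ ⟶ M.tyC A}
    {f' : M.ctxC Φ' ⟶ M.tyC A'} (r : M.Agree t Φ A f Φ' A' f') (h : Φ.NonLinear)
    (h' : Φ'.NonLinear) (d : Drop c Φ Θ) (d' : Drop c Φ' Θ') :
    M.Agree t Θ (.bang A) (M.dropMap t d ≫ M.liftMap h f)
      Θ' (.bang A') (M.dropMap t d' ≫ M.liftMap h' f') := by
  cases r with | mk δ δ' k =>
  have hΔ := δ.nonLinear h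
  rw [← M.comp_liftMap h hΔ (M.isImage_dropMap_of_nonLinear t δ _ _),
    ← M.comp_liftMap h' hΔ (M.isImage_dropMap_of_nonLinear t δ' _ _),
    reassoc_of% M.dropMap_comp t δ d (δ.comp d), reassoc_of% M.dropMap_comp t δ' d' (δ'.comp d')]
  exact .mk _ _ _

theorem AgreeUnder.recur {Φ Φ' Θ Θ' : Ctx} {A : Ty} {f : M.ctxC (some (.bang A) :: Φ) ⟶ M.tyC A}
    {f' : M.ctxC (some (.bang A) :: Φ') ⟶ M.tyC A}
    (r : M.AgreeUnder t Φ (.bang A) A f Φ' A f') (h : Φ.NonLinear) (h' : Φ'.NonLinear)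
    (d : Drop c Φ Θ) (d' : Drop c Φ' Θ') :
    M.Agree t Θ A (M.dropMap t d ≫ M.recMap h f) Θ' A (M.dropMap t d' ≫ M.recMap h' f') := by
  cases r with | mk δ δ' k =>
  have hΔ := δ.nonLinear h
  rw [← M.comp_recMap h hΔ (M.isImage_dropMap_of_nonLinear t δ _ _),
    ← M.comp_recMap h' hΔ (M.isImage_dropMap_of_nonLinear t δ' _ _),
    reassoc_of% M.dropMap_comp t δ d (δ.comp d), reassoc_of% M.dropMap_comp t δ' d' (δ'.comp d')]
  exact .mk _ _ _

theorem Agree.force {Γ Γ' : Ctx} {A A' : Ty} {f : M.ctxC Γ ⟶ M.tyC (.bang A)}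
    {f' : M.ctxC Γ' ⟶ M.tyC (.bang A')} (r : M.Agree t Γ (.bang A) f Γ' (.bang A') f') :
    M.Agree t Γ A (f ≫ M.adjFG.counit.app (M.tyC A))
      Γ' A' (f' ≫ M.adjFG.counit.app (M.tyC A')) := by
  cases r with | mk δ δ' k =>
  rw [Category.assoc, Category.assoc]
  exact .mk _ _ _

theorem Agree.left {Γ Γ' : Ctx} {A A' : Ty} {f : M.ctxC Γ ⟶ M.tyC A} {f' : M.ctxC Γ' ⟶ M.tyC A'}
    (r : M.Agree t Γ A f Γ' A' f') (D : Ty) :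
    M.Agree t Γ (.sum A D) (f ≫ (coprod.inl : M.tyC A ⟶ M.tyC A ⨿ M.tyC D))
      Γ' (.sum A' D) (f' ≫ (coprod.inl : M.tyC A' ⟶ M.tyC A' ⨿ M.tyC D)) := by
  cases r with | mk δ δ' k =>
  rw [Category.assoc, Category.assoc]
  exact .mk (A := .sum _ _) _ _ _

theorem Agree.right {Γ Γ' : Ctx} {D D' : Ty} {f : M.ctxC Γ ⟶ M.tyC D} {f' : M.ctxC Γ' ⟶ M.tyC D'}
    (r : M.Agree t Γ D f Γ' D' f') (A : Ty) :
    M.Agree t Γ (.sum A D) (f ≫ (coprod.inr : M.tyC D ⟶ M.tyC A ⨿ M.tyC D))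
      Γ' (.sum A D') (f' ≫ (coprod.inr : M.tyC D' ⟶ M.tyC A ⨿ M.tyC D')) := by
  cases r with | mk δ δ' k =>
  rw [Category.assoc, Category.assoc]
  exact .mk (A := .sum _ _) _ _ _

theorem AgreeUnder.lam {Γ Γ' : Ctx} {A D D' : Ty} {f : M.ctxC (some A :: Γ) ⟶ M.tyC D}
    {f' : M.ctxC (some A :: Γ') ⟶ M.tyC D'} (r : M.AgreeUnder t Γ A D f Γ' D' f') :
    M.Agree t Γ (.lolli A D) ((M.ctxIsoC Γ).inv ≫ M.L.map (M.curry f))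
      Γ' (.lolli A D') ((M.ctxIsoC Γ').inv ≫ M.L.map (M.curry f')) := by
  cases r with | mk δ δ' k =>
  rw [← M.comp_curry (M.isImage_dropMap t δ), ← M.comp_curry (M.isImage_dropMap t δ')]
  exact .mk (A := .lolli _ _) _ _ _

theorem Agree.share {Γ₁ Γ₂ Θ Γ₁' Γ₂' Θ' Δ₁ Δ₂ : Ctx} {A : Ty} (g : Share c Γ₁ Γ₂ Θ)
    (g' : Share c Γ₁' Γ₂' Θ') (δ₁ : Drop c Δ₁ Γ₁) (δ₂ : Drop c Δ₂ Γ₂) (δ₁' : Drop c Δ₁ Γ₁')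
    (δ₂' : Drop c Δ₂ Γ₂') (k : M.ctxC Δ₁ ⊗ M.ctxC Δ₂ ⟶ M.tyC A) :
    M.Agree t Θ A (M.shareMap t g ≫ (M.dropMap t δ₁ ⊗ₘ M.dropMap t δ₂) ≫ k)
      Θ' A (M.shareMap t g' ≫ (M.dropMap t δ₁' ⊗ₘ M.dropMap t δ₂') ≫ k) := by
  have e := g.dropBoth δ₁ δ₂
  have e' := g'.dropBoth δ₁' δ₂'
  rw [reassoc_of% M.shareMap_dropBoth t g δ₁ δ₂ e, reassoc_of% M.shareMap_dropBoth t g' δ₁' δ₂' e',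
    ← M.dropMap_share t e.dropJoin e.join, ← M.dropMap_share t e'.dropJoin e.join, Category.assoc,
    Category.assoc]
  exact .mk _ _ _

section TwoPremises

variable {Γ₁ Γ₂ Θ Γ₁' Γ₂' Θ' : Ctx} (g : Share c Γ₁ Γ₂ Θ) (g' : Share c Γ₁' Γ₂' Θ')
include g g'

theorem Agree.seq {A A' : Ty} {f : M.ctxC Γ₁ ⟶ M.tyC .unit} {f' : M.ctxC Γ₁' ⟶ M.tyC .unit}
    {k : M.ctxC Γ₂ ⟶ M.tyC A} {k' : M.ctxC Γ₂' ⟶ M.tyC A'}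
    (r₁ : M.Agree t Γ₁ .unit f Γ₁' .unit f') (r₂ : M.Agree t Γ₂ A k Γ₂' A' k') :
    M.Agree t Θ A (M.shareMap t g ≫ seqMap f k) Θ' A' (M.shareMap t g' ≫ seqMap f' k') := by
  cases r₁; cases r₂
  rw [← comp_seqMap, ← comp_seqMap]
  exact .share g g' _ _ _ _ _

theorem Agree.pair {A A' D D' : Ty} {f : M.ctxC Γ₁ ⟶ M.tyC A} {f' : M.ctxC Γ₁' ⟶ M.tyC A'}
    {k : M.ctxC Γ₂ ⟶ M.tyC D} {k' : M.ctxC Γ₂' ⟶ M.tyC D'}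
    (r₁ : M.Agree t Γ₁ A f Γ₁' A' f') (r₂ : M.Agree t Γ₂ D k Γ₂' D' k') :
    M.Agree t Θ (.tensor A D) (M.shareMap t g ≫ (f ⊗ₘ k))
      Θ' (.tensor A' D') (M.shareMap t g' ≫ (f' ⊗ₘ k')) := by
  cases r₁; cases r₂
  rw [← tensorHom_comp_tensorHom, ← tensorHom_comp_tensorHom]
  exact .share (A := .tensor _ _) g g' _ _ _ _ _

theorem Agree.app {A A' D D' : Ty} {f : M.ctxC Γ₁ ⟶ M.tyC (.lolli A D)}
    {f' : M.ctxC Γ₁' ⟶ M.tyC (.lolli A' D')} {k : M.ctxC Γ₂ ⟶ M.tyC A} {k' : M.ctxC Γ₂' ⟶ M.tyC A'}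
    (r₁ : M.Agree t Γ₁ (.lolli A D) f Γ₁' (.lolli A' D') f') (r₂ : M.Agree t Γ₂ A k Γ₂' A' k') :
    M.Agree t Θ D (M.shareMap t g ≫ M.appMap f k) Θ' D' (M.shareMap t g' ≫ M.appMap f' k') := by
  cases r₁; cases r₂
  rw [← comp_appMap, ← comp_appMap]
  exact .share g g' _ _ _ _ _

theorem Agree.caseOf {A D E E' : Ty} {f : M.ctxC Γ₁ ⟶ M.tyC (.sum A D)}
    {f' : M.ctxC Γ₁' ⟶ M.tyC (.sum A D)} {k₁ : M.ctxC (some A :: Γ₂) ⟶ M.tyC E}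
    {k₁' : M.ctxC (some A :: Γ₂') ⟶ M.tyC E'} {k₂ : M.ctxC (some D :: Γ₂) ⟶ M.tyC E}
    {k₂' : M.ctxC (some D :: Γ₂') ⟶ M.tyC E'} (r : M.Agree t Γ₁ (.sum A D) f Γ₁' (.sum A D) f')
    (r₁ : M.AgreeUnder t Γ₂ A E k₁ Γ₂' E' k₁') (r₂ : M.AgreeUnder t Γ₂ D E k₂ Γ₂' E' k₂') :
    M.Agree t Θ E (M.shareMap t g ≫ M.caseMap f k₁ k₂)
      Θ' E' (M.shareMap t g' ≫ M.caseMap f' k₁' k₂') := by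
  cases r
  cases r₁ with | mk δ₁ δ₁' k₁ =>
  cases r₂ with | mk δ₂ δ₂' k₂ =>
  obtain ⟨⟨a₁⟩, ⟨a₂⟩, ⟨a⟩⟩ := δ₁.exists_join δ₂
  obtain ⟨-, -, ⟨a'⟩⟩ := δ₁'.exists_join δ₂'
  rw [← M.dropMap_comp t a₁ a, ← M.dropMap_comp t a₂ a, ← M.dropMap_comp t a₁ a',
    ← M.dropMap_comp t a₂ a']
  simp only [comp_whiskerRight, Category.assoc]
  rw [← comp_caseMap, ← comp_caseMap]
  exact .share g g' _ _ _ _ _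

theorem Agree.letPair {A D E E' : Ty} {f : M.ctxC Γ₁ ⟶ M.tyC (.tensor A D)}
    {f' : M.ctxC Γ₁' ⟶ M.tyC (.tensor A D)} {k : M.ctxC (some D :: some A :: Γ₂) ⟶ M.tyC E}
    {k' : M.ctxC (some D :: some A :: Γ₂') ⟶ M.tyC E'}
    (r₁ : M.Agree t Γ₁ (.tensor A D) f Γ₁' (.tensor A D) f')
    (r : M.AgreeUnderTwo t Γ₂ A D E k Γ₂' E' k') :
    M.Agree t Θ E (M.shareMap t g ≫ M.letPairMap f k)
      Θ' E' (M.shareMap t g' ≫ M.letPairMap f' k') := by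
  cases r₁; cases r
  rw [← comp_letPairMap, ← comp_letPairMap]
  exact .share g g' _ _ _ _ _

end TwoPremises

theorem Denotes.agree {Γ Γ' : Ctx} {m : Tm} {A A' : Ty} {f : M.ctxC Γ ⟶ M.tyC A}
    {f' : M.ctxC Γ' ⟶ M.tyC A'} (h : M.Denotes t Γ m A f) (h' : M.Denotes t Γ' m A' f')
    (r : Compat Γ Γ') : M.Agree t Γ A f Γ' A' f' := by
  induction h generalizing Γ' A' f' with
  | var s d =>
    cases h' with | var s' d' =>
    obtain ⟨rfl, rfl⟩ := Compat.single_eq (Compat.drop r d d') s s'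
    rw [Subsingleton.elim s s']
    exact .mk _ _ _
  | star h =>
    cases h' with | star h' =>
    obtain ⟨Δ, hΔ, ⟨d⟩, ⟨d'⟩⟩ := Compat.exists_empty r h h'
    have discardable := hΔ.nonLinear.discardable c
    rw [← M.dropMap_disc t d discardable, ← M.dropMap_disc t d' discardable]
    exact .mk _ _ _
  | lift h d _ ih =>
    cases h' with | lift h' d' hm' => exact (ih hm' (Compat.drop r d d')).lift h h' d d'
  | recur h d _ ih =>
    cases h' with | recur h' d' hm' =>
    exact (ih hm' (Compat.cons_some _ (Compat.drop r d d'))).under.recur h h' d d'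
  | force _ ih => cases h' with | force hm' => exact (ih hm' r).force
  | left _ ih => cases h' with | left hm' => exact (ih hm' r).left _
  | right _ ih => cases h' with | right hm' => exact (ih hm' r).right _
  | lam _ ih => cases h' with | lam hm' => exact (ih hm' (Compat.cons_some _ r)).under.lam
  | seq g _ _ ihm ihn =>
    cases h' with | seq g' hm' hn' =>
    exact .seq g g' (ihm hm' (Compat.share_fst r g g')) (ihn hn' (Compat.share_snd r g g'))
  | case g _ _ _ ihm ihn ihp =>
    cases h' with | case g' hm' hn' hp' =>
    have r₁ := ihm hm' (Compat.share_fst r g g')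
    obtain ⟨rfl, rfl⟩ := Ty.sum.inj r₁.ty_eq
    have under A := Compat.cons_some A (Compat.share_snd r g g')
    exact .caseOf g g' r₁ (ihn hn' (under _)).under (ihp hp' (under _)).under
  | pair g _ _ ihm ihn =>
    cases h' with | pair g' hm' hn' =>
    exact .pair g g' (ihm hm' (Compat.share_fst r g g')) (ihn hn' (Compat.share_snd r g g'))
  | letPair g _ _ ihm ihn =>
    cases h' with | letPair g' hm' hn' =>
    have r₁ := ihm hm' (Compat.share_fst r g g')
    obtain ⟨rfl, rfl⟩ := Ty.tensor.inj r₁.ty_eq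
    have under A D := Compat.cons_some D (Compat.cons_some A (Compat.share_snd r g g'))
    exact .letPair g g' r₁ (ihn hn' (under _ _)).underTwo
  | app g _ _ ihm ihn =>
    cases h' with | app g' hm' hn' =>
    exact .app g g' (ihm hm' (Compat.share_fst r g g')) (ihn hn' (Compat.share_snd r g g'))

theorem Denotes.unique {Γ : Ctx} {m : Tm} {A : Ty} {f f' : M.ctxC Γ ⟶ M.tyC A}
    (h : M.Denotes t Γ m A f) (h' : M.Denotes t Γ m A f') : f = f' :=
  (h.agree h' (.refl Γ)).eq

/-! ### Substitution -/

variable (M t)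

theorem shareMap_tensor_disc {Γ₁ Γ₂ Θ : Ctx} (g : Share c Γ₁ Γ₂ Θ) (h : Ctx.Discardable c Γ₂)
    (d : Drop c Γ₁ Θ) {X : C} (s : M.ctxC Γ₁ ⟶ X) :
    M.shareMap t g ≫ (s ⊗ₘ M.discMap t Γ₂ h) ≫ (ρ_ X).hom = M.dropMap t d ≫ s := by
  rw [← M.shareMap_discSnd t g h d, tensorHom_def', Category.assoc, Category.assoc, Category.assoc,
    rightUnitor_naturality]

theorem shareMap_disc_tensor {Γ₁ Γ₂ Θ : Ctx} (g : Share c Γ₁ Γ₂ Θ) (h : Ctx.Discardable c Γ₁)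
    (d : Drop c Γ₂ Θ) {X : C} (s : M.ctxC Γ₂ ⟶ X) :
    M.shareMap t g ≫ (M.discMap t Γ₁ h ⊗ₘ s) ≫ (λ_ X).hom = M.dropMap t d ≫ s := by
  rw [← M.shareMap_discFst t g h d, MonoidalCategory.tensorHom_def, Category.assoc, Category.assoc,
    Category.assoc, leftUnitor_naturality]

theorem shareMap_disc {Γ₁ Γ₂ Θ : Ctx} (g : Share c Γ₁ Γ₂ Θ) (h₁ : Ctx.Discardable c Γ₁)
    (h₂ : Ctx.Discardable c Γ₂) (h : Ctx.Discardable c Θ) :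
    M.shareMap t g ≫ (M.discMap t Γ₁ h₁ ⊗ₘ M.discMap t Γ₂ h₂) =
      M.discMap t Θ h ≫ (λ_ (𝟙_ C)).inv := by
  rw [← M.dropMap_disc t (g.dropSnd h₂) h₁ h, ← M.shareMap_tensor_disc t g h₂,
    Category.assoc, Category.assoc, unitors_inv_equal, Iso.hom_inv_id, Category.comp_id]

theorem exists_shareMap_dropMap_tensor {Γ₁ Γ₂ Θ Θ₁ Θ₂ : Ctx} (g : Share c Γ₁ Γ₂ Θ)
    (δ₁ : Drop c Θ₁ Γ₁) (δ₂ : Drop c Θ₂ Γ₂) (h₁ : Θ₁.NonLinear) (h₂ : Θ₂.NonLinear) {X Y : C}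
    (f₁ : M.ctxC Θ₁ ⟶ X) (f₂ : M.ctxC Θ₂ ⟶ Y) :
    ∃ (Θ₀ : Ctx) (_ : Θ₀.NonLinear) (δ : Drop c Θ₀ Θ) (g₀ : Share c Θ₁ Θ₂ Θ₀),
      M.shareMap t g ≫ ((M.dropMap t δ₁ ≫ f₁) ⊗ₘ (M.dropMap t δ₂ ≫ f₂)) =
        M.dropMap t δ ≫ M.shareMap t g₀ ≫ (f₁ ⊗ₘ f₂) := by
  have k := g.dropBoth δ₁ δ₂
  refine ⟨_, k.join_nonLinear h₁ h₂, k.dropJoin, k.join, ?_⟩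
  rw [reassoc_of% M.dropMap_share t k.dropJoin k.join k, ← tensorHom_comp_tensorHom,
    reassoc_of% M.shareMap_dropBoth t g δ₁ δ₂ k]

/-- A class `Q` of denotations that may be substituted for variables: it contains the variables and
is closed under weakening, its members commute with discarding and copying because they lie in the
image of `L`, and those of non-linear type factor through members in the image of `F`. -/
structure Substitutable (Q : (Θ : Ctx) → Tm → (A : Ty) → (M.ctxC Θ ⟶ M.tyC A) → Prop) : Prop where
  denotes {Θ : Ctx} {v : Tm} {A : Ty} {f : M.ctxC Θ ⟶ M.tyC A} : Q Θ v A f → M.Denotes t Θ v A f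
  shift {Θ : Ctx} {v : Tm} {A : Ty} {f : M.ctxC Θ ⟶ M.tyC A} :
    Q Θ v A f → Q (none :: Θ) (v.rename Nat.succ) A f
  isImage {Θ : Ctx} {v : Tm} {A : Ty} {f : M.ctxC Θ ⟶ M.tyC A} :
    Q Θ v A f → Transport.IsImage (M.ctxIsoC Θ) (M.tyIsoC A) f
  exists_isImage {Θ : Ctx} {v : Tm} {A : Ty} {f : M.ctxC Θ ⟶ M.tyC A} (h : A.NonLinear) :
    Q Θ v A f → ∃ (Θ₀ : Ctx) (h₀ : Θ₀.NonLinear) (δ : Drop c Θ₀ Θ) (f₀ : M.ctxC Θ₀ ⟶ M.tyC A),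
      Q Θ₀ v A f₀ ∧ f = M.dropMap t δ ≫ f₀ ∧ Transport.IsImage (M.ctxIsoF Θ₀ h₀) (M.tyIsoF A h) f₀
  var {Θ : Ctx} {A : Ty} (s : Single 0 A Θ) : Q Θ (.var 0) A (M.singleMap t s)

/-- `Env Q Θ σ Γ s`: the simultaneous substitution `σ` assigns to each variable of `Γ` a term with
denotation in `Q`, where `Θ` is distributed over these terms, and `s` is the induced morphism. -/
inductive Env (Q : (Θ : Ctx) → Tm → (A : Ty) → (M.ctxC Θ ⟶ M.tyC A) → Prop) :
    (Θ : Ctx) → (ℕ → Tm) → (Γ : Ctx) → (M.ctxC Θ ⟶ M.ctxC Γ) → Prop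
  | nil {Θ : Ctx} {σ : ℕ → Tm} (h : Ctx.Discardable c Θ) : Env Q Θ σ [] (M.discMap t Θ h)
  | none {Θ Γ : Ctx} {σ : ℕ → Tm} {s : M.ctxC Θ ⟶ M.ctxC Γ} (e : Env Q Θ (fun i => σ (i + 1)) Γ s) :
      Env Q Θ σ (none :: Γ) s
  | some {Θ₁ Θ₂ Θ Γ : Ctx} {σ : ℕ → Tm} {A : Ty} {s : M.ctxC Θ₁ ⟶ M.ctxC Γ}
      {f : M.ctxC Θ₂ ⟶ M.tyC A} (g : Share c Θ₁ Θ₂ Θ) (e : Env Q Θ₁ (fun i => σ (i + 1)) Γ s)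
      (q : Q Θ₂ (σ 0) A f) : Env Q Θ σ (some A :: Γ) (M.shareMap t g ≫ (s ⊗ₘ f))

/-- `OptEnv Q Θ v o f`: the counterpart of `Env` for a single entry `o` of a context. -/
inductive OptEnv (Q : (Θ : Ctx) → Tm → (A : Ty) → (M.ctxC Θ ⟶ M.tyC A) → Prop) (Θ : Ctx)
    (v : Tm) : (o : Option Ty) → (M.ctxC Θ ⟶ M.optC o) → Prop
  | none (h : Ctx.Discardable c Θ) : OptEnv Q Θ v none (M.discMap t Θ h)
  | some {A : Ty} {f : M.ctxC Θ ⟶ M.tyC A} (q : Q Θ v A f) : OptEnv Q Θ v (some A) f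

section

variable {M t} {Q : (Θ : Ctx) → Tm → (A : Ty) → (M.ctxC Θ ⟶ M.tyC A) → Prop}

theorem Env.congr {Θ Γ : Ctx} {σ : ℕ → Tm} {s s' : M.ctxC Θ ⟶ M.ctxC Γ} (e : M.Env t Q Θ σ Γ s)
    (h : s = s') : M.Env t Q Θ σ Γ s' := h ▸ e

theorem Env.weaken {Θ Θ' Γ : Ctx} {σ : ℕ → Tm} {s : M.ctxC Θ ⟶ M.ctxC Γ} (e : M.Env t Q Θ σ Γ s)
    (d : Drop c Θ Θ') : M.Env t Q Θ' σ Γ (M.dropMap t d ≫ s) := by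
  induction e generalizing Θ' with
  | nil h => exact (Env.nil (d.discardable h)).congr (M.dropMap_disc t d _ _).symm
  | none _ ih => exact .none (ih d)
  | some g e q _ =>
    refine (Env.some (g.dropFirst d) e q).congr ?_
    rw [← M.dropMap_share t d g, Category.assoc]

theorem Env.cons {Θ₁ Θ₂ Θ Γ : Ctx} {σ : ℕ → Tm} {o : Option Ty} {s : M.ctxC Θ₁ ⟶ M.ctxC Γ}
    {f : M.ctxC Θ₂ ⟶ M.optC o} (g : Share c Θ₁ Θ₂ Θ) (e : M.Env t Q Θ₁ (fun i => σ (i + 1)) Γ s)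
    (q : M.OptEnv t Q Θ₂ (σ 0) o f) :
    M.Env t Q Θ σ (o :: Γ) (M.shareMap t g ≫ (s ⊗ₘ f) ≫ (M.consIso o Γ).inv) := by
  cases q with
  | none h =>
    exact (e.weaken (g.dropSnd h)).none.congr (M.shareMap_tensor_disc t g h _ s).symm
  | some q => exact (Env.some g e q).congr (congrArg _ (Category.comp_id _).symm)

section Substitutable

variable (hQ : M.Substitutable t Q)
include hQ

theorem Substitutable.disc {Θ : Ctx} {v : Tm} {A : Ty} {f : M.ctxC Θ ⟶ M.tyC A} (q : Q Θ v A f)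
    (h : Ty.Discardable c A) :
    ∃ h' : Ctx.Discardable c Θ, f ≫ M.discTy t A h = M.discMap t Θ h' := by
  cases c with
  | linear =>
    obtain ⟨Θ₀, h₀, δ, f₀, -, rfl, i⟩ := hQ.exists_isImage h q
    refine ⟨δ.discardable (h₀.discardable _), ?_⟩
    rw [← M.dropMap_disc t δ (h₀.discardable _), ← M.discard_eq t Θ₀ h₀, Category.assoc]
    exact congrArg _ i.discard
  | affine =>
    refine ⟨Ctx.discardable_affine Θ, ?_⟩
    obtain ⟨k, hk⟩ := (hQ.isImage q).comp (M.isImage_discTy t A h)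
    obtain ⟨k', hk'⟩ := M.isImage_discMap t Θ (Ctx.discardable_affine Θ)
    rw [hk, hk', IsTerminal.hom_ext t k k']

theorem Env.isImage {Θ Γ : Ctx} {σ : ℕ → Tm} {s : M.ctxC Θ ⟶ M.ctxC Γ} (e : M.Env t Q Θ σ Γ s) :
    Transport.IsImage (M.ctxIsoC Θ) (M.ctxIsoC Γ) s := by
  induction e with
  | nil h => exact M.isImage_discMap t _ h
  | none _ ih => exact ih
  | some g _ q ih => exact (M.isImage_shareMap t g).comp (ih.tensor (hQ.isImage q))

theorem Env.exists_isImage {Θ Γ : Ctx} {σ : ℕ → Tm} {s : M.ctxC Θ ⟶ M.ctxC Γ}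
    (e : M.Env t Q Θ σ Γ s) (h : Γ.NonLinear) :
    ∃ (Θ₀ : Ctx) (h₀ : Θ₀.NonLinear) (δ : Drop c Θ₀ Θ) (s₀ : M.ctxC Θ₀ ⟶ M.ctxC Γ),
      M.Env t Q Θ₀ σ Γ s₀ ∧ s = M.dropMap t δ ≫ s₀ ∧
        Transport.IsImage (M.ctxIsoF Θ₀ h₀) (M.ctxIsoF Γ h) s₀ := by
  induction e with
  | nil h' =>
    obtain ⟨E, hE, ⟨δ⟩⟩ := h'.exists_empty
    refine ⟨E, hE.nonLinear, δ, M.discMap t E (hE.nonLinear.discardable c), .nil _,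
      (M.dropMap_disc t δ _ _).symm, ?_⟩
    rw [ctxIsoF_nil]
    exact M.isImage_discMap_of_nonLinear t E _ _
  | none e ih =>
    obtain ⟨Θ₀, h₀, δ, s₀, e₀, rfl, i⟩ := ih h
    exact ⟨Θ₀, h₀, δ, s₀, .none e₀, rfl, i⟩
  | some g e q ih =>
    obtain ⟨Θ₁, h₁, δ₁, s₁, e₁, rfl, i₁⟩ := ih h.1
    obtain ⟨Θ₂, h₂, δ₂, f₂, q₂, rfl, i₂⟩ := hQ.exists_isImage h.2 q
    obtain ⟨Θ₀, h₀, δ, g₀, eq⟩ := M.exists_shareMap_dropMap_tensor t g δ₁ δ₂ h₁ h₂ s₁ f₂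
    refine ⟨Θ₀, h₀, δ, _, .some g₀ e₁ q₂, eq, ?_⟩
    rw [ctxIsoF_cons]
    exact (M.isImage_shareMap_of_nonLinear t g₀ h₁ h₂ _).comp (i₁.tensor i₂)

theorem Env.disc {Θ Γ : Ctx} {σ : ℕ → Tm} {s : M.ctxC Θ ⟶ M.ctxC Γ} (e : M.Env t Q Θ σ Γ s)
    (h : Ctx.Discardable c Γ) :
    ∃ h' : Ctx.Discardable c Θ, s ≫ M.discMap t Γ h = M.discMap t Θ h' := by
  cases c with
  | linear =>
    have h' := Ctx.Discardable.nonLinear h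
    obtain ⟨Θ₀, h₀, δ, s₀, -, rfl, i⟩ := e.exists_isImage hQ h'
    refine ⟨δ.discardable (h₀.discardable _), ?_⟩
    rw [← M.dropMap_disc t δ (h₀.discardable _), ← M.discard_eq t Θ₀ h₀, Category.assoc,
      ← M.discard_eq t Γ h']
    exact congrArg _ i.discard
  | affine => exact ⟨Ctx.discardable_affine Θ, M.comp_discMap_affine t (e.isImage hQ) _ _⟩

theorem Env.drop {Θ Γ Γ' : Ctx} {σ : ℕ → Tm} {s : M.ctxC Θ ⟶ M.ctxC Γ} (e : M.Env t Q Θ σ Γ s)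
    (d : Drop c Γ' Γ) : M.Env t Q Θ σ Γ' (s ≫ M.dropMap t d) := by
  induction e generalizing Γ' with
  | nil h =>
    cases d
    exact (Env.nil h).congr (by simp [dropMap])
  | none _ ih =>
    cases d with | cons l d =>
    cases l
    rw [dropMap_keep_none]
    exact .none (ih d)
  | some g _ q ih =>
    cases d with | cons l d =>
    cases l with
    | keep =>
      rw [dropMap_keep_some, Category.assoc, ← tensorHom_id, tensorHom_comp_tensorHom,
        Category.comp_id]
      exact .some g (ih d) q
    | drop A h =>
      obtain ⟨h', eq⟩ := hQ.disc q h
      refine ((ih d).weaken (g.dropSnd h')).none.congr ?_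
      rw [dropMap_drop, Category.assoc, tensorHom_comp_tensorHom_assoc, eq,
        M.shareMap_tensor_disc t g]

theorem Env.lookup {Θ S : Ctx} {σ : ℕ → Tm} {s : M.ctxC Θ ⟶ M.ctxC S} (e : M.Env t Q Θ σ S s)
    {i : ℕ} {A : Ty} (j : Single i A S) : M.Denotes t Θ (σ i) A (s ≫ M.singleMap t j) := by
  induction j generalizing Θ σ with
  | zero A hE =>
    cases e with | some g e q =>
    have hE' := hE.nonLinear.discardable c
    obtain ⟨h, eq⟩ := e.disc hQ hE'
    refine ((hQ.denotes q).weaken (g.swap.dropSnd h)).congr ?_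
    rw [← M.shareMap_disc_tensor t g h, ← eq, ← tensorHom_comp_whiskerRight]
    simp only [singleMap, Category.assoc]
  | succ j ih =>
    cases e with | none e =>
    exact ih e

theorem Substitutable.share {Θ : Ctx} {v : Tm} {A : Ty} {f : M.ctxC Θ ⟶ M.tyC A}
    (q : Q Θ v A f) {o₁ o₂ : Option Ty} (l : OptShare c o₁ o₂ (Option.some A)) :
    ∃ (Θ₁ Θ₂ : Ctx) (g : Share c Θ₁ Θ₂ Θ) (f₁ : M.ctxC Θ₁ ⟶ M.optC o₁)
      (f₂ : M.ctxC Θ₂ ⟶ M.optC o₂), M.OptEnv t Q Θ₁ v o₁ f₁ ∧ M.OptEnv t Q Θ₂ v o₂ f₂ ∧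
        f ≫ M.optShareMap t l = M.shareMap t g ≫ (f₁ ⊗ₘ f₂) := by
  cases l with
  | drop A h =>
    obtain ⟨h', eq⟩ := hQ.disc q h
    obtain ⟨E, hE, ⟨δ⟩⟩ := h'.exists_empty
    refine ⟨E, E, .dropFirst δ (.diag hE.nonLinear), _, _, .none (hE.nonLinear.discardable c),
      .none (hE.nonLinear.discardable c), ?_⟩
    rw [M.shareMap_disc t _ _ _ h', optShareMap, reassoc_of% eq]
  | left A =>
    obtain ⟨E, hE, ⟨g⟩⟩ := Share.exists_unit (c := c) Θ
    refine ⟨Θ, E, g, _, _, .some q, .none (hE.nonLinear.discardable c), ?_⟩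
    rw [optShareMap, Iso.comp_inv_eq, Category.assoc, M.shareMap_tensor_disc t g _ (.refl _),
      dropMap_refl, Category.id_comp]
  | right A =>
    obtain ⟨E, hE, ⟨g⟩⟩ := Share.exists_unit (c := c) Θ
    refine ⟨E, Θ, g.swap, _, _, .none (hE.nonLinear.discardable c), .some q, ?_⟩
    rw [optShareMap, Iso.comp_inv_eq, Category.assoc, M.shareMap_disc_tensor t g.swap _ (.refl _),
      dropMap_refl, Category.id_comp]
  | both A h =>
    obtain ⟨Θ₀, h₀, δ, f₀, q₀, rfl, i⟩ := hQ.exists_isImage h q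
    refine ⟨Θ₀, Θ₀, .dropFirst δ (.diag h₀), _, _, .some q₀, .some q₀, ?_⟩
    rw [← M.dropMap_share t δ (.diag h₀), ← M.copy_eq t h₀, Category.assoc, Category.assoc]
    exact congrArg _ i.copy

theorem Env.share {Θ Γ Γ₁ Γ₂ : Ctx} {σ : ℕ → Tm} {s : M.ctxC Θ ⟶ M.ctxC Γ}
    (e : M.Env t Q Θ σ Γ s) (g : Share c Γ₁ Γ₂ Γ) :
    ∃ (Θ₁ Θ₂ : Ctx) (g' : Share c Θ₁ Θ₂ Θ) (s₁ : M.ctxC Θ₁ ⟶ M.ctxC Γ₁)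
      (s₂ : M.ctxC Θ₂ ⟶ M.ctxC Γ₂), M.Env t Q Θ₁ σ Γ₁ s₁ ∧ M.Env t Q Θ₂ σ Γ₂ s₂ ∧
        s ≫ M.shareMap t g = M.shareMap t g' ≫ (s₁ ⊗ₘ s₂) := by
  induction e generalizing Γ₁ Γ₂ with
  | nil h =>
    cases g
    obtain ⟨E, hE, ⟨δ⟩⟩ := h.exists_empty
    refine ⟨E, E, .dropFirst δ (.diag hE.nonLinear), _, _, .nil (hE.nonLinear.discardable c),
      .nil (hE.nonLinear.discardable c), ?_⟩
    exact (M.shareMap_disc t _ _ _ h).symm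
  | none _ ih =>
    cases g with | cons l g =>
    cases l
    obtain ⟨Θ₁, Θ₂, g', s₁, s₂, e₁, e₂, eq⟩ := ih g
    exact ⟨Θ₁, Θ₂, g', s₁, s₂, .none e₁, .none e₂, by rw [shareMap_none, eq]⟩
  | some h _ q ih =>
    cases g with | @cons o₁ o₂ _ Γ₁ Γ₂ _ l g =>
    obtain ⟨Θ₁, Θ₂, g', s₁, s₂, e₁, e₂, eq⟩ := ih g
    obtain ⟨Θ₁', Θ₂', g'', f₁, f₂, q₁, q₂, eq'⟩ := hQ.share q l
    obtain ⟨Δ₁, Δ₂, ⟨k⟩, ⟨k₁⟩, ⟨k₂⟩⟩ := h.exists_interchange g' g''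
    have ex := M.shareMap_interchange t h g' g'' k k₁ k₂
    refine ⟨Δ₁, Δ₂, k, _, _, .cons k₁ e₁ q₁, .cons k₂ e₂ q₂, ?_⟩
    rw [← tensorHom_comp_tensorHom, ← reassoc_of% ex, ← tensorHom_comp_tensorHom,
      ← tensorμ_natural_assoc, tensorHom_comp_tensorHom_assoc, ← eq, ← eq', shareMap, consIso,
      Iso.refl_hom, Category.id_comp, ← tensorHom_comp_tensorHom]
    simp only [Category.assoc]

theorem Env.shift {Θ Γ : Ctx} {σ : ℕ → Tm} {s : M.ctxC Θ ⟶ M.ctxC Γ} (e : M.Env t Q Θ σ Γ s) :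
    M.Env t Q (Option.none :: Θ) (fun i => (σ i).rename Nat.succ) Γ s := by
  induction e with
  | nil h => exact Env.nil (Θ := Option.none :: _) h
  | none _ ih => exact .none ih
  | some g _ q ih =>
    refine (Env.some (Share.cons .none g) ih (hQ.shift q)).congr ?_
    rw [shareMap_none]

theorem Env.up {Θ Γ : Ctx} {σ : ℕ → Tm} {s : M.ctxC Θ ⟶ M.ctxC Γ} (e : M.Env t Q Θ σ Γ s) (A : Ty) :
    M.Env t Q (Option.some A :: Θ) (Tm.upSub σ) (Option.some A :: Γ) (s ▷ M.tyC A) := by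
  obtain ⟨E, hE, ⟨g⟩⟩ := Share.exists_unit (c := c) Θ
  have hs := M.shareMap_tensor_disc t g (hE.nonLinear.discardable c) (.refl _) s
  rw [dropMap_refl, Category.id_comp] at hs
  refine (Env.some (σ := Tm.upSub σ) (Share.cons (.right A) g) (e.shift hQ)
    (hQ.var (.zero A hE))).congr ?_
  calc M.shareMap t (Share.cons (.right A) g) ≫ (s ⊗ₘ M.discMap t E _ ▷ M.tyC A ≫ (λ_ _).hom)
      = M.shareMap t g ▷ M.tyC A ≫ (α_ _ _ _).hom ≫
          (s ⊗ₘ (M.discMap t E _ ⊗ₘ 𝟙 _)) ≫ M.ctxC _ ◁ (λ_ _).hom := by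
        rw [shareMap_right, Category.assoc, tensorHom_id, tensorHom_comp_whiskerLeft]
    _ = (M.shareMap t g ≫ (s ⊗ₘ M.discMap t E _) ≫ (ρ_ _).hom) ▷ M.tyC A := by
        rw [← associator_naturality_assoc, triangle, tensorHom_id, comp_whiskerRight,
          comp_whiskerRight]
    _ = s ▷ M.tyC A := by rw [hs]

theorem Env.id (Γ : Ctx) : M.Env t Q Γ Tm.var Γ (𝟙 _) := by
  induction Γ with
  | nil => exact Env.nil (Θ := []) trivial
  | cons o Γ ih =>
    cases o with
    | none => exact .none (ih.shift hQ)
    | some A =>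
      have h := ih.up hQ A
      rwa [Tm.upSub_var, id_whiskerRight] at h

theorem Denotes.subst {Θ Γ : Ctx} {σ : ℕ → Tm} {s : M.ctxC Θ ⟶ M.ctxC Γ} {m : Tm} {A : Ty}
    {f : M.ctxC Γ ⟶ M.tyC A} (h : M.Denotes t Γ m A f) (e : M.Env t Q Θ σ Γ s) :
    M.Denotes t Θ (m.subst σ) A (s ≫ f) := by
  induction h generalizing Θ σ with
  | var j d => exact ((e.drop hQ d).lookup hQ j).congr (Category.assoc ..)
  | star h =>
    obtain ⟨h', eq⟩ := e.disc hQ h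
    exact (Denotes.star h').congr eq.symm
  | lift h d _ ih =>
    obtain ⟨Θ₀, h₀, δ, s₀, e₀, eq, i⟩ := (e.drop hQ d).exists_isImage hQ h
    refine (Denotes.lift h₀ δ (ih e₀)).congr ?_
    rw [← M.comp_liftMap h₀ h i, reassoc_of% eq]
  | recur h d _ ih =>
    obtain ⟨Θ₀, h₀, δ, s₀, e₀, eq, i⟩ := (e.drop hQ d).exists_isImage hQ h
    refine (Denotes.recur h₀ δ (ih (e₀.up hQ _))).congr ?_
    rw [← M.comp_recMap h₀ h i, reassoc_of% eq]
  | force _ ih => exact (Denotes.force (ih e)).congr (Category.assoc ..)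
  | left _ ih => exact (Denotes.left (ih e)).congr (Category.assoc ..)
  | right _ ih => exact (Denotes.right (ih e)).congr (Category.assoc ..)
  | lam _ ih =>
    refine (Denotes.lam (ih (e.up hQ _))).congr ?_
    rw [M.comp_curry (e.isImage hQ)]
  | seq g _ _ ihm ihn =>
    obtain ⟨Θ₁, Θ₂, g', s₁, s₂, e₁, e₂, eq⟩ := e.share hQ g
    refine (Denotes.seq g' (ihm e₁) (ihn e₂)).congr ?_
    rw [reassoc_of% eq, comp_seqMap]
  | case g _ _ _ ihm ihn ihp =>
    obtain ⟨Θ₁, Θ₂, g', s₁, s₂, e₁, e₂, eq⟩ := e.share hQ g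
    refine (Denotes.case g' (ihm e₁) (ihn (e₂.up hQ _)) (ihp (e₂.up hQ _))).congr ?_
    rw [reassoc_of% eq, comp_caseMap]
  | pair g _ _ ihm ihn =>
    obtain ⟨Θ₁, Θ₂, g', s₁, s₂, e₁, e₂, eq⟩ := e.share hQ g
    refine (Denotes.pair g' (ihm e₁) (ihn e₂)).congr ?_
    rw [reassoc_of% eq, tensorHom_comp_tensorHom]
  | letPair g _ _ ihm ihn =>
    obtain ⟨Θ₁, Θ₂, g', s₁, s₂, e₁, e₂, eq⟩ := e.share hQ g
    refine (Denotes.letPair g' (ihm e₁) (ihn ((e₂.up hQ _).up hQ _))).congr ?_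
    rw [reassoc_of% eq, comp_letPairMap]
  | app g _ _ ihm ihn =>
    obtain ⟨Θ₁, Θ₂, g', s₁, s₂, e₁, e₂, eq⟩ := e.share hQ g
    refine (Denotes.app g' (ihm e₁) (ihn e₂)).congr ?_
    rw [reassoc_of% eq, comp_appMap]

end Substitutable

end

/-! ### Evaluation -/

/-- The denotations of variables in minimal contexts: substituting them yields renaming. -/
inductive DenotesVar : (Θ : Ctx) → Tm → (A : Ty) → (M.ctxC Θ ⟶ M.tyC A) → Prop
  | mk {Θ : Ctx} {i : ℕ} {A : Ty} (s : Single i A Θ) : DenotesVar Θ (.var i) A (M.singleMap t s)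

/-- The denotations of values, the terms that evaluation substitutes for variables. -/
def DenotesValue (Θ : Ctx) (v : Tm) (A : Ty) (f : M.ctxC Θ ⟶ M.tyC A) : Prop :=
  IsValue v ∧ M.Denotes t Θ v A f

variable {M t}

theorem substitutable_denotesVar : M.Substitutable t (M.DenotesVar t) where
  denotes := by
    rintro _ _ _ _ ⟨s⟩
    refine (Denotes.var s (.refl _)).congr ?_
    rw [dropMap_refl, Category.id_comp]
  shift := by
    rintro _ _ _ _ ⟨s⟩
    exact .mk (.succ s)
  isImage := by
    rintro _ _ _ _ ⟨s⟩
    exact M.isImage_singleMap t s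
  exists_isImage := by
    rintro _ _ _ _ h ⟨s⟩
    exact ⟨_, s.nonLinear h, .refl _, _, .mk s, by rw [dropMap_refl, Category.id_comp],
      M.isImage_singleMap_of_nonLinear t s _ _⟩
  var s := .mk s

theorem Denotes.shift {Θ : Ctx} {m : Tm} {A : Ty} {f : M.ctxC Θ ⟶ M.tyC A}
    (h : M.Denotes t Θ m A f) : M.Denotes t (none :: Θ) (m.rename Nat.succ) A f := by
  rw [Tm.rename_eq_subst]
  have hQ := substitutable_denotesVar (M := M) (t := t)
  exact (h.subst hQ ((Env.id hQ Θ).shift hQ)).congr (Category.id_comp f)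

theorem Denotes.isImage_of_isValue {Θ : Ctx} {v : Tm} {A : Ty} {f : M.ctxC Θ ⟶ M.tyC A}
    (h : M.Denotes t Θ v A f) (hv : IsValue v) :
    Transport.IsImage (M.ctxIsoC Θ) (M.tyIsoC A) f := by
  induction h with
  | var s d => exact (M.isImage_dropMap t d).comp (M.isImage_singleMap t s)
  | star h => exact M.isImage_discMap t _ h
  | lift h d _ => exact (M.isImage_dropMap t d).comp (M.isImage_liftMap h _)
  | left _ ih => cases hv with | left hv => exact (ih hv).comp (M.isImage_inl _ _)
  | right _ ih => cases hv with | right hv => exact (ih hv).comp (M.isImage_inr _ _)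
  | lam _ => exact M.isImage_curry _
  | pair g _ _ ihm ihn =>
    cases hv with | pair hv hw =>
    exact (M.isImage_shareMap t g).comp ((ihm hv).tensor (ihn hw))
  | recur | force | seq | case | letPair | app => cases hv

theorem Denotes.exists_isImage_of_isValue {Θ : Ctx} {v : Tm} {A : Ty} {f : M.ctxC Θ ⟶ M.tyC A}
    (h : M.Denotes t Θ v A f) (hv : IsValue v) (hA : A.NonLinear) :
    ∃ (Θ₀ : Ctx) (h₀ : Θ₀.NonLinear) (δ : Drop c Θ₀ Θ) (f₀ : M.ctxC Θ₀ ⟶ M.tyC A),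
      M.Denotes t Θ₀ v A f₀ ∧ f = M.dropMap t δ ≫ f₀ ∧
        Transport.IsImage (M.ctxIsoF Θ₀ h₀) (M.tyIsoF A hA) f₀ := by
  induction h with
  | var s d =>
    exact ⟨_, s.nonLinear hA, d, _, substitutable_denotesVar.denotes (.mk s), rfl,
      M.isImage_singleMap_of_nonLinear t s _ _⟩
  | star h =>
    obtain ⟨E, hE, ⟨δ⟩⟩ := h.exists_empty
    refine ⟨E, hE.nonLinear, δ, _, .star (hE.nonLinear.discardable c),
      (M.dropMap_disc t δ _ _).symm, ?_⟩
    rw [tyIsoF_unit]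
    exact M.isImage_discMap_of_nonLinear t E _ _
  | lift h d hm =>
    refine ⟨_, h, d, _, (Denotes.lift h (.refl _) hm).congr ?_, rfl,
      M.isImage_liftMap_of_nonLinear h _ _⟩
    rw [dropMap_refl, Category.id_comp]
  | left hm ih =>
    cases hv with | left hv =>
    obtain ⟨Θ₀, h₀, δ, f₀, hf, rfl, i⟩ := ih hv hA.1
    exact ⟨Θ₀, h₀, δ, _, .left hf, Category.assoc .., i.comp (M.isImage_inl_of_nonLinear hA)⟩
  | right hm ih =>
    cases hv with | right hv =>
    obtain ⟨Θ₀, h₀, δ, f₀, hf, rfl, i⟩ := ih hv hA.2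
    exact ⟨Θ₀, h₀, δ, _, .right hf, Category.assoc .., i.comp (M.isImage_inr_of_nonLinear hA)⟩
  | lam _ => exact hA.elim
  | pair g hm hn ihm ihn =>
    cases hv with | pair hv hw =>
    obtain ⟨Θ₁, h₁, δ₁, f₁, hf₁, rfl, i₁⟩ := ihm hv hA.1
    obtain ⟨Θ₂, h₂, δ₂, f₂, hf₂, rfl, i₂⟩ := ihn hw hA.2
    obtain ⟨Θ₀, h₀, δ, g₀, eq⟩ := M.exists_shareMap_dropMap_tensor t g δ₁ δ₂ h₁ h₂ f₁ f₂
    refine ⟨Θ₀, h₀, δ, _, .pair g₀ hf₁ hf₂, eq, ?_⟩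
    rw [tyIsoF_tensor]
    exact (M.isImage_shareMap_of_nonLinear t g₀ h₁ h₂ _).comp (i₁.tensor i₂)
  | recur | force | seq | case | letPair | app => cases hv

theorem substitutable_denotesValue : M.Substitutable t (M.DenotesValue t) where
  denotes h := h.2
  shift h := ⟨h.1.rename _, h.2.shift⟩
  isImage h := h.2.isImage_of_isValue h.1
  exists_isImage hA h := by
    obtain ⟨Θ₀, h₀, δ, f₀, hf, e, i⟩ := h.2.exists_isImage_of_isValue h.1 hA
    exact ⟨Θ₀, h₀, δ, f₀, ⟨h.1, hf⟩, e, i⟩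
  var s := ⟨.var 0, substitutable_denotesVar.denotes (.mk s)⟩

theorem Denotes.subst1 {Γ Γ' Θ : Ctx} {m v : Tm} {A D : Ty} {f : M.ctxC (some A :: Γ) ⟶ M.tyC D}
    {k : M.ctxC Γ' ⟶ M.tyC A} (h : M.Denotes t (some A :: Γ) m D f) (hv : IsValue v)
    (h' : M.Denotes t Γ' v A k) (g : Share c Γ Γ' Θ) :
    M.Denotes t Θ (m.subst1 v) D (M.shareMap t g ≫ M.ctxC Γ ◁ k ≫ f) := by
  have hQ := substitutable_denotesValue (M := M) (t := t)
  refine (h.subst hQ (Env.some (σ := Tm.scons v .var) g (Env.id hQ Γ) ⟨hv, h'⟩)).congr ?_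
  rw [id_tensorHom, Category.assoc]

theorem Denotes.subst2 {Γ Γ' Γ₁ Γ₂ Θ : Ctx} {m v w : Tm} {A D E : Ty}
    {f : M.ctxC (some D :: some A :: Γ) ⟶ M.tyC E}
    {k : M.ctxC Γ₁ ⟶ M.tyC A} {l : M.ctxC Γ₂ ⟶ M.tyC D}
    (h : M.Denotes t (some D :: some A :: Γ) m E f) (hv : IsValue v) (hw : IsValue w)
    (h₁ : M.Denotes t Γ₁ v A k) (h₂ : M.Denotes t Γ₂ w D l) (g : Share c Γ Γ' Θ)
    (g' : Share c Γ₁ Γ₂ Γ') :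
    M.Denotes t Θ (m.subst2 v w) E
      (M.shareMap t g ≫ M.ctxC Γ ◁ (M.shareMap t g' ≫ (k ⊗ₘ l)) ≫ (α_ _ _ _).inv ≫ f) := by
  have hQ := substitutable_denotesValue (M := M) (t := t)
  obtain ⟨Δ, ⟨p⟩, ⟨q⟩⟩ := g.exists_assoc g'
  refine (h.subst hQ (Env.some (σ := Tm.scons w (Tm.scons v .var)) q
    (Env.some p (Env.id hQ Γ) ⟨hv, h₁⟩) ⟨hw, h₂⟩)).congr ?_
  have assoc : M.shareMap t q ≫ M.shareMap t p ▷ M.ctxC Γ₂ ≫ (α_ _ _ _).hom =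
      M.shareMap t g ≫ M.ctxC Γ ◁ M.shareMap t g' := M.shareMap_assoc t q p g g'
  have natural : M.ctxC Γ ◁ (k ⊗ₘ l) ≫ (α_ _ _ _).inv = (α_ _ _ _).inv ≫ (M.ctxC Γ ◁ k ⊗ₘ l) := by
    rw [← id_tensorHom, ← id_tensorHom, associator_inv_naturality]
  rw [whiskerLeft_comp, Category.assoc, Category.assoc, ← reassoc_of% assoc, reassoc_of% natural,
    Iso.hom_inv_id_assoc, id_tensorHom, ← whiskerRight_comp_tensorHom, Category.assoc]

theorem Denotes.case_left {Γ₁ Γ₂ Θ : Ctx} {v n : Tm} {A D E : Ty} {f : M.ctxC Γ₁ ⟶ M.tyC A}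
    {f' : M.ctxC (some A :: Γ₂) ⟶ M.tyC E} (h : M.Denotes t Γ₁ v A f) (hv : IsValue v)
    (hn : M.Denotes t (some A :: Γ₂) n E f') (g : Share c Γ₁ Γ₂ Θ)
    (f'' : M.ctxC (some D :: Γ₂) ⟶ M.tyC E) :
    M.Denotes t Θ (n.subst1 v) E (M.shareMap t g ≫
      M.caseMap (f ≫ (coprod.inl : M.tyC A ⟶ M.tyC A ⨿ M.tyC D)) f' f'') := by
  refine (hn.subst1 hv h g.swap).congr ?_
  rw [caseMap, whiskerLeft_comp, Category.assoc, reassoc_of% M.inl_distrib,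
    reassoc_of% M.shareMap_swap t g g.swap]
  congr 2
  exact (coprod.inl_desc _ _).symm

theorem Denotes.case_right {Γ₁ Γ₂ Θ : Ctx} {v p : Tm} {A D E : Ty} {f : M.ctxC Γ₁ ⟶ M.tyC D}
    {f'' : M.ctxC (some D :: Γ₂) ⟶ M.tyC E} (h : M.Denotes t Γ₁ v D f) (hv : IsValue v)
    (hp : M.Denotes t (some D :: Γ₂) p E f'') (g : Share c Γ₁ Γ₂ Θ)
    (f' : M.ctxC (some A :: Γ₂) ⟶ M.tyC E) :
    M.Denotes t Θ (p.subst1 v) E (M.shareMap t g ≫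
      M.caseMap (f ≫ (coprod.inr : M.tyC D ⟶ M.tyC A ⨿ M.tyC D)) f' f'') := by
  refine (hp.subst1 hv h g.swap).congr ?_
  rw [caseMap, whiskerLeft_comp, Category.assoc, reassoc_of% M.inr_distrib,
    reassoc_of% M.shareMap_swap t g g.swap]
  congr 2
  exact (coprod.inr_desc _ _).symm

theorem Denotes.letPair_pair {Γ₁ Γ₂ Γ Γ' Θ : Ctx} {v w n : Tm} {A D E : Ty}
    {k : M.ctxC Γ₁ ⟶ M.tyC A} {l : M.ctxC Γ₂ ⟶ M.tyC D}
    {f : M.ctxC (some D :: some A :: Γ) ⟶ M.tyC E} (h₁ : M.Denotes t Γ₁ v A k) (hv : IsValue v)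
    (h₂ : M.Denotes t Γ₂ w D l) (hw : IsValue w)
    (hn : M.Denotes t (some D :: some A :: Γ) n E f) (g' : Share c Γ₁ Γ₂ Γ')
    (g : Share c Γ' Γ Θ) :
    M.Denotes t Θ (n.subst2 v w) E
      (M.shareMap t g ≫ M.letPairMap (M.shareMap t g' ≫ (k ⊗ₘ l)) f) := by
  refine (hn.subst2 hv hw h₁ h₂ g.swap g').congr ?_
  rw [letPairMap, BraidedCategory.braiding_naturality_left_assoc,
    reassoc_of% M.shareMap_swap t g g.swap]

theorem Denotes.app_lam {Γ₁ Γ₂ Θ : Ctx} {m v : Tm} {A D : Ty}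
    {f : M.ctxC (some A :: Γ₁) ⟶ M.tyC D} {k : M.ctxC Γ₂ ⟶ M.tyC A}
    (h : M.Denotes t (some A :: Γ₁) m D f) (hv : IsValue v) (h' : M.Denotes t Γ₂ v A k)
    (g : Share c Γ₁ Γ₂ Θ) :
    M.Denotes t Θ (m.subst1 v) D
      (M.shareMap t g ≫ M.appMap ((M.ctxIsoC Γ₁).inv ≫ M.L.map (M.curry f)) k) := by
  refine (h.subst1 hv h' g).congr ?_
  rw [appMap, curry_eval]

theorem Denotes.force_lift {Φ Θ : Ctx} {m : Tm} {A : Ty} {f : M.ctxC Φ ⟶ M.tyC A}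
    (h : M.Denotes t Φ m A f) (hΦ : Φ.NonLinear) (d : Drop c Φ Θ) :
    M.Denotes t Θ m A ((M.dropMap t d ≫ M.liftMap hΦ f) ≫ M.adjFG.counit.app (M.tyC A)) := by
  refine (h.weaken d).congr ?_
  rw [Category.assoc, liftMap_counit]

theorem Denotes.recur_unfold {Φ Θ : Ctx} {m : Tm} {A : Ty}
    {f : M.ctxC (some (.bang A) :: Φ) ⟶ M.tyC A} (h : M.Denotes t (some (.bang A) :: Φ) m A f)
    (hΦ : Φ.NonLinear) (d : Drop c Φ Θ) :
    M.Denotes t Θ (m.subst1 (.lift (.recur A m))) A (M.dropMap t d ≫ M.recMap hΦ f) := by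
  have hr := Denotes.recur hΦ (.refl _) h
  have hl := Denotes.lift hΦ (.refl _) hr
  refine ((h.subst1 (.lift _) hl (.diag hΦ)).weaken d).congr ?_
  rw [dropMap_refl, Category.id_comp, Category.id_comp, ← M.copy_eq t hΦ, ← recMap_unfold]

theorem Denotes.eval {Γ : Ctx} {m v : Tm} {A : Ty} {f : M.ctxC Γ ⟶ M.tyC A}
    (h : M.Denotes t Γ m A f) (r : Eval m v) : M.Denotes t Γ v A f := by
  induction r generalizing Γ A with
  | var | star | lam | lift => exact h
  | seq _ _ ihm ihn =>
    cases h with | seq g hm hn =>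
    cases ihm hm with | star hd =>
    exact ((ihn hn).weaken (g.swap.dropSnd hd)).congr (M.shareMap_disc_tensor t g hd _ _).symm
  | left _ ih => cases h with | left hm => exact .left (ih hm)
  | right _ ih => cases h with | right hm => exact .right (ih hm)
  | caseLeft r _ ihm ihn =>
    cases h with | case g hm hn hp =>
    cases r.isValue with | left hv =>
    cases ihm hm with | left hw =>
    exact ihn (hw.case_left hv hn g _)
  | caseRight r _ ihm ihn =>
    cases h with | case g hm hn hp =>
    cases r.isValue with | right hv =>
    cases ihm hm with | right hw =>
    exact ihn (hw.case_right hv hp g _)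
  | pair _ _ ihm ihn => cases h with | pair g hm hn => exact .pair g (ihm hm) (ihn hn)
  | letPair r _ ihm ihn =>
    cases h with | letPair g hm hn =>
    cases r.isValue with | pair hv hw =>
    cases ihm hm with | pair g' h₁ h₂ =>
    exact ihn (h₁.letPair_pair hv h₂ hw hn g' g)
  | app _ r _ ihm ihn ihb =>
    cases h with | app g hm hn =>
    cases ihm hm with | lam hb =>
    exact ihb (hb.app_lam r.isValue (ihn hn) g)
  | force _ _ ihm ihn =>
    cases h with | force hm =>
    cases ihm hm with | lift hΦ d hb =>
    exact ihn (hb.force_lift hΦ d)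
  | recur _ ih =>
    cases h with | recur hΦ d hm =>
    exact ih (hm.recur_unfold hΦ d)

theorem interp_eq_of_eval {Γ : Ctx} {m v : Tm} {A : Ty} (r : Eval m v) (d : Der c Γ m A)
    (d' : Der c Γ v A) : M.interp t d = M.interp t d' :=
  ((denotes_interp d).eval r).unique (denotes_interp d')

theorem nonempty_der_of_eval (t : M.Supports c) {Γ : Ctx} {m v : Tm} {A : Ty} (r : Eval m v)
    (d : Der c Γ m A) : Nonempty (Der c Γ v A) :=
  ((denotes_interp (t := t) d).eval r).nonempty_der (.refl Γ)

end LinearModel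

/-! ### Subject reduction

In a model on the category with one morphism, interpretations carry no information, so that
preservation of interpretations under evaluation becomes a statement about derivations alone. -/

namespace OneMorphism

/-- The category with one object and one morphism. -/
def Point : Type := Discrete PUnit.{1}

instance : Category Point := inferInstanceAs (Category (Discrete PUnit.{1}))

instance : HasFiniteCoproducts Point := inferInstanceAs (HasFiniteCoproducts (Discrete PUnit.{1}))

instance (X Y : Point) : Unique (X ⟶ Y) where
  default := eqToHom (Subsingleton.elim (α := Discrete PUnit.{1}) X Y)
  uniq _ := ULift.ext _ _ rfl

/-- Terminality of any object of `Point`. -/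
def isTerminal (X : Point) : IsTerminal X := IsTerminal.ofUnique X

instance : CartesianMonoidalCategory Point :=
  .ofChosenFiniteProducts ⟨asEmptyCone ⟨⟨⟩⟩, isTerminal _⟩ fun X _ =>
    ⟨BinaryFan.mk (P := X) default default, BinaryFan.IsLimit.mk _ (fun _ _ => default)
      (fun _ _ => Subsingleton.elim _ _) (fun _ _ => Subsingleton.elim _ _)
      (fun _ _ _ _ _ => Subsingleton.elim _ _)⟩

instance : BraidedCategory Point := .ofCartesianMonoidalCategory

instance : SymmetricCategory Point where
  symmetry _ _ := Subsingleton.elim _ _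

/-- The adjunction between any two endofunctors of `Point`. -/
def adjunction (F G : Point ⥤ Point) : F ⊣ G :=
  Adjunction.mkOfHomEquiv { homEquiv := fun _ _ => Equiv.ofUnique _ _ }

/-- The model whose three categories are `Point`. -/
def model : LinearModel Point Point Point where
  J := 𝟭 _
  K := 𝟭 _
  L := 𝟭 _
  R := 𝟭 _
  adjJK := .id
  monoidalJK := inferInstance
  adjLR := .id
  monoidalLR := inferInstance
  hom _ := 𝟭 _
  adjHom _ := adjunction _ _
  omega _ := ⟨𝟙_ Point, default⟩
  omegaInitial _ := IsInitial.ofUniqueHom (fun _ => ⟨default, Subsingleton.elim _ _⟩)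
    (fun _ _ => Endofunctor.Algebra.Hom.ext (Subsingleton.elim _ _))
  omegaFinal _ := IsTerminal.ofUniqueHom (fun _ => ⟨default, Subsingleton.elim _ _⟩)
    (fun _ _ => Endofunctor.Coalgebra.Hom.ext (Subsingleton.elim _ _))

/-- The structure by which `model` interprets either calculus. -/
def supports : (c : Calculus) → model.Supports c
  | .linear => PUnit.unit
  | .affine => isTerminal (𝟙_ Point)

end OneMorphism

theorem Der.nonempty_of_eval {c : Calculus} {Γ : Ctx} {m v : Tm} {A : Ty} (d : Der c Γ m A)
    (r : Eval m v) : Nonempty (Der c Γ v A) :=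
  LinearModel.nonempty_der_of_eval (OneMorphism.supports c) r d

end

end SubLambda

theorem mainTheorem1
    {B : Type u₁} [Category.{v₁} B] [CartesianMonoidalCategory B]
    [BraidedCategory B] [HasFiniteCoproducts B]
    {V : Type u₂} [Category.{v₂} V] [MonoidalCategory V] [SymmetricCategory V]
    [HasFiniteCoproducts V]
    {C : Type u₃} [Category.{v₃} C] [MonoidalCategory C] [SymmetricCategory C]
    [HasFiniteCoproducts C] :
    (∀ (Γ : SubLambda.Ctx) (m v : SubLambda.Tm) (A : SubLambda.Ty)
        (d : SubLambda.Der .linear Γ m A), SubLambda.Eval m v →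
      Nonempty (SubLambda.Der .linear Γ v A) ∧
        ∀ (M : SubLambda.LinearModel B V C) (d' : SubLambda.Der .linear Γ v A),
          M.interpL d = M.interpL d') ∧
    (∀ (Γ : SubLambda.Ctx) (m v : SubLambda.Tm) (A : SubLambda.Ty)
        (d : SubLambda.Der .affine Γ m A), SubLambda.Eval m v →
      Nonempty (SubLambda.Der .affine Γ v A) ∧
        ∀ (M : SubLambda.AffineModel B V C) (d' : SubLambda.Der .affine Γ v A),
          M.interpA d = M.interpA d') :=
  ⟨fun _ _ _ _ d r => ⟨d.nonempty_of_eval r, fun _ d' =>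
      SubLambda.LinearModel.interp_eq_of_eval r d d'⟩,
    fun _ _ _ _ d r => ⟨d.nonempty_of_eval r, fun _ d' =>
      SubLambda.LinearModel.interp_eq_of_eval r d d'⟩⟩
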